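/- **Theorem.** The affine distance tariff design problem can be solved in linear time $O(|D|)$ on a real RAM. *The problem.* Given are a finite set $D$ of origin-destination pairs and, for every $d\in D$, a reference price $r_d\in\mathbb{R}_{\ge 0}$, a number of passengers $t_d\in\mathbb{N}_{\ge 1}$ and a distance $l_d\in\mathbb{R}_{\ge 0}$. The task is to determine a price per kilometer $p\in\mathbb{R}_{\ge 0}$ and a base amount $f\in\mathbb{R}_{\ge 0}$ for which $$\sum_{d\in D} t_d\,\bigl|r_d-(p\cdot l_d+f)\bigr|$$ is minimal among all $p,f\in\mathbb{R}_{\ge 0}$. *The machine.* A real RAM has variables and arrays for natural numbers and for real numbers; each of the operations $+,-,<$ on natural numbers, $+,-,\cdot,/,<$ on real numbers, each access to a variable, a constant or an array cell (with indirect addressing), and each execution of a control command (sequencing, branch, loop test, procedure call) costs one step. Real numbers cannot be rounded or converted to natural numbers. *Precisely:* there are a real-RAM program $P$ (a fixed finite text, independent of the instance) and a constant $C$ such that, for every instance $(D,(r_d),(t_d),(l_d))$ with its data stored in arrays in an arbitrary order of $D$, the program $P$ halts after at most $C\cdot(|D|+1)$ steps and outputs a pair $(p,f)$ that is an optimal solution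 of the instance. -/

import Mathlib

/-!
# A real random access machine with unit-cost steps

The machine has, for natural numbers and for real numbers separately, scalar variables and arrays
(with indirect addressing). Natural numbers can be added, subtracted (truncated) and compared; real
numbers can be added, subtracted, multiplied, divided and compared. There is no rounding and no
conversion of real numbers to natural numbers. Programs are finite texts: they are built by
sequencing, branching, loops and calls of finitely many (possibly recursive) parameterless
procedures. Every node of an evaluated expression and every executed command costs one step.
-/

namespace RealRAM

/-- The memory: variables and arrays are named by natural numbers; a program mentions only finitely
many names. -/
structure State where
  natVar : ℕ → ℕ
  realVar : ℕ → ℝ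
  natArr : ℕ → ℕ → ℕ
  realArr : ℕ → ℕ → ℝ

/-- Expressions with values in the natural numbers. `read a e` is the cell of the array `a` whose
index is the value of `e`. -/
inductive NExp where
  | const (c : ℕ)
  | var (i : ℕ)
  | read (a : ℕ) (e : NExp)
  | add (e₁ e₂ : NExp)
  | sub (e₁ e₂ : NExp)

/-- Expressions with values in the real numbers; literals are rational. -/
inductive RExp where
  | const (q : ℚ)
  | var (i : ℕ)
  | read (a : ℕ) (e : NExp)
  | add (e₁ e₂ : RExp)
  | sub (e₁ e₂ : RExp)
  | mul (e₁ e₂ : RExp)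
  | div (e₁ e₂ : RExp)

/-- Tests for branches and loops. -/
inductive BExp where
  | natLt (e₁ e₂ : NExp)
  | realLt (e₁ e₂ : RExp)
  | not (b : BExp)
  | and (b₁ b₂ : BExp)

def NExp.eval (s : State) : NExp → ℕ
  | .const c => c
  | .var i => s.natVar i
  | .read a e => s.natArr a (e.eval s)
  | .add e₁ e₂ => e₁.eval s + e₂.eval s
  | .sub e₁ e₂ => e₁.eval s - e₂.eval s

/-- Division by zero returns zero; a program can test the divisor beforehand. -/
noncomputable def RExp.eval (s : State) : RExp → ℝ
  | .const q => (q : ℝ)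
  | .var i => s.realVar i
  | .read a e => s.realArr a (e.eval s)
  | .add e₁ e₂ => e₁.eval s + e₂.eval s
  | .sub e₁ e₂ => e₁.eval s - e₂.eval s
  | .mul e₁ e₂ => e₁.eval s * e₂.eval s
  | .div e₁ e₂ => e₁.eval s / e₂.eval s

def BExp.Holds (s : State) : BExp → Prop
  | .natLt e₁ e₂ => e₁.eval s < e₂.eval s
  | .realLt e₁ e₂ => e₁.eval s < e₂.eval s
  | .not b => ¬ b.Holds s
  | .and b₁ b₂ => b₁.Holds s ∧ b₂.Holds s

/-- The cost of evaluating an expression is its number of nodes. -/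
def NExp.cost : NExp → ℕ
  | .const _ => 1
  | .var _ => 1
  | .read _ e => e.cost + 1
  | .add e₁ e₂ => e₁.cost + e₂.cost + 1
  | .sub e₁ e₂ => e₁.cost + e₂.cost + 1

def RExp.cost : RExp → ℕ
  | .const _ => 1
  | .var _ => 1
  | .read _ e => e.cost + 1
  | .add e₁ e₂ => e₁.cost + e₂.cost + 1
  | .sub e₁ e₂ => e₁.cost + e₂.cost + 1
  | .mul e₁ e₂ => e₁.cost + e₂.cost + 1
  | .div e₁ e₂ => e₁.cost + e₂.cost + 1

def BExp.cost : BExp → ℕ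
  | .natLt e₁ e₂ => e₁.cost + e₂.cost + 1
  | .realLt e₁ e₂ => e₁.cost + e₂.cost + 1
  | .not b => b.cost + 1
  | .and b₁ b₂ => b₁.cost + b₂.cost + 1

inductive Cmd where
  | skip
  /-- variable `i` := value of `e` -/
  | setNat (i : ℕ) (e : NExp)
  | setReal (i : ℕ) (e : RExp)
  /-- cell `j` of array `a` := value of `e` -/
  | writeNat (a : ℕ) (j : NExp) (e : NExp)
  | writeReal (a : ℕ) (j : NExp) (e : RExp)
  | seq (c₁ c₂ : Cmd)
  | cond (b : BExp) (c₁ c₂ : Cmd)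
  | loop (b : BExp) (c : Cmd)
  /-- execute the body of the procedure number `p` -/
  | call (p : ℕ)

/-- A program: a main command and a finite list of procedure bodies. -/
structure Program where
  main : Cmd
  procs : List Cmd

/-- `Exec procs c s k s'`: started in memory `s`, the command `c` halts after exactly `k` steps with
memory `s'`. A command that runs forever, or calls a procedure that does not exist, has no such
`k` and `s'`. -/
inductive Exec (procs : List Cmd) : Cmd → State → ℕ → State → Prop
  | skip (s : State) : Exec procs .skip s 1 s
  | setNat (i : ℕ) (e : NExp) (s : State) :
      Exec procs (.setNat i e) s (e.cost + 1)
        { s with natVar := Function.update s.natVar i (e.eval s) }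
  | setReal (i : ℕ) (e : RExp) (s : State) :
      Exec procs (.setReal i e) s (e.cost + 1)
        { s with realVar := Function.update s.realVar i (e.eval s) }
  | writeNat (a : ℕ) (j : NExp) (e : NExp) (s : State) :
      Exec procs (.writeNat a j e) s (j.cost + e.cost + 1)
        { s with natArr :=
            Function.update s.natArr a (Function.update (s.natArr a) (j.eval s) (e.eval s)) }
  | writeReal (a : ℕ) (j : NExp) (e : RExp) (s : State) :
      Exec procs (.writeReal a j e) s (j.cost + e.cost + 1)
        { s with realArr :=
            Function.update s.realArr a (Function.update (s.realArr a) (j.eval s) (e.eval s)) }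
  | seq {c₁ c₂ : Cmd} {s s' s'' : State} {k m : ℕ} :
      Exec procs c₁ s k s' → Exec procs c₂ s' m s'' → Exec procs (.seq c₁ c₂) s (k + m + 1) s''
  | condTrue {b : BExp} {c₁ c₂ : Cmd} {s s' : State} {k : ℕ} :
      b.Holds s → Exec procs c₁ s k s' → Exec procs (.cond b c₁ c₂) s (b.cost + k + 1) s'
  | condFalse {b : BExp} {c₁ c₂ : Cmd} {s s' : State} {k : ℕ} :
      ¬ b.Holds s → Exec procs c₂ s k s' → Exec procs (.cond b c₁ c₂) s (b.cost + k + 1) s'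
  | loopTrue {b : BExp} {c : Cmd} {s s' s'' : State} {k m : ℕ} :
      b.Holds s → Exec procs c s k s' → Exec procs (.loop b c) s' m s'' →
      Exec procs (.loop b c) s (b.cost + k + m + 1) s''
  | loopFalse {b : BExp} {c : Cmd} {s : State} :
      ¬ b.Holds s → Exec procs (.loop b c) s (b.cost + 1) s
  | call {p : ℕ} {c : Cmd} {s s' : State} {k : ℕ} :
      procs[p]? = some c → Exec procs c s k s' → Exec procs (.call p) s (k + 1) s'

/-- The machine is deterministic: step count and final memory of a halting run are unique. -/
theorem Exec.unique {procs : List Cmd} {c : Cmd} {s s₁ s₂ : State} {k₁ k₂ : ℕ}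
    (h₁ : Exec procs c s k₁ s₁) (h₂ : Exec procs c s k₂ s₂) : k₁ = k₂ ∧ s₁ = s₂ := by
  induction h₁ generalizing k₂ s₂ with
  | skip | setNat | setReal | writeNat | writeReal => cases h₂; exact ⟨rfl, rfl⟩
  | seq _ _ ih₁ ih₂ =>
    cases h₂ with
    | seq g₁ g₂ =>
      obtain ⟨rfl, rfl⟩ := ih₁ g₁
      obtain ⟨rfl, rfl⟩ := ih₂ g₂
      exact ⟨rfl, rfl⟩
  | condTrue hb _ ih =>
    cases h₂ with
    | condTrue _ g => obtain ⟨rfl, rfl⟩ := ih g; exact ⟨rfl, rfl⟩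
    | condFalse hb' _ => exact absurd hb hb'
  | condFalse hb _ ih =>
    cases h₂ with
    | condTrue hb' _ => exact absurd hb' hb
    | condFalse _ g => obtain ⟨rfl, rfl⟩ := ih g; exact ⟨rfl, rfl⟩
  | loopTrue hb _ _ ih₁ ih₂ =>
    cases h₂ with
    | loopTrue _ g₁ g₂ =>
      obtain ⟨rfl, rfl⟩ := ih₁ g₁
      obtain ⟨rfl, rfl⟩ := ih₂ g₂
      exact ⟨rfl, rfl⟩
    | loopFalse hb' => exact absurd hb hb'
  | loopFalse hb =>
    cases h₂ with
    | loopTrue hb' _ _ => exact absurd hb' hb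
    | loopFalse _ => exact ⟨rfl, rfl⟩
  | call hp _ ih =>
    cases h₂ with
    | call hp' g =>
      obtain rfl := Option.some.inj (hp.symm.trans hp')
      obtain ⟨rfl, rfl⟩ := ih g
      exact ⟨rfl, rfl⟩

/-- The program `P`, started in memory `s`, halts after exactly `k` steps with memory `s'`. -/
def Program.HaltsIn (P : Program) (s : State) (k : ℕ) (s' : State) : Prop :=
  Exec P.procs P.main s k s'

end RealRAM

/-- An instance of the affine distance tariff design problem with set of OD pairs `D`: reference
prices `r_d ≥ 0`, passenger numbers `t_d ≥ 1` and distances `l_d ≥ 0`. -/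
structure AffineDistanceInstance (D : Type*) where
  refPrice : D → ℝ
  passengers : D → ℕ
  dist : D → ℝ
  refPrice_nonneg : ∀ d, 0 ≤ refPrice d
  one_le_passengers : ∀ d, 1 ≤ passengers d
  dist_nonneg : ∀ d, 0 ≤ dist d

namespace AffineDistanceInstance

variable {D : Type*} [Fintype D]

/-- The sum of absolute deviations of the tariff with price per kilometer `p` and base amount `f`
from the reference prices. -/
def deviation (I : AffineDistanceInstance D) (p f : ℝ) : ℝ :=
  ∑ d, (I.passengers d : ℝ) * |I.refPrice d - (p * I.dist d + f)|

/-- `(p, f)` is an optimal solution. -/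
def IsOptimal (I : AffineDistanceInstance D) (p f : ℝ) : Prop :=
  0 ≤ p ∧ 0 ≤ f ∧ ∀ p' f' : ℝ, 0 ≤ p' → 0 ≤ f' → I.deviation p f ≤ I.deviation p' f'

/-- The initial memory for the instance `I`, whose OD pairs are listed in the order `e`: the
variable `0` holds the number of OD pairs; the real arrays `0`, `1`, `2` hold the distances, the
reference prices and the passenger numbers; everything else is zero. -/
noncomputable def inputState (I : AffineDistanceInstance D) (e : Fin (Fintype.card D) ≃ D) :
    RealRAM.State where
  natVar i := if i = 0 then Fintype.card D else 0
  realVar _ := 0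
  natArr _ _ := 0
  realArr a j :=
    if h : j < Fintype.card D then
      if a = 0 then I.dist (e ⟨j, h⟩)
      else if a = 1 then I.refPrice (e ⟨j, h⟩)
      else if a = 2 then (I.passengers (e ⟨j, h⟩) : ℝ)
      else 0
    else 0

end AffineDistanceInstance

/-! The constraints are removed by an exact penalty. Truncating `p` and `f` at zero raises the
deviation by at most `wp * (|p| - p) + wf * (|f| - f)`, where `wp = ∑ t l` and `wf = ∑ t`
(`tariffDev_max_le`). It therefore suffices to minimise the deviation plus this penalty over the
whole plane and then to truncate. In the variables `x = p - f`, `y = f`, and after division of each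
residual by `1 + l`, all terms, including the two penalties, have the form `W * |R - L * x - y|` up
to a linear part (`linDev_eq_tariffDev`). What remains is the minimisation of `linDev`, a sum of
weighted absolute values plus a linear function.

This is done by prune and search. Away from its zero line an absolute value is affine, so a term
whose zero line misses the region of better points can be moved to the linear part. Let `lam` be a
median of the slopes `L`. The lines are paired so that one slope is at most `lam` and the other at
least `lam`, and each pair has a crossing point. A line test for the vertical line through the
median abscissa, and a second one for a line `y + lam * x = y₀`, where `y₀` is a median over the
crossing points not strictly on the good side of the first line, either find a minimiser or confine
all better points to an open quadrant. At least a quarter of the crossing points lie in the opposite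
closed quadrant, and for each of these one of the two lines misses the open quadrant (`pair_side`).
Hence at least an eighth of the terms becomes linear (`Cmd.resolve_runs`), and the recursion `T(n) ≤
T(7n/8) + O(n)` is linear.

The line test (`Cmd.lineTest_runs`) minimises along the line and looks for a descent direction to
either side. The directional derivative is again a `linDev`, so each search is another minimisation
in one variable. By convexity a descent direction to one side excludes better points on the other
(`lt_of_linDevDir_neg`), and without any descent direction the minimiser on the line is global. In
one variable a minimiser is a weighted quantile, found in linear time with the median of medians of
five as pivot (`Cmd.quantile_spec`).

A pruned function equals the original one only in part of the plane. The relation `SameBelow`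
records agreement on both strict sublevel sets of a level `c`; convexity of the pruned function
yields it (`SameBelow.of_halfPlane`), and it transports minimisers back (`SameBelow.isMin`). -/

namespace RealRAM

open Finset

-- Program logic with time bounds and frames

infixr:60 " ;; " => Cmd.seq

/-- Total correctness with a time bound. -/
def Runs (procs : List Cmd) (c : Cmd) (s : State) (K : ℕ) (Q : State → Prop) : Prop :=
  ∃ k s', Exec procs c s k s' ∧ k ≤ K ∧ Q s'

/-- Commands without loops and calls. -/
def Cmd.simple : Cmd → Bool
  | .seq a b => a.simple && b.simple
  | .cond _ a b => a.simple && b.simple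
  | .loop _ _ => false
  | .call _ => false
  | _ => true

open Classical in
/-- The effect of a command without loops and calls. -/
noncomputable def Cmd.run : Cmd → State → State
  | .skip, s => s
  | .setNat i e, s => { s with natVar := Function.update s.natVar i (e.eval s) }
  | .setReal i e, s => { s with realVar := Function.update s.realVar i (e.eval s) }
  | .writeNat a j e, s => ⟨s.natVar, s.realVar,
      Function.update s.natArr a (Function.update (s.natArr a) (j.eval s) (e.eval s)), s.realArr⟩
  | .writeReal a j e, s => ⟨s.natVar, s.realVar, s.natArr,
      Function.update s.realArr a (Function.update (s.realArr a) (j.eval s) (e.eval s))⟩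
  | .seq a b, s => b.run (a.run s)
  | .cond b c₁ c₂, s => if b.Holds s then c₁.run s else c₂.run s
  | .loop _ _, s => s
  | .call _, s => s

attribute [simp] NExp.eval RExp.eval BExp.Holds Cmd.run

/-- A bound for the running time of a command without loops and calls. -/
def Cmd.bound : Cmd → ℕ
  | .skip => 1
  | .setNat _ e => e.cost + 1
  | .setReal _ e => e.cost + 1
  | .writeNat _ j e => j.cost + e.cost + 1
  | .writeReal _ j e => j.cost + e.cost + 1
  | .seq a b => a.bound + b.bound + 1
  | .cond b c₁ c₂ => b.cost + (c₁.bound + c₂.bound) + 1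
  | .loop _ _ => 0
  | .call _ => 0

/-- Straight-line code can thus be evaluated by `simp`; only loops and calls need separate rules.
The bound charges a branch for both arms, hence the inequality. -/
theorem Cmd.exec_run (procs : List Cmd) (c : Cmd) (hc : c.simple) (s : State) :
    ∃ k, Exec procs c s k (c.run s) ∧ k ≤ c.bound := by
  induction c generalizing s with
  | skip => exact ⟨_, .skip s, le_rfl⟩
  | setNat i e => exact ⟨_, .setNat i e s, le_rfl⟩
  | setReal i e => exact ⟨_, .setReal i e s, le_rfl⟩
  | writeNat a j e => exact ⟨_, .writeNat a j e s, le_rfl⟩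
  | writeReal a j e => exact ⟨_, .writeReal a j e s, le_rfl⟩
  | seq a b iha ihb =>
    simp only [Cmd.simple, Bool.and_eq_true] at hc
    obtain ⟨k, hk, hk'⟩ := iha hc.1 s
    obtain ⟨m, hm, hm'⟩ := ihb hc.2 (a.run s)
    exact ⟨_, .seq hk hm, by simp only [Cmd.bound]; omega⟩
  | cond b c₁ c₂ ih₁ ih₂ =>
    simp only [Cmd.simple, Bool.and_eq_true] at hc
    by_cases hb : b.Holds s
    · obtain ⟨k, hk, hk'⟩ := ih₁ hc.1 s
      refine ⟨b.cost + k + 1, ?_, by simp only [Cmd.bound]; omega⟩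
      simp only [Cmd.run, hb, if_true]
      exact .condTrue hb hk
    · obtain ⟨k, hk, hk'⟩ := ih₂ hc.2 s
      refine ⟨b.cost + k + 1, ?_, by simp only [Cmd.bound]; omega⟩
      simp only [Cmd.run, hb, if_false]
      exact .condFalse hb hk
  | loop => simp [Cmd.simple] at hc
  | call => simp [Cmd.simple] at hc

/-- The names which a command may write to, and the procedures it may call. -/
structure Footprint where
  nat : List ℕ
  real : List ℕ
  natArr : List ℕ
  realArr : List ℕ
  calls : List ℕ

def Cmd.within (A : Footprint) : Cmd → Bool
  | .skip => true
  | .setNat i _ => A.nat.contains i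
  | .setReal i _ => A.real.contains i
  | .writeNat a _ _ => A.natArr.contains a
  | .writeReal a _ _ => A.realArr.contains a
  | .seq a b => a.within A && b.within A
  | .cond _ a b => a.within A && b.within A
  | .loop _ a => a.within A
  | .call p => A.calls.contains p

/-- The two memories agree except for names in the footprint. -/
structure Frame (A : Footprint) (s s' : State) : Prop where
  nat : ∀ i, i ∉ A.nat → s'.natVar i = s.natVar i
  real : ∀ i, i ∉ A.real → s'.realVar i = s.realVar i
  natArr : ∀ i, i ∉ A.natArr → s'.natArr i = s.natArr i
  realArr : ∀ i, i ∉ A.realArr → s'.realArr i = s.realArr i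

theorem Frame.refl (A : Footprint) (s : State) : Frame A s s :=
  ⟨fun _ _ => rfl, fun _ _ => rfl, fun _ _ => rfl, fun _ _ => rfl⟩

theorem Frame.trans {A : Footprint} {s s' s'' : State} (h : Frame A s s') (h' : Frame A s' s'') :
    Frame A s s'' :=
  ⟨fun i hi => (h'.nat i hi).trans (h.nat i hi), fun i hi => (h'.real i hi).trans (h.real i hi),
    fun i hi => (h'.natArr i hi).trans (h.natArr i hi),
    fun i hi => (h'.realArr i hi).trans (h.realArr i hi)⟩

/-- A purely syntactic check suffices because the induction is on the run. Recursion is covered,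
since every callable procedure must respect the same footprint. -/
theorem Exec.frame {procs : List Cmd} {A : Footprint}
    (hp : ∀ p ∈ A.calls, ∀ c, procs[p]? = some c → c.within A) {c : Cmd} {s s' : State} {k : ℕ}
    (h : Exec procs c s k s') (hc : c.within A) : Frame A s s' := by
  induction h with
  | skip s => exact Frame.refl _ _
  | setNat i e s =>
    refine ⟨fun x hx => ?_, fun _ _ => rfl, fun _ _ => rfl, fun _ _ => rfl⟩
    have : x ≠ i := by rintro rfl; simp_all [Cmd.within]
    simp [this]
  | setReal i e s =>
    refine ⟨fun _ _ => rfl, fun x hx => ?_, fun _ _ => rfl, fun _ _ => rfl⟩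
    have : x ≠ i := by rintro rfl; simp_all [Cmd.within]
    simp [this]
  | writeNat i j e s =>
    refine ⟨fun _ _ => rfl, fun _ _ => rfl, fun x hx => ?_, fun _ _ => rfl⟩
    have : x ≠ i := by rintro rfl; simp_all [Cmd.within]
    simp [this]
  | writeReal i j e s =>
    refine ⟨fun _ _ => rfl, fun _ _ => rfl, fun _ _ => rfl, fun x hx => ?_⟩
    have : x ≠ i := by rintro rfl; simp_all [Cmd.within]
    simp [this]
  | seq _ _ ih₁ ih₂ =>
    simp only [Cmd.within, Bool.and_eq_true] at hc
    exact (ih₁ hc.1).trans (ih₂ hc.2)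
  | condTrue _ _ ih =>
    simp only [Cmd.within, Bool.and_eq_true] at hc
    exact ih hc.1
  | condFalse _ _ ih =>
    simp only [Cmd.within, Bool.and_eq_true] at hc
    exact ih hc.2
  | loopTrue _ _ _ ih₁ ih₂ =>
    exact (ih₁ (by simpa [Cmd.within] using hc)).trans (ih₂ hc)
  | loopFalse _ => exact Frame.refl _ _
  | call hp' _ ih =>
    exact ih (hp _ (by simpa [Cmd.within] using hc) _ hp')

namespace Runs

variable {procs : List Cmd} {c c₁ c₂ : Cmd} {s : State} {K K₁ K₂ : ℕ} {P Q : State → Prop}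

theorem mono (h : Runs procs c s K₁ P) (hK : K₁ ≤ K) (hQ : ∀ s', P s' → Q s') :
    Runs procs c s K Q := by
  obtain ⟨k, s', h, hk, hs⟩ := h
  exact ⟨k, s', h, hk.trans hK, hQ _ hs⟩

theorem seq (h₁ : Runs procs c₁ s K₁ P) (h₂ : ∀ s', P s' → Runs procs c₂ s' K₂ Q)
    (hK : K₁ + K₂ + 1 ≤ K) : Runs procs (c₁ ;; c₂) s K Q := by
  obtain ⟨k, s', h, hk, hs⟩ := h₁
  obtain ⟨k', s'', h', hk', hs'⟩ := h₂ s' hs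
  exact ⟨_, s'', .seq h h', by omega, hs'⟩

theorem of_simple (hc : c.simple) (hK : c.bound ≤ K) (hQ : Q (c.run s)) : Runs procs c s K Q := by
  obtain ⟨k, h, hk⟩ := c.exec_run procs hc s
  exact ⟨k, _, h, hk.trans hK, hQ⟩

theorem seq_simple (hc : c₁.simple) (h₂ : Runs procs c₂ (c₁.run s) K₂ Q)
    (hK : c₁.bound + K₂ + 1 ≤ K) : Runs procs (c₁ ;; c₂) s K Q :=
  seq (of_simple (Q := fun t => t = c₁.run s) hc le_rfl rfl) (by rintro _ rfl; exact h₂) hK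

theorem cond {b : BExp} (h₁ : b.Holds s → Runs procs c₁ s K₁ Q)
    (h₂ : ¬ b.Holds s → Runs procs c₂ s K₁ Q) (hK : b.cost + K₁ + 1 ≤ K) :
    Runs procs (.cond b c₁ c₂) s K Q := by
  by_cases hb : b.Holds s
  · obtain ⟨k, s', h, hk, hs⟩ := h₁ hb
    exact ⟨_, s', .condTrue hb h, by omega, hs⟩
  · obtain ⟨k, s', h, hk, hs⟩ := h₂ hb
    exact ⟨_, s', .condFalse hb h, by omega, hs⟩

theorem call {p : ℕ} (hp : procs[p]? = some c) (h : Runs procs c s K₁ Q) (hK : K₁ + 1 ≤ K) :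
    Runs procs (.call p) s K Q := by
  obtain ⟨k, s', h, hk, hs⟩ := h
  exact ⟨_, s', .call hp h, by omega, hs⟩

theorem frame (h : Runs procs c s K Q) (A : Footprint)
    (hp : ∀ p ∈ A.calls, ∀ c, procs[p]? = some c → c.within A) (hc : c.within A) :
    Runs procs c s K (fun s' => Frame A s s' ∧ Q s') := by
  obtain ⟨k, s', h, hk, hs⟩ := h
  exact ⟨k, s', h, hk, h.frame hp hc, hs⟩

/-- The invariant is indexed by the number of completed rounds, so the number of rounds is known in
advance; the extra `B` pays for the final failing test. -/
theorem loop {b : BExp} {B : ℕ} (N : ℕ) (Inv : ℕ → State → Prop)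
    (hB : K₁ + b.cost + 1 ≤ B)
    (hstep : ∀ j, j < N → ∀ s, Inv j s → b.Holds s ∧ Runs procs c s K₁ (Inv (j + 1)))
    (hend : ∀ s, Inv N s → ¬ b.Holds s) (h0 : Inv 0 s) :
    Runs procs (.loop b c) s (N * B + B) (Inv N) := by
  suffices H : ∀ m j, j + m = N → ∀ s, Inv j s → Runs procs (.loop b c) s (m * B + B) (Inv N) from
    H N 0 (by omega) s h0
  intro m
  induction m with
  | zero =>
    intro j hj s hs
    obtain rfl : j = N := by omega
    exact ⟨_, s, .loopFalse (hend s hs), by omega, hs⟩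
  | succ m ih =>
    intro j hj s hs
    obtain ⟨hb, k, s', h, hk, hs'⟩ := hstep j (by omega) s hs
    obtain ⟨k', s'', h', hk', hs''⟩ := ih (j + 1) (by omega) s' hs'
    refine ⟨_, s'', .loopTrue hb h h', ?_, hs''⟩
    rw [Nat.succ_mul]
    omega

end Runs

/-- `for i := 0 to n - 1 do body` -/
def Cmd.forUp (i n : ℕ) (body : Cmd) : Cmd :=
  .setNat i (.const 0) ;;
  .loop (.natLt (.var i) (.var n)) (body ;; .setNat i (.add (.var i) (.const 1)))

def Footprint.addNat (A : Footprint) (i : ℕ) : Footprint := { A with nat := i :: A.nat }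

theorem Cmd.within_addNat {A : Footprint} (i : ℕ) {c : Cmd} (h : c.within A) :
    c.within (A.addNat i) := by
  induction c with
  | setNat j e => simp_all [Cmd.within, Footprint.addNat]
  | _ => simp_all [Cmd.within, Footprint.addNat]

/-- The body must not write the counter or the bound. In `hstep` everything outside the footprint
still has its initial value, so invariants need to mention only what changes. -/
theorem Runs.forUp {procs : List Cmd} {s₀ : State} {i n : ℕ} {body : Cmd}
    (A : Footprint) (B N : ℕ) (Inv : ℕ → State → Prop)
    (hs : body.simple) (hw : body.within A) (hi : i ∉ A.nat) (hn : n ∉ i :: A.nat)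
    (hA : A.calls = []) (hB : body.bound + 9 ≤ B) (hN : s₀.natVar n = N)
    (h0 : Inv 0 { s₀ with natVar := Function.update s₀.natVar i 0 })
    (hstep : ∀ j, j < N → ∀ s, Frame (A.addNat i) s₀ s → s.natVar i = j → Inv j s →
      Inv (j + 1) { body.run s with natVar := Function.update (body.run s).natVar i (j + 1) }) :
    Runs procs (.forUp i n body) s₀ (N * B + B + 3)
      (fun s => Frame (A.addNat i) s₀ s ∧ Inv N s) := by
  have hp : ∀ p ∈ (A.addNat i).calls, ∀ c, procs[p]? = some c → c.within (A.addNat i) := by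
    simp [Footprint.addNat, hA]
  have hp' : ∀ p ∈ A.calls, ∀ c, procs[p]? = some c → c.within A := by
    simp [hA]
  have hb : (body ;; .setNat i (.add (.var i) (.const 1))).within (A.addNat i) := by
    simp only [Cmd.within, Bool.and_eq_true]
    exact ⟨Cmd.within_addNat i hw, by simp [Footprint.addNat]⟩
  have hf0 : Frame (A.addNat i) s₀ { s₀ with natVar := Function.update s₀.natVar i 0 } := by
    refine ⟨fun x hx => ?_, fun _ _ => rfl, fun _ _ => rfl, fun _ _ => rfl⟩
    have : x ≠ i := by rintro rfl; simp [Footprint.addNat] at hx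
    simp [this]
  refine Runs.seq_simple rfl ?_ (K₂ := N * B + B) (by simp [Cmd.bound, NExp.cost]; omega)
  have key := Runs.loop (procs := procs) (s := { s₀ with natVar := Function.update s₀.natVar i 0 })
    (b := .natLt (.var i) (.var n)) (c := body ;; .setNat i (.add (.var i) (.const 1)))
    (B := B) (K₁ := body.bound + 5) N
    (fun j s => Frame (A.addNat i) s₀ s ∧ s.natVar i = j ∧ Inv j s)
    (by simp [BExp.cost, NExp.cost]; omega) ?_ ?_ ⟨hf0, by simp, h0⟩
  · exact key.mono le_rfl (fun s h => ⟨h.1, h.2.2⟩)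
  · rintro j hj s ⟨hf, hij, hI⟩
    have hn' : s.natVar n = N := by rw [hf.nat n hn, hN]
    refine ⟨by simp only [BExp.Holds, NExp.eval, hij, hn']; exact hj, ?_⟩
    obtain ⟨k, hk, hk'⟩ := (body ;; .setNat i (.add (.var i) (.const 1))).exec_run procs
      (by simp [Cmd.simple, hs]) s
    refine ⟨k, _, hk, hk'.trans (by simp [Cmd.bound, NExp.cost]), hf.trans (hk.frame hp hb), ?_⟩
    obtain ⟨k₁, hk₁, -⟩ := body.exec_run procs hs s
    have hi' : (body.run s).natVar i = j := by rw [(hk₁.frame hp' hw).nat i hi, hij]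
    simp only [Cmd.run, NExp.eval, hi', Function.update_self, true_and]
    exact hstep j hj s hf hij hI
  · rintro s ⟨hf, hij, hI⟩
    have hn' : s.natVar n = N := by rw [hf.nat n hn, hN]
    simp [BExp.Holds, NExp.eval, hij, hn']

/-! ### Weighted quantiles in linear time -/

/-- Sort the real variables `a` and `b`, using `t` as temporary storage. -/
def Cmd.sort2 (a b t : ℕ) : Cmd :=
  .setReal t (.var a) ;;
  .cond (.realLt (.var b) (.var a)) (.setReal a (.var b) ;; .setReal b (.var t)) .skip

theorem Cmd.run_sort2 {a b t : ℕ} (hab : a ≠ b) (hat : a ≠ t) (hbt : b ≠ t) (s : State) :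
    (Cmd.sort2 a b t).run s = ⟨s.natVar, Function.update (Function.update
      (Function.update s.realVar t (s.realVar a)) a (min (s.realVar a) (s.realVar b)))
      b (max (s.realVar a) (s.realVar b)), s.natArr, s.realArr⟩ := by
  simp only [Cmd.sort2, Cmd.run, BExp.Holds, RExp.eval, Function.update_self, ne_eq, hab, hat, hbt,
    not_false_eq_true, Function.update_of_ne, Ne.symm hab, Ne.symm hat, Ne.symm hbt]
  split_ifs with h
  · rw [min_eq_right h.le, max_eq_left h.le]
  · rw [min_eq_left (not_lt.1 h), max_eq_right (not_lt.1 h)]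
    congr 1
    funext x
    by_cases hx : x = a <;> by_cases hx' : x = b <;> by_cases hx'' : x = t <;>
      simp_all [Function.update_apply]

/-- `u` is a weighted quantile: a minimiser of `∑ M k * |V k - u| + κ * u`. -/
def IsQuantile (n : ℕ) (V M : ℕ → ℝ) (κ u : ℝ) : Prop :=
  ∑ k ∈ range n, (if u < V k then M k else 0) ≤ κ + ∑ k ∈ range n, (if V k ≤ u then M k else 0) ∧
  κ + ∑ k ∈ range n, (if V k < u then M k else 0) ≤ ∑ k ∈ range n, (if u ≤ V k then M k else 0)

/-- Every block of five consecutive cells is replaced by its median. -/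
def Cmd.medians5Body : Cmd :=
  .setReal 5 (.read 10 (.add (.var 0) (.var 3))) ;;
  .setReal 6 (.read 10 (.add (.var 0) (.add (.var 3) (.const 1)))) ;;
  .setReal 7 (.read 10 (.add (.var 0) (.add (.var 3) (.const 2)))) ;;
  .setReal 8 (.read 10 (.add (.var 0) (.add (.var 3) (.const 3)))) ;;
  .setReal 9 (.read 10 (.add (.var 0) (.add (.var 3) (.const 4)))) ;;
  .sort2 5 6 10 ;; .sort2 7 8 10 ;; .sort2 5 7 10 ;; .sort2 6 8 10 ;;
  .sort2 6 7 10 ;; .sort2 7 9 10 ;; .sort2 6 7 10 ;;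
  .writeReal 10 (.add (.add (.var 0) (.var 1)) (.var 4)) (.var 7) ;;
  .writeReal 11 (.add (.add (.var 0) (.var 1)) (.var 4)) (.const 1) ;;
  .setNat 4 (.add (.var 4) (.const 1)) ;;
  .setNat 3 (.add (.var 3) (.const 5))

/-- Natural variable `3` is the start of the current block and `4` the number of medians so far. The
medians are stored directly behind the segment; up to four trailing cells are ignored. -/
def Cmd.medians5 : Cmd :=
  .setNat 3 (.const 0) ;; .setNat 4 (.const 0) ;;
  .loop (.natLt (.add (.var 3) (.const 4)) (.var 1)) .medians5Body

/-- The recursive call works on the medians behind the segment. The length and `κ` are saved in the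
cell `lo + n` of natural array `0` and real array `12`, which act as a call stack addressed by the
start of the callee's segment. -/
def Cmd.pivot : Cmd :=
  .cond (.natLt (.var 1) (.const 24))
    (.setReal 0 (.read 10 (.var 0)))
    (.medians5 ;;
      (.writeNat 0 (.add (.var 0) (.var 1)) (.var 1) ;;
      .writeReal 12 (.add (.var 0) (.var 1)) (.var 1) ;;
      .setNat 0 (.add (.var 0) (.var 1)) ;;
      .setNat 1 (.var 4) ;;
      .setReal 1 (.const 0)) ;;
      .call 0 ;;
      (.setNat 1 (.read 0 (.var 0)) ;;
      .setReal 1 (.read 12 (.var 0)) ;;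
      .setNat 0 (.sub (.var 0) (.var 1))))

def Cmd.quantileSums : Cmd :=
  (.setReal 2 (.const 0) ;; .setReal 3 (.const 0) ;; .setReal 4 (.const 0)) ;;
  .forUp 3 1
    (.cond (.realLt (.read 10 (.add (.var 0) (.var 3))) (.var 0))
      (.setReal 2 (.add (.var 2) (.read 11 (.add (.var 0) (.var 3)))))
      (.cond (.realLt (.var 0) (.read 10 (.add (.var 0) (.var 3))))
        (.setReal 3 (.add (.var 3) (.read 11 (.add (.var 0) (.var 3)))))
        (.setReal 4 (.add (.var 4) (.read 11 (.add (.var 0) (.var 3)))))))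

/-- Real variable `11` receives the side of the pivot on which the quantile lies, with `0` if the
pivot is one. The cells to be discarded act on that side as a linear function, so their weight is
absorbed into `κ`. -/
def Cmd.quantileSide : Cmd :=
  .cond (.realLt (.add (.add (.var 1) (.var 2)) (.var 4)) (.var 3))
    (.setReal 11 (.const 1) ;; .setReal 1 (.add (.add (.var 1) (.var 2)) (.var 4)))
    (.cond (.realLt (.add (.var 3) (.var 4)) (.add (.var 1) (.var 2)))
      (.setReal 11 (.const (-1)) ;; .setReal 1 (.sub (.sub (.var 1) (.var 3)) (.var 4)))
      (.setReal 11 (.const 0)))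

/-- Multiplication by the sign handles both sides with one test. The sign `0` keeps nothing, so the
next call sees an empty segment and leaves the pivot in place as the result. -/
def Cmd.quantileFilter : Cmd :=
  .setNat 4 (.const 0) ;;
  .forUp 3 1
    (.cond (.realLt (.const 0) (.mul (.var 11) (.sub (.read 10 (.add (.var 0) (.var 3))) (.var 0))))
      (.writeReal 10 (.add (.var 0) (.var 4)) (.read 10 (.add (.var 0) (.var 3))) ;;
      .writeReal 11 (.add (.var 0) (.var 4)) (.read 11 (.add (.var 0) (.var 3))) ;;
      .setNat 4 (.add (.var 4) (.const 1)))
      .skip)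

/-- The procedure computing a weighted quantile of the cells `lo, …, lo + n - 1` of the real arrays
`10` (values) and `11` (weights), where `lo` and `n` are the natural variables `0` and `1`, and `κ`
is the real variable `1`. The result is stored in the real variable `0`. -/
def Cmd.quantile : Cmd :=
  .cond (.natLt (.const 0) (.var 1))
    (.pivot ;; .quantileSums ;; .quantileSide ;; .quantileFilter ;; .setNat 1 (.var 4) ;; .call 0)
    .skip

/-- The part of the memory used by `Cmd.quantile`. -/
def quantileFootprint : Footprint :=
  ⟨List.range 5, List.range 12, [0], [10, 11, 12], [0]⟩

/-- A compare-exchange preserves every symmetric sum; this reduces the counting for the sorting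
network to linear arithmetic. -/
theorem sum_sort2 (φ : ℝ → ℝ) (a b : ℝ) : φ (min a b) + φ (max a b) = φ a + φ b := by
  rcases le_total a b with h | h
  · rw [min_eq_left h, max_eq_right h]
  · rw [min_eq_right h, max_eq_left h, add_comm]

/-- After the seven compare-exchanges two other values are at most `m` and two others are at least
`m`, which gives three on each side with `m` itself. -/
theorem Cmd.medians5Body_run (s : State) : ∃ m : ℝ,
    Cmd.medians5Body.run s = ⟨
      Function.update (Function.update s.natVar 4 (s.natVar 4 + 1)) 3 (s.natVar 3 + 5),
      (Cmd.medians5Body.run s).realVar, s.natArr,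
      Function.update (Function.update s.realArr 10
        (Function.update (s.realArr 10) (s.natVar 0 + s.natVar 1 + s.natVar 4) m)) 11
        (Function.update (s.realArr 11) (s.natVar 0 + s.natVar 1 + s.natVar 4) 1)⟩ ∧
    (∀ u, (if m ≤ u then (3 : ℝ) else 0) ≤
      ∑ t ∈ range 5, if s.realArr 10 (s.natVar 0 + (s.natVar 3 + t)) ≤ u then 1 else 0) ∧
    (∀ u, (if u ≤ m then (3 : ℝ) else 0) ≤
      ∑ t ∈ range 5, if u ≤ s.realArr 10 (s.natVar 0 + (s.natVar 3 + t)) then 1 else 0) := by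
  obtain ⟨v, hv⟩ : ∃ v : ℕ → ℝ, ∀ t, s.realArr 10 (s.natVar 0 + (s.natVar 3 + t)) = v t :=
    ⟨_, fun _ => rfl⟩
  have hv0 : s.realArr 10 (s.natVar 0 + s.natVar 3) = v 0 := hv 0
  obtain ⟨a, ha⟩ : ∃ a, a = min (v 0) (v 1) := ⟨_, rfl⟩
  obtain ⟨b, hb⟩ : ∃ b, b = max (v 0) (v 1) := ⟨_, rfl⟩
  obtain ⟨c, hc⟩ : ∃ c, c = min (v 2) (v 3) := ⟨_, rfl⟩
  obtain ⟨d, hd⟩ : ∃ d, d = max (v 2) (v 3) := ⟨_, rfl⟩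
  obtain ⟨a', ha'⟩ : ∃ a', a' = min a c := ⟨_, rfl⟩
  obtain ⟨c', hc'⟩ : ∃ c', c' = max a c := ⟨_, rfl⟩
  obtain ⟨b', hb'⟩ : ∃ b', b' = min b d := ⟨_, rfl⟩
  obtain ⟨d', hd'⟩ : ∃ d', d' = max b d := ⟨_, rfl⟩
  obtain ⟨e, he⟩ : ∃ e, e = min b' c' := ⟨_, rfl⟩
  obtain ⟨f, hf⟩ : ∃ f, f = max b' c' := ⟨_, rfl⟩
  obtain ⟨g, hg⟩ : ∃ g, g = min f (v 4) := ⟨_, rfl⟩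
  obtain ⟨h, hh⟩ : ∃ h, h = max f (v 4) := ⟨_, rfl⟩
  obtain ⟨e', he'⟩ : ∃ e', e' = min e g := ⟨_, rfl⟩
  obtain ⟨m, hm⟩ : ∃ m, m = max e g := ⟨_, rfl⟩
  have hab : a ≤ b := by rw [ha, hb]; exact min_le_max
  have hcd : c ≤ d := by rw [hc, hd]; exact min_le_max
  have h1 : a' ≤ e := by
    rw [he, hb', hc']
    refine le_min (le_min ?_ ?_) ?_
    · rw [ha']; exact (min_le_left _ _).trans hab
    · rw [ha']; exact (min_le_right _ _).trans hcd
    · rw [ha']; exact min_le_max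
  have h2 : f ≤ d' := by
    rw [hf, hb', hc']
    refine max_le ?_ (max_le ?_ ?_)
    · rw [hd']; exact min_le_max
    · rw [hd']; exact hab.trans (le_max_left _ _)
    · rw [hd']; exact hcd.trans (le_max_right _ _)
  have h3 : e ≤ m := by rw [hm]; exact le_max_left _ _
  have h4 : e' ≤ m := by rw [hm, he']; exact min_le_max
  have hef : e ≤ f := by rw [he, hf]; exact min_le_max
  have hgf : g ≤ f := by rw [hg]; exact min_le_left _ _
  have h5 : m ≤ f := by rw [hm]; exact max_le hef hgf
  have h6 : f ≤ h := by rw [hh]; exact le_max_left _ _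
  -- The block is a rearrangement of these five values, and `a'`, `e'` are at most `m` while `d'`,
  -- `h` are at least `m`.
  have hsum : ∀ φ : ℝ → ℝ, ∑ t ∈ range 5, φ (v t) = φ a' + φ e' + φ m + φ d' + φ h := by
    intro φ
    have e1 := sum_sort2 φ (v 0) (v 1)
    have e2 := sum_sort2 φ (v 2) (v 3)
    have e3 := sum_sort2 φ a c
    have e4 := sum_sort2 φ b d
    have e5 := sum_sort2 φ b' c'
    have e6 := sum_sort2 φ f (v 4)
    have e7 := sum_sort2 φ e g
    rw [← ha, ← hb] at e1
    rw [← hc, ← hd] at e2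
    rw [← ha', ← hc'] at e3
    rw [← hb', ← hd'] at e4
    rw [← he, ← hf] at e5
    rw [← hg, ← hh] at e6
    rw [← he', ← hm] at e7
    simp only [sum_range_succ, range_zero, sum_empty]
    linarith
  refine ⟨m, ?_, fun u => ?_, fun u => ?_⟩
  · simp [Cmd.medians5Body, Cmd.run_sort2, Function.update_apply, hv, hv0, ← ha, ← hb, ← hc, ← hd,
      ← ha', ← hc', ← hb', ← hd', ← he, ← hf, ← hg, ← hh, ← he', ← hm]
  · simp only [hv]
    rw [hsum (fun x => if x ≤ u then 1 else 0)]
    split_ifs <;> norm_num <;> linarith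
  · simp only [hv]
    rw [hsum (fun x => if u ≤ x then 1 else 0)]
    split_ifs <;> norm_num <;> linarith

theorem Cmd.medians5_runs (procs : List Cmd) (s : State) (lo n : ℕ) (hlo : s.natVar 0 = lo)
    (hn : s.natVar 1 = n) :
    Runs procs .medians5 s (n / 5 * 300 + 310) (fun s' => s'.natVar 4 = n / 5 ∧
      Frame ⟨[3, 4], [5, 6, 7, 8, 9, 10], [], [10, 11], []⟩ s s' ∧
      (∀ x < lo + n, s'.realArr 10 x = s.realArr 10 x) ∧
      (∀ x < lo + n, s'.realArr 11 x = s.realArr 11 x) ∧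
      (∀ k < n / 5, s'.realArr 11 (lo + n + k) = 1) ∧
      (∀ u, ∑ k ∈ range (n / 5), (if s'.realArr 10 (lo + n + k) ≤ u then (3 : ℝ) else 0) ≤
        ∑ k ∈ range n, if s.realArr 10 (lo + k) ≤ u then 1 else 0) ∧
      (∀ u, ∑ k ∈ range (n / 5), (if u ≤ s'.realArr 10 (lo + n + k) then (3 : ℝ) else 0) ≤
        ∑ k ∈ range n, if u ≤ s.realArr 10 (lo + k) then 1 else 0)) := by
  set A : Footprint := ⟨[3, 4], [5, 6, 7, 8, 9, 10], [], [10, 11], []⟩ with hA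
  have hle : 5 * (n / 5) ≤ n := by omega
  refine Runs.seq_simple rfl (K₂ := n / 5 * 300 + 307) ?_ (by simp [Cmd.bound, NExp.cost]; omega)
  refine Runs.seq_simple rfl (K₂ := n / 5 * 300 + 300) ?_ (by simp [Cmd.bound, NExp.cost]; omega)
  refine (Runs.loop (K₁ := 250) (B := 300) (n / 5) (fun j s' => s'.natVar 3 = 5 * j ∧
    s'.natVar 4 = j ∧ Frame A s s' ∧
      (∀ x < lo + n, s'.realArr 10 x = s.realArr 10 x) ∧
      (∀ x < lo + n, s'.realArr 11 x = s.realArr 11 x) ∧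
      (∀ k < j, s'.realArr 11 (lo + n + k) = 1) ∧
      (∀ u, ∑ k ∈ range j, (if s'.realArr 10 (lo + n + k) ≤ u then (3 : ℝ) else 0) ≤
        ∑ k ∈ range (5 * j), if s.realArr 10 (lo + k) ≤ u then 1 else 0) ∧
      (∀ u, ∑ k ∈ range j, (if u ≤ s'.realArr 10 (lo + n + k) then (3 : ℝ) else 0) ≤
        ∑ k ∈ range (5 * j), if u ≤ s.realArr 10 (lo + k) then 1 else 0))
    (by simp [BExp.cost, NExp.cost]) ?_ ?_ ?_).mono le_rfl ?_
  · rintro j hj s' ⟨h3, h4, hF, hV, hM, h1, hu, hu'⟩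
    have hlo' : s'.natVar 0 = lo := by rw [hF.nat 0 (by simp [hA]), hlo]
    have hn' : s'.natVar 1 = n := by rw [hF.nat 1 (by simp [hA]), hn]
    refine ⟨by simp [h3, hn']; omega, ?_⟩
    obtain ⟨k, hk, hk'⟩ := Cmd.medians5Body.exec_run procs rfl s'
    refine ⟨k, _, hk, hk'.trans (by decide), ?_⟩
    have hF' := hF.trans (hk.frame (A := A) (by simp [hA]) (by rfl))
    obtain ⟨m, hm, hm1, hm2⟩ := Cmd.medians5Body_run s'
    rw [hm] at hF' ⊢
    simp only [h3, h4, hlo', hn'] at hF' hm1 hm2 ⊢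
    refine ⟨?_, ?_, hF', ?_, ?_, ?_, ?_, ?_⟩
    · simp; ring
    · simp
    · intro x hx
      have : x ≠ lo + n + j := by omega
      simp [this, hV x hx]
    · intro x hx
      have : x ≠ lo + n + j := by omega
      simp [this, hM x hx]
    · intro x hx
      by_cases hxj : x = j
      · simp [hxj]
      · simp [hxj, h1 x (by omega)]
    · intro u
      rw [sum_range_succ, mul_add, mul_one, sum_range_add]
      refine add_le_add ?_ ?_
      · refine le_trans (le_of_eq (sum_congr rfl fun x hx => ?_)) (hu u)
        have : x ≠ j := by simp at hx; omega
        simp [this]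
      · simp only [ne_eq, Nat.reduceEqDiff, not_false_eq_true, Function.update_of_ne,
          Function.update_self]
        refine (hm1 u).trans (le_of_eq (sum_congr rfl fun t ht => ?_))
        rw [hV _ (by simp at ht; omega)]
    · intro u
      rw [sum_range_succ, mul_add, mul_one, sum_range_add]
      refine add_le_add ?_ ?_
      · refine le_trans (le_of_eq (sum_congr rfl fun x hx => ?_)) (hu' u)
        have : x ≠ j := by simp at hx; omega
        simp [this]
      · simp only [ne_eq, Nat.reduceEqDiff, not_false_eq_true, Function.update_of_ne,
          Function.update_self]
        refine (hm2 u).trans (le_of_eq (sum_congr rfl fun t ht => ?_))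
        rw [hV _ (by simp at ht; omega)]
  · rintro s' ⟨h3, h4, hF, -⟩
    have hn' : s'.natVar 1 = n := by rw [hF.nat 1 (by simp [hA]), hn]
    simp [h3, hn']
    omega
  · refine ⟨by simp, by simp, ⟨?_, ?_, ?_, ?_⟩, by simp, by simp, by simp, by simp, by simp⟩
    · intro x hx
      simp [hA] at hx
      simp [hx]
    all_goals intros; rfl
  · rintro s' ⟨h3, h4, hF, hV, hM, h1, hu, hu'⟩
    -- The cells beyond the last full block can only increase the right-hand sides.
    refine ⟨h4, hF, hV, hM, h1, fun u => (hu u).trans ?_, fun u => (hu' u).trans ?_⟩ <;>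
    · refine sum_le_sum_of_subset_of_nonneg (range_mono hle) fun i _ _ => ?_
      split_ifs <;> norm_num

theorem sum_eq_add_of_forall {n : ℕ} {f g h : ℕ → ℝ} (H : ∀ k, f k = g k + h k) :
    ∑ k ∈ range n, f k = ∑ k ∈ range n, g k + ∑ k ∈ range n, h k := by
  rw [← sum_add_distrib]
  exact sum_congr rfl fun k _ => H k

theorem sum_le_split (n : ℕ) (V M : ℕ → ℝ) (u : ℝ) :
    ∑ k ∈ range n, (if V k ≤ u then M k else 0) =
      ∑ k ∈ range n, (if V k < u then M k else 0) + ∑ k ∈ range n, (if V k = u then M k else 0) :=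
  sum_eq_add_of_forall fun k => by grind

theorem sum_ge_split (n : ℕ) (V M : ℕ → ℝ) (u : ℝ) :
    ∑ k ∈ range n, (if u ≤ V k then M k else 0) =
      ∑ k ∈ range n, (if u < V k then M k else 0) + ∑ k ∈ range n, (if V k = u then M k else 0) :=
  sum_eq_add_of_forall fun k => by grind

theorem sum_split (n : ℕ) (V M : ℕ → ℝ) (u : ℝ) :
    ∑ k ∈ range n, M k = ∑ k ∈ range n, (if V k ≤ u then M k else 0) +
      ∑ k ∈ range n, (if u < V k then M k else 0) :=
  sum_eq_add_of_forall fun k => by grind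

theorem sum_split' (n : ℕ) (V M : ℕ → ℝ) (u : ℝ) :
    ∑ k ∈ range n, M k = ∑ k ∈ range n, (if u ≤ V k then M k else 0) +
      ∑ k ∈ range n, (if V k < u then M k else 0) :=
  sum_eq_add_of_forall fun k => by grind

/-- The first `m` pairs `(V' k, M' k)` are those among the first `n` pairs `(V k, M k)` which
satisfy `P (V k)`. -/
def IsFiltered (n m : ℕ) (P : ℝ → Prop) [DecidablePred P] (V M V' M' : ℕ → ℝ) : Prop :=
  ∀ φ : ℝ → ℝ → ℝ, ∑ k ∈ range m, φ (V' k) (M' k) =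
    ∑ k ∈ range n, if P (V k) then φ (V k) (M k) else 0

/-- For `u' > u` the discarded cells all lie below `u'`, so they contribute exactly the shift of
`κ`. And `u' ≤ u` is impossible: all kept weight would lie above `u'`, and the first quantile
inequality would contradict `hκ`. -/
theorem IsQuantile.of_right {n m : ℕ} {V M V' M' : ℕ → ℝ} {κ u u' : ℝ}
    (hf : IsFiltered n m (u < ·) V M V' M')
    (hκ : κ + ∑ k ∈ range n, (if V k ≤ u then M k else 0) <
      ∑ k ∈ range n, (if u < V k then M k else 0))
    (h : IsQuantile m V' M' (κ + ∑ k ∈ range n, (if V k ≤ u then M k else 0)) u') :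
    IsQuantile n V M κ u' := by
  obtain ⟨h1, h2⟩ := h
  have f1 := hf fun v w => if v ≤ u' then w else 0
  have f2 := hf fun v w => if v < u' then w else 0
  have f3 := hf fun v w => if u' ≤ v then w else 0
  have f4 := hf fun v w => if u' < v then w else 0
  have huu : u < u' := by
    by_contra! hc
    have e1 : ∑ k ∈ range n, (if u < V k then (if V k ≤ u' then M k else 0) else 0) = 0 :=
      sum_eq_zero fun k _ => by
        by_cases hk : u < V k
        · simp [hk, (hc.trans_lt hk).not_ge]
        · simp [hk]
    have e4 : ∑ k ∈ range n, (if u < V k then (if u' < V k then M k else 0) else 0) =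
        ∑ k ∈ range n, (if u < V k then M k else 0) :=
      sum_congr rfl fun k _ => by
        by_cases hk : u < V k
        · simp [hk, hc.trans_lt hk]
        · simp [hk]
    linarith
  have g1 : ∑ k ∈ range n, (if V k ≤ u' then M k else 0) =
      ∑ k ∈ range n, (if V k ≤ u then M k else 0) +
      ∑ k ∈ range n, (if u < V k then (if V k ≤ u' then M k else 0) else 0) :=
    sum_eq_add_of_forall fun k => by
      by_cases hk : u < V k
      · simp [hk, hk.not_ge]
      · simp [hk, not_lt.1 hk, (not_lt.1 hk).trans huu.le]
  have g2 : ∑ k ∈ range n, (if V k < u' then M k else 0) =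
      ∑ k ∈ range n, (if V k ≤ u then M k else 0) +
      ∑ k ∈ range n, (if u < V k then (if V k < u' then M k else 0) else 0) :=
    sum_eq_add_of_forall fun k => by
      by_cases hk : u < V k
      · simp [hk, hk.not_ge]
      · simp [hk, not_lt.1 hk, (not_lt.1 hk).trans_lt huu]
  have g3 : ∑ k ∈ range n, (if u' ≤ V k then M k else 0) =
      ∑ k ∈ range n, (if u < V k then (if u' ≤ V k then M k else 0) else 0) :=
    sum_congr rfl fun k _ => by
      by_cases hk : u < V k
      · simp [hk]
      · simp [hk, (not_lt.1 hk).trans_lt huu]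
  have g4 : ∑ k ∈ range n, (if u' < V k then M k else 0) =
      ∑ k ∈ range n, (if u < V k then (if u' < V k then M k else 0) else 0) :=
    sum_congr rfl fun k _ => by
      by_cases hk : u < V k
      · simp [hk]
      · simp [hk, (not_lt.1 hk).trans huu.le]
  constructor <;> linarith

theorem IsQuantile.neg {n : ℕ} {V M : ℕ → ℝ} {κ u : ℝ} (h : IsQuantile n V M κ u) :
    IsQuantile n (fun k => -V k) M (-κ) (-u) := by
  obtain ⟨h1, h2⟩ := h
  unfold IsQuantile
  simp only [neg_lt_neg_iff, neg_le_neg_iff]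
  constructor <;> linarith

/-- The mirror image of `IsQuantile.of_right` under a change of sign of the values, of `κ` and of
`u`. -/
theorem IsQuantile.of_left {n m : ℕ} {V M V' M' : ℕ → ℝ} {κ u u' : ℝ}
    (hf : IsFiltered n m (· < u) V M V' M')
    (hκ : ∑ k ∈ range n, (if u ≤ V k then M k else 0) <
      κ + ∑ k ∈ range n, (if V k < u then M k else 0))
    (h : IsQuantile m V' M' (κ - ∑ k ∈ range n, (if u ≤ V k then M k else 0)) u') :
    IsQuantile n V M κ u' := by
  have := IsQuantile.of_right (n := n) (V := fun k => -V k) (M := M) (V' := fun k => -V' k)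
    (M' := M') (κ := -κ) (u := -u) (u' := -u') (m := m) ?_ ?_ ?_
  · simpa using this.neg
  · intro φ
    simpa using hf fun v w => φ (-v) w
  · simp only [neg_le_neg_iff, neg_lt_neg_iff]
    linarith
  · convert h.neg using 1
    simp only [neg_le_neg_iff]
    ring

/-- Everything below the current segment is unchanged. -/
structure Below (s s' : State) : Prop where
  lo : s'.natVar 0 = s.natVar 0
  stackNat : ∀ x ≤ s.natVar 0, s'.natArr 0 x = s.natArr 0 x
  stackReal : ∀ x ≤ s.natVar 0, s'.realArr 12 x = s.realArr 12 x
  values : ∀ x < s.natVar 0, s'.realArr 10 x = s.realArr 10 x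
  weights : ∀ x < s.natVar 0, s'.realArr 11 x = s.realArr 11 x

theorem Below.trans {s s' s'' : State} (h : Below s s') (h' : Below s' s'') : Below s s'' := by
  have := h.lo
  refine ⟨h'.lo.trans h.lo, fun x hx => ?_, fun x hx => ?_, fun x hx => ?_, fun x hx => ?_⟩
  · rw [h'.stackNat x (by omega), h.stackNat x hx]
  · rw [h'.stackReal x (by omega), h.stackReal x hx]
  · rw [h'.values x (by omega), h.values x hx]
  · rw [h'.weights x (by omega), h.weights x hx]

theorem Cmd.quantileSums_runs (procs : List Cmd) (s : State) (lo n : ℕ) (u : ℝ)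
    (V M : ℕ → ℝ) (hlo : s.natVar 0 = lo) (hn : s.natVar 1 = n) (hu : s.realVar 0 = u)
    (hV : ∀ k < n, s.realArr 10 (lo + k) = V k) (hM : ∀ k < n, s.realArr 11 (lo + k) = M k) :
    Runs procs .quantileSums s (n * 100 + 120) (fun s' =>
      Frame ⟨[3], [2, 3, 4], [], [], []⟩ s s' ∧
      s'.realVar 2 = ∑ k ∈ range n, (if V k < u then M k else 0) ∧
      s'.realVar 3 = ∑ k ∈ range n, (if u < V k then M k else 0) ∧
      s'.realVar 4 = ∑ k ∈ range n, (if V k = u then M k else 0)) := by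
  refine Runs.seq_simple rfl (K₂ := n * 100 + 100 + 3) ?_
    (by simp [Cmd.bound, RExp.cost]; omega)
  have hF0 : Frame ⟨[3], [2, 3, 4], [], [], []⟩ s ((Cmd.setReal 2 (.const 0) ;;
      .setReal 3 (.const 0) ;; .setReal 4 (.const 0)).run s) := by
    refine ⟨fun _ _ => rfl, fun x hx => ?_, fun _ _ => rfl, fun _ _ => rfl⟩
    simp at hx
    simp [hx]
  refine (Runs.forUp ⟨[], [2, 3, 4], [], [], []⟩ 100 n (fun j s' =>
    s'.realVar 2 = ∑ k ∈ range j, (if V k < u then M k else 0) ∧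
    s'.realVar 3 = ∑ k ∈ range j, (if u < V k then M k else 0) ∧
    s'.realVar 4 = ∑ k ∈ range j, (if V k = u then M k else 0)) rfl rfl (by simp) (by simp) rfl
    (by decide) (by simpa using hn) (by simp) ?_).mono le_rfl ?_
  · rintro j hj s' hF hi ⟨h2, h3, h4⟩
    have e0 : s'.natVar 0 = lo := by rw [hF.nat 0 (by simp [Footprint.addNat])]; simpa using hlo
    have eu : s'.realVar 0 = u := by rw [hF.real 0 (by simp [Footprint.addNat])]; simpa using hu
    have eV : s'.realArr 10 (lo + j) = V j := by
      rw [hF.realArr 10 (by simp [Footprint.addNat])]; simpa using hV j hj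
    have eM : s'.realArr 11 (lo + j) = M j := by
      rw [hF.realArr 11 (by simp [Footprint.addNat])]; simpa using hM j hj
    rcases lt_trichotomy (V j) u with h | h | h
    · simp [e0, eu, eV, eM, hi, sum_range_succ, h, h.not_gt, h.ne, h2, h3, h4]
    · simp [e0, eu, eV, eM, hi, sum_range_succ, h, h2, h3, h4]
    · simp [e0, eu, eV, eM, hi, sum_range_succ, h, h.not_gt, h.ne', h2, h3, h4]
  · rintro s' ⟨hF, h⟩
    exact ⟨hF0.trans hF, h⟩

theorem Cmd.quantileFilter_runs (procs : List Cmd) (s : State) (lo n : ℕ) (u σ : ℝ)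
    (V M : ℕ → ℝ) (hlo : s.natVar 0 = lo) (hn : s.natVar 1 = n) (hu : s.realVar 0 = u)
    (hσ : s.realVar 11 = σ)
    (hV : ∀ k < n, s.realArr 10 (lo + k) = V k) (hM : ∀ k < n, s.realArr 11 (lo + k) = M k) :
    Runs procs .quantileFilter s (n * 100 + 120) (fun s' =>
      Frame ⟨[3, 4], [], [], [10, 11], []⟩ s s' ∧
      IsFiltered n (s'.natVar 4) (fun v => 0 < σ * (v - u)) V M
        (fun k => s'.realArr 10 (lo + k)) (fun k => s'.realArr 11 (lo + k)) ∧
      (∀ k < s'.natVar 4, ∃ i < n, s'.realArr 11 (lo + k) = M i) ∧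
      (∀ x < lo, s'.realArr 10 x = s.realArr 10 x) ∧
      (∀ x < lo, s'.realArr 11 x = s.realArr 11 x)) := by
  refine Runs.seq_simple rfl (K₂ := n * 100 + 100 + 3) ?_
    (by simp [Cmd.bound, NExp.cost]; omega)
  have hF0 : Frame ⟨[3, 4], [], [], [10, 11], []⟩ s ((Cmd.setNat 4 (.const 0)).run s) := by
    refine ⟨fun x hx => ?_, fun _ _ => rfl, fun _ _ => rfl, fun _ _ => rfl⟩
    simp at hx
    simp [hx]
  -- Filtering in place is safe because the write position never overtakes the read position; the
  -- last two clauses say that the unread cells are intact.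
  refine (Runs.forUp ⟨[4], [], [], [10, 11], []⟩ 100 n (fun j s' => s'.natVar 4 ≤ j ∧
      IsFiltered j (s'.natVar 4) (fun v => 0 < σ * (v - u)) V M
        (fun k => s'.realArr 10 (lo + k)) (fun k => s'.realArr 11 (lo + k)) ∧
      (∀ k < s'.natVar 4, ∃ i < n, s'.realArr 11 (lo + k) = M i) ∧
      (∀ x < lo, s'.realArr 10 x = s.realArr 10 x) ∧
      (∀ x < lo, s'.realArr 11 x = s.realArr 11 x) ∧
      (∀ k < n, j ≤ k → s'.realArr 10 (lo + k) = V k) ∧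
      (∀ k < n, j ≤ k → s'.realArr 11 (lo + k) = M k))
    rfl rfl (by simp) (by simp) rfl
    (by decide) (by simpa using hn) ?_ ?_).mono le_rfl ?_
  · simp only [Cmd.run, NExp.eval]
    refine ⟨by simp, ?_, by simp, by simp, by simp, fun k hk _ => hV k hk, fun k hk _ => hM k hk⟩
    intro φ
    simp
  · rintro j hj s' hF hi ⟨h4, hf, hm, hbV, hbM, hjV, hjM⟩
    have e0 : s'.natVar 0 = lo := by rw [hF.nat 0 (by simp [Footprint.addNat])]; simpa using hlo
    have eu : s'.realVar 0 = u := by rw [hF.real 0 (by simp [Footprint.addNat])]; simpa using hu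
    have eσ : s'.realVar 11 = σ := by rw [hF.real 11 (by simp [Footprint.addNat])]; simpa using hσ
    have eV := hjV j hj le_rfl
    have eM := hjM j hj le_rfl
    by_cases h : 0 < σ * (V j - u)
    · obtain ⟨m, hm4⟩ : ∃ m, s'.natVar 4 = m := ⟨_, rfl⟩
      simp only [hm4] at h4 hf hm
      simp [e0, eu, eV, eσ, hi, h, eM, hm4]
      refine ⟨h4, ?_, ?_, ?_, ?_, ?_, ?_⟩
      · intro φ
        rw [sum_range_succ, sum_range_succ, ← hf φ]
        simp only [Function.update_self, h, if_true]
        congr 1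
        refine sum_congr rfl fun k hk => ?_
        have : k ≠ m := by simp at hk; omega
        simp [this]
      · intro k hk
        by_cases hkm : k = m
        · exact ⟨j, hj, by simp [hkm]⟩
        · simpa [hkm] using hm k (by omega)
      · intro x hx
        have : x ≠ lo + m := by omega
        simp [this, hbV x hx]
      · intro x hx
        have : x ≠ lo + m := by omega
        simp [this, hbM x hx]
      · intro k hk hjk
        have : k ≠ m := by omega
        simp [this, hjV k hk (by omega)]
      · intro k hk hjk
        have : k ≠ m := by omega
        simp [this, hjM k hk (by omega)]
    · simp [e0, eu, eV, eσ, hi, h]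
      refine ⟨by omega, ?_, hm, hbV, hbM, fun k hk hjk => hjV k hk (by omega),
        fun k hk hjk => hjM k hk (by omega)⟩
      intro φ
      rw [sum_range_succ, ← hf φ]
      simp [h]
  · rintro s' ⟨hF, -, h1, h2, h3, h4, -⟩
    refine ⟨hF0.trans ⟨?_, hF.real, hF.natArr, hF.realArr⟩, h1, h2, h3, h4⟩
    intro x hx
    exact hF.nat x (by simpa [Footprint.addNat] using hx)

/-- The time needed by `Cmd.quantile` on a segment of length `n`. -/
def quantileTime (n : ℕ) : ℕ := 100000 * n + 10

/-- The specification of the procedure `Cmd.quantile` for segments of length `n`. -/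
def QuantileSpec (procs : List Cmd) (n : ℕ) : Prop :=
  ∀ s : State, s.natVar 1 = n → Runs procs (.call 0) s (quantileTime n) fun s' =>
    Below s s' ∧ (n = 0 → s'.realVar 0 = s.realVar 0) ∧
    ∀ V M : ℕ → ℝ, (∀ k < n, s.realArr 10 (s.natVar 0 + k) = V k) →
      (∀ k < n, s.realArr 11 (s.natVar 0 + k) = M k) → (∀ k < n, 0 ≤ M k) →
      -∑ k ∈ range n, M k ≤ s.realVar 1 → s.realVar 1 ≤ ∑ k ∈ range n, M k →
      IsQuantile n V M (s.realVar 1) (s'.realVar 0)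

/-- At least the fraction `3 / 10` (up to rounding) of the values lies on each side. -/
def IsPivot (n : ℕ) (V : ℕ → ℝ) (u : ℝ) : Prop :=
  (1 ≤ ∑ k ∈ range n, (if V k ≤ u then (1 : ℝ) else 0) ∧
    1 ≤ ∑ k ∈ range n, (if u ≤ V k then (1 : ℝ) else 0)) ∧
  (24 ≤ n → (3 * ((n : ℝ) - 4) ≤ 10 * ∑ k ∈ range n, (if V k ≤ u then (1 : ℝ) else 0) ∧
    3 * ((n : ℝ) - 4) ≤ 10 * ∑ k ∈ range n, (if u ≤ V k then (1 : ℝ) else 0)))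

/-- With unit weights and `κ = 0` a quantile is a median: the two inequalities compare the number of
values on one side with the number of the others. -/
theorem IsQuantile.le_two_mul_card {n : ℕ} {V M : ℕ → ℝ} {u : ℝ} (hM : ∀ k < n, M k = 1)
    (h : IsQuantile n V M 0 u) :
    (n : ℝ) ≤ 2 * ∑ k ∈ range n, (if V k ≤ u then (1 : ℝ) else 0) ∧
    (n : ℝ) ≤ 2 * ∑ k ∈ range n, (if u ≤ V k then (1 : ℝ) else 0) := by
  have hc : ∀ P : ℕ → Prop, ∀ _ : DecidablePred P, ∑ k ∈ range n, (if P k then M k else 0) =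
      ∑ k ∈ range n, (if P k then (1 : ℝ) else 0) := fun P _ =>
    sum_congr rfl fun k hk => by rw [hM k (by simpa using hk)]
  obtain ⟨h1, h2⟩ := h
  rw [hc, hc] at h1 h2
  have e1 := sum_split n V (fun _ => 1) u
  have e2 := sum_split' n V (fun _ => 1) u
  simp only [sum_const, card_range, nsmul_eq_mul, mul_one] at e1 e2
  constructor <;> linarith

theorem Cmd.pivot_runs {procs : List Cmd} (hp : procs[0]? = some .quantile) (n : ℕ) (hn0 : 0 < n)
    (ih : ∀ m < n, QuantileSpec procs m) (s : State) (hn : s.natVar 1 = n) (T : ℕ)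
    (hT : 400 ≤ T) (hT' : 24 ≤ n → quantileTime (n / 5) + (n / 5 * 300 + 400) ≤ T) :
    Runs procs .pivot s T fun s' =>
      Frame quantileFootprint s s' ∧ Below s s' ∧ s'.natVar 1 = n ∧ s'.realVar 1 = s.realVar 1 ∧
      (∀ k < n, s'.realArr 10 (s.natVar 0 + k) = s.realArr 10 (s.natVar 0 + k)) ∧
      (∀ k < n, s'.realArr 11 (s.natVar 0 + k) = s.realArr 11 (s.natVar 0 + k)) ∧
      IsPivot n (fun k => s.realArr 10 (s.natVar 0 + k)) (s'.realVar 0) := by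
  refine (Runs.frame (A := quantileFootprint) ?_ ?_ (by rfl))
  swap
  · intro p hp' c hc
    obtain rfl : p = 0 := by simpa [quantileFootprint] using hp'
    obtain rfl : Cmd.quantile = c := by simpa [hp] using hc
    rfl
  obtain ⟨lo, hlo⟩ : ∃ lo, s.natVar 0 = lo := ⟨_, rfl⟩
  refine Runs.cond (K₁ := T - 10) (fun hb => ?_) (fun hb => ?_)
    (by simp [BExp.cost, NExp.cost]; omega)
  · refine Runs.of_simple rfl (le_trans (b := 200) (by decide) (by omega)) ?_
    have hlt : n < 24 := by simpa [hn] using hb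
    refine ⟨⟨by simp, by simp, by simp, by simp, by simp⟩, by simp [hn], by simp, by simp,
      by simp, ⟨?_, ?_⟩, fun h => absurd hlt (by omega)⟩
    · refine le_trans ?_ (single_le_sum (f := fun k => if s.realArr 10 (s.natVar 0 + k) ≤ _ then
        (1 : ℝ) else 0) (fun k _ => by positivity) (mem_range.2 hn0))
      simp
    · refine le_trans ?_ (single_le_sum (f := fun k => if _ ≤ s.realArr 10 (s.natVar 0 + k) then
        (1 : ℝ) else 0) (fun k _ => by positivity) (mem_range.2 hn0))
      simp
  · have hge : 24 ≤ n := by simpa [hn] using hb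
    have hT' := hT' hge
    refine Runs.seq (Cmd.medians5_runs procs s lo n hlo hn)
      (K₂ := quantileTime (n / 5) + 70) ?_ (by omega)
    rintro s₁ ⟨h4, hF, hV, hM, h1, hu, hu'⟩
    have e0 : s₁.natVar 0 = lo := by rw [hF.nat 0 (by simp), hlo]
    have e1 : s₁.natVar 1 = n := by rw [hF.nat 1 (by simp), hn]
    have eκ : s₁.realVar 1 = s.realVar 1 := by rw [hF.real 1 (by simp)]
    have eN : s₁.natArr = s.natArr := funext fun i => hF.natArr i (by simp)
    have eS : s₁.realArr 12 = s.realArr 12 := hF.realArr 12 (by simp)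
    refine Runs.seq_simple rfl (K₂ := quantileTime (n / 5) + 40) ?_
      (by simp [Cmd.bound, NExp.cost, RExp.cost]; omega)
    refine Runs.seq (ih (n / 5) (by omega) _ (by simpa using h4)) (K₂ := 20) ?_ (by omega)
    rintro s₂ ⟨hB, -, hQ⟩
    refine Runs.of_simple rfl (by decide) ?_
    have hlo2 := hB.lo
    have hsn := hB.stackNat
    have hsr := hB.stackReal
    have hva := hB.values
    have hwe := hB.weights
    simp [e0, e1, eN, eκ, eS] at hlo2 hsn hsr hva hwe
    -- The saved data lie in the very first cell of the callee's segment. This is why `Below`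
    -- protects the stack arrays up to and including the start, but values and weights only before
    -- it.
    have hsn' := hsn (lo + n) le_rfl
    have hsr' := hsr (lo + n) le_rfl
    simp only [Function.update_self] at hsn' hsr'
    have hQ' := hQ _ (fun _ => 1) (fun k _ => rfl) (fun k hk => by simpa [e0, e1] using h1 k hk)
      (fun _ _ => zero_le_one) (by simp) (by simp)
    simp [e0, e1] at hQ'
    obtain ⟨c1, c2⟩ := hQ'.le_two_mul_card (fun _ _ => rfl)
    have d1 := hu (s₂.realVar 0)
    have d2 := hu' (s₂.realVar 0)
    have hmul : ∀ P : ℕ → Prop, ∀ _ : DecidablePred P,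
        ∑ k ∈ range (n / 5), (if P k then (3 : ℝ) else 0) =
        3 * ∑ k ∈ range (n / 5), (if P k then (1 : ℝ) else 0) := fun P _ => by
      rw [mul_sum]; exact sum_congr rfl fun k _ => by split_ifs <;> norm_num
    rw [hmul] at d1 d2
    have hn5 : (n : ℝ) ≤ 5 * ((n / 5 : ℕ) : ℝ) + 4 := by
      exact_mod_cast (by omega : n ≤ 5 * (n / 5) + 4)
    have hnn : (24 : ℝ) ≤ n := by exact_mod_cast hge
    simp only [Cmd.run, NExp.eval, RExp.eval]
    refine ⟨⟨?_, ?_, ?_, ?_, ?_⟩, ?_, ?_, ?_, ?_, ?_⟩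
    · simp [hlo2, hsn', hlo]
    · intro x hx
      rw [hlo] at hx
      have : x ≠ lo + n := by omega
      simp [hsn x (by omega), this]
    · intro x hx
      rw [hlo] at hx
      have : x ≠ lo + n := by omega
      simp [hsr x (by omega), this]
    · intro x hx
      simp [hva x (by omega), hV x (by omega)]
    · intro x hx
      simp [hwe x (by omega), hM x (by omega)]
    · simp [hlo2, hsn']
    · simp [hlo2, hsr']
    · intro x hx
      simp [hva _ (by omega : s.natVar 0 + x < lo + n), hV _ (by omega : s.natVar 0 + x < lo + n)]
    · intro x hx
      simp [hwe _ (by omega : s.natVar 0 + x < lo + n), hM _ (by omega : s.natVar 0 + x < lo + n)]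
    · suffices IsPivot n (fun k => s.realArr 10 (lo + k)) (s₂.realVar 0) by simpa [hlo] using this
      -- Half of the `n / 5` block medians lie on each side, each brings three values, and `5 * (n /
      -- 5) ≥ n - 4`.
      exact ⟨⟨by linarith, by linarith⟩, fun _ => ⟨by linarith, by linarith⟩⟩

theorem IsQuantile.congr {n : ℕ} {V M V' M' : ℕ → ℝ} {κ u : ℝ} (h : IsQuantile n V M κ u)
    (hV : ∀ k < n, V k = V' k) (hM : ∀ k < n, M k = M' k) : IsQuantile n V' M' κ u := by
  have e : ∀ P : ℝ → Prop, ∀ _ : DecidablePred P, ∑ k ∈ range n, (if P (V k) then M k else 0) =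
      ∑ k ∈ range n, (if P (V' k) then M' k else 0) := fun P _ =>
    sum_congr rfl fun k hk => by rw [hV k (by simpa using hk), hM k (by simpa using hk)]
  obtain ⟨h1, h2⟩ := h
  unfold IsQuantile
  rw [← e (u < ·), ← e (· ≤ u), ← e (· < u), ← e (u ≤ ·)]
  exact ⟨h1, h2⟩

theorem IsFiltered.sum_weights {n m : ℕ} {P : ℝ → Prop} [DecidablePred P] {V M V' M' : ℕ → ℝ}
    (h : IsFiltered n m P V M V' M') :
    ∑ k ∈ range m, M' k = ∑ k ∈ range n, if P (V k) then M k else 0 := h fun _ w => w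

theorem IsFiltered.card {n m : ℕ} {P : ℝ → Prop} [DecidablePred P] {V M V' M' : ℕ → ℝ}
    (h : IsFiltered n m P V M V' M') :
    (m : ℝ) = ∑ k ∈ range n, if P (V k) then (1 : ℝ) else 0 := by
  simpa using h fun _ _ => 1

theorem Cmd.quantileSide_run (s : State) (κ a b e : ℝ) (h1 : s.realVar 1 = κ)
    (h2 : s.realVar 2 = a) (h3 : s.realVar 3 = b) (h4 : s.realVar 4 = e) :
    (κ + a + e < b ∧ (Cmd.quantileSide.run s).realVar 11 = 1 ∧
      (Cmd.quantileSide.run s).realVar 1 = κ + a + e) ∨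
    (b + e < κ + a ∧ (Cmd.quantileSide.run s).realVar 11 = -1 ∧
      (Cmd.quantileSide.run s).realVar 1 = κ - b - e) ∨
    (b ≤ κ + a + e ∧ κ + a ≤ b + e ∧ (Cmd.quantileSide.run s).realVar 11 = 0) := by
  by_cases hr : κ + a + e < b
  · left
    simp [Cmd.quantileSide, h1, h2, h3, h4, hr]
  · by_cases hl : b + e < κ + a
    · right; left
      simp [Cmd.quantileSide, h1, h2, h3, h4, hr, hl]
    · right; right
      simp [Cmd.quantileSide, h1, h2, h3, h4, hr, hl]
      exact ⟨not_lt.1 hr, not_lt.1 hl⟩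

/-- The two recursive calls take the fractions `1 / 5` and `7 / 10`; the remaining tenth pays for
the linear work and the rounding terms once `n ≥ 24`. Shorter segments merely lose at least one cell
per call. -/
theorem quantileTime_step {n : ℕ} (hn : 0 < n) :
    (if 24 ≤ n then quantileTime (n / 5) + (n / 5 * 300 + 400) else 400) + (200 * n + 600) +
      (if 24 ≤ n then 70000 * n + 120000 else 100000 * (n - 1)) ≤ 100000 * n := by
  unfold quantileTime
  by_cases h : 24 ≤ n
  · simp only [h, if_true]
    have : 5 * (n / 5) ≤ n := by omega
    generalize n / 5 = q at this
    linarith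
  · simp only [h, if_false]
    obtain ⟨n, rfl⟩ : ∃ k, n = k + 1 := ⟨n - 1, by omega⟩
    simp only [Nat.add_sub_cancel]
    linarith

/-- Strong induction covers both the call for the pivot and the call on the kept side. The condition
that `|κ|` is at most the total weight is inherited by the kept side; for the empty segment it
forces `κ = 0`. -/
theorem Cmd.quantile_spec {procs : List Cmd} (hp : procs[0]? = some .quantile) (n : ℕ) :
    QuantileSpec procs n := by
  induction n using Nat.strong_induction_on with
  | h n ih =>
  intro s hn
  refine Runs.call (K₁ := 100000 * n + 9) hp ?_ (by simp [quantileTime])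
  refine Runs.cond (K₁ := 100000 * n + 5) (fun hb => ?_) (fun hb => ?_)
    (by simp [BExp.cost, NExp.cost]; omega)
  swap
  · obtain rfl : n = 0 := by simpa [hn] using hb
    refine Runs.of_simple rfl (by simp [Cmd.bound]) ⟨⟨rfl, ?_, ?_, ?_, ?_⟩, fun _ => rfl, ?_⟩
    iterate 4 intro _ _; rfl
    intro V M _ _ _ h1 h2
    simp only [range_zero, sum_empty, neg_zero] at h1 h2
    exact ⟨by simpa using h1, by simpa using h2⟩
  have hn0 : 0 < n := by simpa [hn] using hb
  obtain ⟨lo, hlo⟩ : ∃ lo, s.natVar 0 = lo := ⟨_, rfl⟩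
  obtain ⟨V, hV⟩ : ∃ V : ℕ → ℝ, ∀ k, s.realArr 10 (lo + k) = V k := ⟨_, fun _ => rfl⟩
  obtain ⟨M, hM⟩ : ∃ M : ℕ → ℝ, ∀ k, s.realArr 11 (lo + k) = M k := ⟨_, fun _ => rfl⟩
  obtain ⟨T, hT⟩ : ∃ T, T = if 24 ≤ n then quantileTime (n / 5) + (n / 5 * 300 + 400) else 400 :=
    ⟨_, rfl⟩
  have hT1 : 400 ≤ T := by rw [hT]; split_ifs <;> omega
  have hT2 : 24 ≤ n → quantileTime (n / 5) + (n / 5 * 300 + 400) ≤ T := fun h => by simp [hT, h]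
  have hT3 : T + (200 * n + 600) + (if 24 ≤ n then 70000 * n + 120000 else 100000 * (n - 1)) ≤
      100000 * n := by
    rw [hT]
    exact quantileTime_step hn0
  refine Runs.seq (Cmd.pivot_runs hp n hn0 ih s hn T hT1 hT2) (K₂ := 100000 * n + 4 - T) ?_
    (by omega)
  rintro s₁ ⟨-, hB1, e1n, e1κ, e1V, e1M, hpiv⟩
  obtain ⟨u, hu⟩ : ∃ u, s₁.realVar 0 = u := ⟨_, rfl⟩
  obtain ⟨κ, hκ⟩ : ∃ κ, s.realVar 1 = κ := ⟨_, rfl⟩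
  have e1lo := hB1.lo
  rw [hlo] at e1V e1M hpiv e1lo
  simp only [hV, hM, hu, hκ] at e1V e1M hpiv e1κ
  refine Runs.seq (Cmd.quantileSums_runs procs s₁ lo n u V M e1lo e1n hu e1V e1M)
    (K₂ := 100000 * n + 3 - T - (100 * n + 120)) ?_ (by omega)
  rintro s₂ ⟨hF2, h2, h3, h4⟩
  refine Runs.seq_simple rfl (K₂ := 100000 * n + 2 - T - (100 * n + 220)) ?_
    (by simp [Cmd.quantileSide, Cmd.bound, BExp.cost, RExp.cost]; omega)
  obtain ⟨k₃, hk₃, -⟩ := Cmd.quantileSide.exec_run procs rfl s₂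
  have hF3 := hk₃.frame (A := ⟨[], [1, 11], [], [], []⟩) (by simp) (by rfl)
  have hside := Cmd.quantileSide_run s₂ κ _ _ _ (by rw [hF2.real 1 (by simp), e1κ]) h2 h3 h4
  generalize Cmd.quantileSide.run s₂ = s₃ at hF3 hside
  clear hk₃
  have hB3 : Below s₁ s₃ := by
    refine ⟨?_, ?_, ?_, ?_, ?_⟩
    · rw [hF3.nat 0 (by simp), hF2.nat 0 (by simp)]
    · intro x _; rw [hF3.natArr 0 (by simp), hF2.natArr 0 (by simp)]
    · intro x _; rw [hF3.realArr 12 (by simp), hF2.realArr 12 (by simp)]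
    · intro x _; rw [hF3.realArr 10 (by simp), hF2.realArr 10 (by simp)]
    · intro x _; rw [hF3.realArr 11 (by simp), hF2.realArr 11 (by simp)]
  have e3lo : s₃.natVar 0 = lo := by rw [hB3.lo, e1lo]
  have e3n : s₃.natVar 1 = n := by rw [hF3.nat 1 (by simp), hF2.nat 1 (by simp), e1n]
  have e3u : s₃.realVar 0 = u := by rw [hF3.real 0 (by simp), hF2.real 0 (by simp), hu]
  have e3V : ∀ k < n, s₃.realArr 10 (lo + k) = V k := fun k hk => by
    rw [hF3.realArr 10 (by simp), hF2.realArr 10 (by simp), e1V k hk]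
  have e3M : ∀ k < n, s₃.realArr 11 (lo + k) = M k := fun k hk => by
    rw [hF3.realArr 11 (by simp), hF2.realArr 11 (by simp), e1M k hk]
  obtain ⟨σ, hσ⟩ : ∃ σ, s₃.realVar 11 = σ := ⟨_, rfl⟩
  refine Runs.seq (Cmd.quantileFilter_runs procs s₃ lo n u σ V M e3lo e3n e3u hσ e3V e3M)
    (K₂ := 100000 * n + 1 - T - (200 * n + 340)) ?_ (by omega)
  rintro s₄ ⟨hF4, hf, hpos, hbV, hbM⟩
  obtain ⟨m, hm⟩ : ∃ m, s₄.natVar 4 = m := ⟨_, rfl⟩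
  rw [hm] at hf hpos
  have e4u : s₄.realVar 0 = u := by rw [hF4.real 0 (by simp), e3u]
  have e4lo : s₄.natVar 0 = lo := by rw [hF4.nat 0 (by simp), e3lo]
  have hB4 : Below s₃ s₄ := by
    refine ⟨by rw [e4lo, e3lo], ?_, ?_, ?_, ?_⟩
    · intro x _; rw [hF4.natArr 0 (by simp)]
    · intro x _; rw [hF4.realArr 12 (by simp)]
    · intro x hx; exact hbV x (by omega)
    · intro x hx; exact hbM x (by omega)
  have s1 := sum_split n V (fun _ => 1) u
  have s2 := sum_split' n V (fun _ => 1) u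
  simp only [sum_const, card_range, nsmul_eq_mul, mul_one] at s1 s2
  have hcard := hf.card
  -- The kept values lie strictly on one side of the pivot, so all values on the other closed side
  -- are dropped.
  have hmn : (m : ℝ) ≤ n - ∑ k ∈ range n, (if V k ≤ u then (1 : ℝ) else 0) ∨
      (m : ℝ) ≤ n - ∑ k ∈ range n, (if u ≤ V k then (1 : ℝ) else 0) := by
    rcases hside with ⟨-, h, -⟩ | ⟨-, h, -⟩ | ⟨-, -, h⟩ <;> rw [hσ] at h <;> rw [h] at hcard
    · left; simp only [one_mul, sub_pos] at hcard; linarith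
    · right; simp only [neg_mul, one_mul, neg_sub, sub_pos] at hcard; linarith
    · left
      have : 0 ≤ ∑ k ∈ range n, (if u < V k then (1 : ℝ) else 0) :=
        sum_nonneg fun _ _ => by positivity
      have hm0 : (m : ℝ) = 0 := by rw [hcard]; simp
      linarith
  obtain ⟨⟨p1, p2⟩, p3⟩ := hpiv
  have hlt : m < n := by
    have : (m : ℝ) < n := by rcases hmn with h | h <;> linarith
    exact_mod_cast this
  have h24 : 24 ≤ n → 10 * m ≤ 7 * n + 12 := fun h => by
    obtain ⟨q1, q2⟩ := p3 h
    have : (10 : ℝ) * m ≤ 7 * n + 12 := by rcases hmn with h | h <;> linarith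
    exact_mod_cast this
  have hK : quantileTime m ≤ if 24 ≤ n then 70000 * n + 120010 else 100000 * (n - 1) + 10 := by
    unfold quantileTime
    split_ifs with h
    · have := h24 h; omega
    · omega
  refine Runs.seq_simple rfl (K₂ := quantileTime m) ?_
    (by simp [Cmd.bound, NExp.cost]; split_ifs at hK hT3 <;> omega)
  refine (ih m hlt _ (by simpa using hm)).mono le_rfl ?_
  rintro s₅ ⟨hB5, hz, hQ⟩
  have hB45 : Below s₄ ((Cmd.setNat 1 (.var 4)).run s₄) := by
    refine ⟨by simp, ?_, ?_, ?_, ?_⟩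
    iterate 4 intro _ _; rfl
  refine ⟨hB1.trans (hB3.trans (hB4.trans (hB45.trans hB5))), fun h => absurd h hn0.ne', ?_⟩
  intro V' M' hV' hM' hpos' hκ1 hκ2
  rw [hlo] at hV' hM'
  simp only [hV, hM] at hV' hM'
  simp only [hκ] at hκ1 hκ2 ⊢
  have hsum : ∑ k ∈ range n, M' k = ∑ k ∈ range n, M k :=
    sum_congr rfl fun k hk => (hM' k (by simpa using hk)).symm
  rw [hsum] at hκ1 hκ2
  refine IsQuantile.congr ?_ hV' hM'
  replace hQ := hQ (fun k => s₄.realArr 10 (lo + k)) (fun k => s₄.realArr 11 (lo + k))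
    (fun k _ => by simp [e4lo]) (fun k _ => by simp [e4lo]) (fun k hk => by
      obtain ⟨i, hi, he⟩ := hpos k hk
      rw [he, hM' i hi]
      exact hpos' i hi)
  have hw := hf.sum_weights
  rw [hw] at hQ
  have e4κ : ((Cmd.setNat 1 (.var 4)).run s₄).realVar 1 = s₃.realVar 1 := by
    simp [hF4.real 1 (by simp)]
  rw [e4κ] at hQ
  have t1 := sum_split n V M u
  have t2 := sum_split' n V M u
  have t3 := sum_le_split n V M u
  have t4 := sum_ge_split n V M u
  rcases hside with ⟨hc, h, hκ'⟩ | ⟨hc, h, hκ'⟩ | ⟨hc, hc', h⟩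
  · rw [hσ] at h
    subst h
    simp only [one_mul, sub_pos] at hf hQ
    rw [hκ'] at hQ
    refine IsQuantile.of_right hf (by linarith) ?_
    convert hQ (by linarith) (by linarith) using 1
    linarith
  · rw [hσ] at h
    subst h
    simp only [neg_mul, one_mul, neg_sub, sub_pos] at hf hQ
    rw [hκ'] at hQ
    refine IsQuantile.of_left hf (by linarith) ?_
    convert hQ (by linarith) (by linarith) using 1
    linarith
  · rw [hσ] at h
    -- The sign is `0`, so nothing is kept, and the call on the empty segment returns the pivot, for
    -- which `hc` and `hc'` are the quantile inequalities.
    have hm0 : m = 0 := by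
      rw [h] at hcard
      simpa using hcard
    have : s₅.realVar 0 = u := by rw [hz hm0]; simpa using e4u
    rw [this]
    constructor <;> linarith

/-- The two inequalities say that the right derivative at `u` is nonnegative and the left one
nonpositive; the subgradient inequalities of the single terms add up to minimality. -/
theorem IsQuantile.le {n : ℕ} {V M : ℕ → ℝ} {κ u : ℝ} (h : IsQuantile n V M κ u)
    (hM : ∀ k < n, 0 ≤ M k) (u' : ℝ) :
    ∑ k ∈ range n, M k * |V k - u| + κ * u ≤ ∑ k ∈ range n, M k * |V k - u'| + κ * u' := by
  obtain ⟨h1, h2⟩ := h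
  rcases le_total u u' with hu | hu
  · have key : ∑ k ∈ range n, (M k * |V k - u| + (u' - u) *
        ((if V k ≤ u then M k else 0) - (if u < V k then M k else 0))) ≤
        ∑ k ∈ range n, M k * |V k - u'| := by
      refine sum_le_sum fun k hk => ?_
      have hk := hM k (by simpa using hk)
      by_cases hv : V k ≤ u
      · rw [if_pos hv, if_neg hv.not_gt, abs_of_nonpos (by linarith), abs_of_nonpos (by linarith)]
        linarith
      · rw [if_neg hv, if_pos (not_le.1 hv), abs_of_pos (by linarith)]
        have := mul_le_mul_of_nonneg_left (le_abs_self (V k - u')) hk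
        linarith
    rw [sum_add_distrib, ← mul_sum, sum_sub_distrib] at key
    nlinarith
  · have key : ∑ k ∈ range n, (M k * |V k - u| + (u - u') *
        ((if u ≤ V k then M k else 0) - (if V k < u then M k else 0))) ≤
        ∑ k ∈ range n, M k * |V k - u'| := by
      refine sum_le_sum fun k hk => ?_
      have hk := hM k (by simpa using hk)
      by_cases hv : u ≤ V k
      · rw [if_pos hv, if_neg hv.not_gt, abs_of_nonneg (by linarith), abs_of_nonneg (by linarith)]
        linarith
      · rw [if_neg hv, if_pos (not_le.1 hv), abs_of_neg (by linarith)]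
        have := mul_le_mul_of_nonneg_left (neg_abs_le (V k - u')) hk
        linarith
    rw [sum_add_distrib, ← mul_sum, sum_sub_distrib] at key
    nlinarith

/-! ### Piecewise linear convex functions and their directional derivatives -/

/-- A sum of weighted absolute values of affine functions of two variables plus a linear
function. -/
def linDev (n : ℕ) (P Q S W : ℕ → ℝ) (a b x y : ℝ) : ℝ :=
  ∑ k ∈ range n, W k * |S k - P k * x - Q k * y| + a * x + b * y

theorem linDev_convex {n : ℕ} {P Q S W : ℕ → ℝ} {a b : ℝ} (hW : ∀ k < n, 0 ≤ W k)
    {t : ℝ} (ht : 0 ≤ t) (ht' : t ≤ 1) (x y x' y' : ℝ) :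
    linDev n P Q S W a b ((1 - t) * x + t * x') ((1 - t) * y + t * y') ≤
      (1 - t) * linDev n P Q S W a b x y + t * linDev n P Q S W a b x' y' := by
  have key : ∑ k ∈ range n,
      W k * |S k - P k * ((1 - t) * x + t * x') - Q k * ((1 - t) * y + t * y')| ≤
      ∑ k ∈ range n, ((1 - t) * (W k * |S k - P k * x - Q k * y|) +
        t * (W k * |S k - P k * x' - Q k * y'|)) := by
    refine sum_le_sum fun k hk => ?_
    have hk := hW k (by simpa using hk)
    have e : S k - P k * ((1 - t) * x + t * x') - Q k * ((1 - t) * y + t * y') =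
      (1 - t) * (S k - P k * x - Q k * y) + t * (S k - P k * x' - Q k * y') := by ring
    rw [e]
    refine (mul_le_mul_of_nonneg_left (abs_add_le _ _) hk).trans (le_of_eq ?_)
    rw [abs_mul, abs_mul, abs_of_nonneg ht, abs_of_nonneg (sub_nonneg.2 ht')]
    ring
  rw [sum_add_distrib, ← mul_sum, ← mul_sum] at key
  unfold linDev
  linarith

/-- The weights of those terms which vanish. -/
noncomputable def zeroWeight (W ρ : ℕ → ℝ) (k : ℕ) : ℝ :=
  if 0 < ρ k then 0 else if ρ k < 0 then 0 else W k

/-- A coefficient of the linear part of the directional derivative. -/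
noncomputable def slopeCoeff (n : ℕ) (W ρ T : ℕ → ℝ) (a : ℝ) : ℝ :=
  a + ∑ k ∈ range n, if 0 < ρ k then -(W k * T k) else if ρ k < 0 then W k * T k else 0

/-- The directional derivative of `linDev` at the point `(0, u)`. -/
noncomputable def linDevDir (n : ℕ) (P Q S W : ℕ → ℝ) (a b u x y : ℝ) : ℝ :=
  linDev n P Q (fun _ => 0) (zeroWeight W fun k => S k - Q k * u)
    (slopeCoeff n W (fun k => S k - Q k * u) P a) (slopeCoeff n W (fun k => S k - Q k * u) Q b) x y

/-- The definition as a `linDev` makes the one-variable minimisation applicable to the derivative;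
this form shows the sign of each term and serves the estimates. -/
theorem linDevDir_eq (n : ℕ) (P Q S W : ℕ → ℝ) (a b u x y : ℝ) :
    linDevDir n P Q S W a b u x y = a * x + b * y + ∑ k ∈ range n,
      (if 0 < S k - Q k * u then -(W k * (P k * x + Q k * y)) else
        if S k - Q k * u < 0 then W k * (P k * x + Q k * y) else W k * |P k * x + Q k * y|) := by
  unfold linDevDir linDev slopeCoeff zeroWeight
  have : ∀ A B C : ℝ, A + (a + B) * x + (b + C) * y = a * x + b * y + (A + B * x + C * y) := by
    intros; ring
  rw [this, sum_mul, sum_mul, ← sum_add_distrib, ← sum_add_distrib]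
  congr 1
  refine sum_congr rfl fun k _ => ?_
  have e : |0 - P k * x - Q k * y| = |P k * x + Q k * y| := by
    rw [← abs_neg]; congr 1; ring
  rw [e]
  split_ifs <;> ring

/-- A convex function lies above its first-order approximation; termwise this is `±z ≤ |z|`. -/
theorem linDev_ge {n : ℕ} {P Q S W : ℕ → ℝ} {a b : ℝ} (hW : ∀ k < n, 0 ≤ W k) (u x y : ℝ) :
    linDev n P Q S W a b 0 u + linDevDir n P Q S W a b u x (y - u) ≤
      linDev n P Q S W a b x y := by
  rw [linDevDir_eq]
  unfold linDev
  have key : ∑ k ∈ range n, (W k * |S k - P k * 0 - Q k * u| +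
      (if 0 < S k - Q k * u then -(W k * (P k * x + Q k * (y - u))) else
        if S k - Q k * u < 0 then W k * (P k * x + Q k * (y - u)) else
          W k * |P k * x + Q k * (y - u)|)) ≤
      ∑ k ∈ range n, W k * |S k - P k * x - Q k * y| := by
    refine sum_le_sum fun k hk => ?_
    have hk := hW k (by simpa using hk)
    rw [mul_zero, sub_zero]
    split_ifs with h1 h2
    · rw [abs_of_pos h1]
      have := mul_le_mul_of_nonneg_left (le_abs_self (S k - P k * x - Q k * y)) hk
      linarith
    · rw [abs_of_neg h2]
      have := mul_le_mul_of_nonneg_left (neg_abs_le (S k - P k * x - Q k * y)) hk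
      linarith
    · have h0 : S k - Q k * u = 0 := le_antisymm (not_lt.1 h1) (not_lt.1 h2)
      have e : S k - P k * x - Q k * y = -(P k * x + Q k * (y - u)) := by linarith
      rw [h0, e, abs_neg, abs_zero]
      linarith
  rw [sum_add_distrib] at key
  linarith

/-- For short steps the first-order approximation is exact: nonzero residuals keep their sign, and
vanishing ones are homogeneous along the direction. -/
theorem exists_linDev_le (n : ℕ) (P Q S W : ℕ → ℝ) (a b u x y : ℝ) :
    ∃ ε > 0, linDev n P Q S W a b (ε * x) (u + ε * y) =
      linDev n P Q S W a b 0 u + ε * linDevDir n P Q S W a b u x y := by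
  have hev : ∀ k ∈ range n, ∀ᶠ ε in nhdsWithin (0 : ℝ) (Set.Ioi 0),
      W k * |S k - P k * (ε * x) - Q k * (u + ε * y)| = W k * |S k - P k * 0 - Q k * u| +
      ε * (if 0 < S k - Q k * u then -(W k * (P k * x + Q k * y)) else
        if S k - Q k * u < 0 then W k * (P k * x + Q k * y) else W k * |P k * x + Q k * y|) := by
    intro k _
    have hc : Filter.Tendsto (fun ε : ℝ => S k - P k * (ε * x) - Q k * (u + ε * y))
        (nhdsWithin 0 (Set.Ioi 0)) (nhds (S k - Q k * u)) := by
      have : Continuous fun ε : ℝ => S k - P k * (ε * x) - Q k * (u + ε * y) := by fun_prop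
      have := this.tendsto 0
      simp only [zero_mul, mul_zero, sub_zero, add_zero] at this
      exact this.mono_left nhdsWithin_le_nhds
    rw [mul_zero, sub_zero]
    split_ifs with h1 h2
    · filter_upwards [hc.eventually (lt_mem_nhds h1)] with ε hε
      rw [abs_of_pos hε, abs_of_pos h1]
      ring
    · filter_upwards [hc.eventually (gt_mem_nhds h2)] with ε hε
      rw [abs_of_neg hε, abs_of_neg h2]
      ring
    · have h0 : S k - Q k * u = 0 := le_antisymm (not_lt.1 h1) (not_lt.1 h2)
      filter_upwards [self_mem_nhdsWithin] with ε hε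
      have e : S k - P k * (ε * x) - Q k * (u + ε * y) = -(ε * (P k * x + Q k * y)) := by
        linear_combination h0
      rw [e, abs_neg, abs_mul, abs_of_pos hε, h0, abs_zero]
      ring
  have hev' := (Filter.eventually_all_finset (range n)).2 hev
  obtain ⟨ε, hε, hpos⟩ := (hev'.and self_mem_nhdsWithin).exists
  refine ⟨ε, hpos, ?_⟩
  rw [linDevDir_eq]
  unfold linDev
  rw [sum_congr rfl hε, sum_add_distrib, ← mul_sum]
  ring

theorem linDevDir_smul {n : ℕ} {P Q S W : ℕ → ℝ} {a b u : ℝ} {t : ℝ} (ht : 0 ≤ t) (x y : ℝ) :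
    linDevDir n P Q S W a b u (t * x) (t * y) = t * linDevDir n P Q S W a b u x y := by
  rw [linDevDir_eq, linDevDir_eq, mul_add, mul_sum]
  congr 1
  · ring
  · refine sum_congr rfl fun k _ => ?_
    have e : |P k * (t * x) + Q k * (t * y)| = t * |P k * x + Q k * y| := by
      rw [show P k * (t * x) + Q k * (t * y) = t * (P k * x + Q k * y) by ring, abs_mul,
        abs_of_nonneg ht]
    rw [e]
    split_ifs <;> ring

/-- A function bounded below has a linear part dominated by its other terms. -/
theorem abs_le_of_linDev_bounded {n : ℕ} {P Q S W : ℕ → ℝ} {a b m : ℝ} (hW : ∀ k < n, 0 ≤ W k)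
    (h : ∀ y, m ≤ linDev n P Q S W a b 0 y) : |b| ≤ ∑ k ∈ range n, W k * |Q k| := by
  have key : ∀ y, m ≤ ∑ k ∈ range n, W k * |S k| + |y| * ∑ k ∈ range n, W k * |Q k| + b * y := by
    intro y
    refine (h y).trans ?_
    unfold linDev
    rw [mul_sum, ← sum_add_distrib, mul_zero, add_zero]
    refine add_le_add (sum_le_sum fun k hk => ?_) le_rfl
    have hk := hW k (by simpa using hk)
    rw [mul_zero, sub_zero]
    refine (mul_le_mul_of_nonneg_left (abs_sub (S k) (Q k * y)) hk).trans (le_of_eq ?_)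
    rw [abs_mul]
    ring
  by_contra! hc
  set A := ∑ k ∈ range n, W k * |S k|
  set B := ∑ k ∈ range n, W k * |Q k|
  have hpos : 0 < |b| - B := by linarith
  -- A step of length `t` against the sign of `b` changes the upper bound by `-t * (|b| - B)`,
  -- enough to fall below `m`.
  obtain ⟨t, ht, ht'⟩ : ∃ t : ℝ, 0 ≤ t ∧ A - m < t * (|b| - B) := by
    refine ⟨(|A - m| + 1) / (|b| - B), by positivity, ?_⟩
    rw [div_mul_cancel₀ _ hpos.ne']
    linarith [le_abs_self (A - m)]
  rcases abs_cases b with ⟨hb, hb'⟩ | ⟨hb, hb'⟩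
  · have := key (-t)
    rw [abs_neg, abs_of_nonneg ht] at this
    rw [hb] at ht'
    linarith
  · have := key t
    rw [abs_of_nonneg ht] at this
    rw [hb] at ht'
    linarith

section LineTest

variable {n : ℕ} {P Q S W : ℕ → ℝ} {a b u : ℝ}

theorem linDevDir_line_nonneg
    (hmin : ∀ y, linDev n P Q S W a b 0 u ≤ linDev n P Q S W a b 0 y) (y : ℝ) :
    0 ≤ linDevDir n P Q S W a b u 0 y := by
  obtain ⟨ε, hε, he⟩ := exists_linDev_le n P Q S W a b u 0 y
  rw [mul_zero] at he
  have := hmin (u + ε * y)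
  rw [he] at this
  nlinarith

/-- A short step along `(σ, τ)` gives a better point on the side of `σ`. The segment from there to a
better point on the other closed side would meet the line `x = 0`, where convexity would force a
value below the minimum on that line. -/
theorem lt_of_linDevDir_neg (hW : ∀ k < n, 0 ≤ W k)
    (hmin : ∀ y, linDev n P Q S W a b 0 u ≤ linDev n P Q S W a b 0 y) {σ τ : ℝ}
    (hneg : linDevDir n P Q S W a b u σ τ < 0) (hσ : 0 < σ * σ) :
    (∃ x y, linDev n P Q S W a b x y < linDev n P Q S W a b 0 u) ∧
    ∀ x y, linDev n P Q S W a b x y < linDev n P Q S W a b 0 u → 0 < σ * x := by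
  obtain ⟨ε, hε, he⟩ := exists_linDev_le n P Q S W a b u σ τ
  have hlt : linDev n P Q S W a b (ε * σ) (u + ε * τ) < linDev n P Q S W a b 0 u := by
    rw [he]; nlinarith
  refine ⟨⟨_, _, hlt⟩, fun x y hxy => ?_⟩
  by_contra! hc
  have hd : 0 < ε * (σ * σ) - σ * x := by nlinarith
  -- The parameter at which the segment from `(ε * σ, u + ε * τ)` to `(x, y)` has first coordinate
  -- zero.
  obtain ⟨t, ht⟩ : ∃ t, t = ε * (σ * σ) / (ε * (σ * σ) - σ * x) := ⟨_, rfl⟩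
  have ht0 : 0 ≤ t := by rw [ht]; positivity
  have ht1 : t ≤ 1 := by rw [ht, div_le_one hd]; linarith
  have hσ0 : σ ≠ 0 := by rintro rfl; simp at hσ
  have hx : (1 - t) * (ε * σ) + t * x = 0 := by
    have hte : t * (ε * (σ * σ) - σ * x) = ε * (σ * σ) := by rw [ht, div_mul_cancel₀ _ hd.ne']
    refine (mul_eq_zero.1 (?_ : σ * _ = 0)).resolve_left hσ0
    linear_combination -hte
  have h1 := linDev_convex (P := P) (Q := Q) (S := S) (a := a) (b := b) hW ht0 ht1 (ε * σ)
    (u + ε * τ) x y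
  rw [hx] at h1
  have h2 := hmin ((1 - t) * (u + ε * τ) + t * y)
  rcases ht0.eq_or_lt with h | h
  · rw [← h] at h1 h2
    linarith
  · nlinarith

/-- The directional derivative is positively homogeneous, so directions with first component `1`,
`0` and `-1` represent all. -/
theorem linDev_min_of_linDevDir_nonneg (hW : ∀ k < n, 0 ≤ W k)
    (hmin : ∀ y, linDev n P Q S W a b 0 u ≤ linDev n P Q S W a b 0 y)
    (h1 : ∀ y, 0 ≤ linDevDir n P Q S W a b u 1 y)
    (h2 : ∀ y, 0 ≤ linDevDir n P Q S W a b u (-1) y) (x y : ℝ) :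
    linDev n P Q S W a b 0 u ≤ linDev n P Q S W a b x y := by
  refine le_trans ?_ (linDev_ge hW u x y)
  suffices 0 ≤ linDevDir n P Q S W a b u x (y - u) by linarith
  rcases lt_trichotomy x 0 with hx | hx | hx
  · have := linDevDir_smul (n := n) (P := P) (Q := Q) (S := S) (W := W) (a := a) (b := b) (u := u)
      (t := -x) (by linarith) (-1) ((y - u) / (-x))
    rw [mul_div_cancel₀ _ (by linarith : -x ≠ 0)] at this
    rw [show x = -x * -1 by ring, this]
    exact mul_nonneg (by linarith) (h2 _)
  · rw [hx]
    exact linDevDir_line_nonneg hmin _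
  · have := linDevDir_smul (n := n) (P := P) (Q := Q) (S := S) (W := W) (a := a) (b := b) (u := u)
      (t := x) hx.le 1 ((y - u) / x)
    rw [mul_div_cancel₀ _ hx.ne', mul_one] at this
    rw [this]
    exact mul_nonneg hx.le (h1 _)

end LineTest

/-! ### Deciding the side of a line -/

/-- Minimise `∑ Z k * |N k - Q k * u| + κ * u`, where `Q`, `Z`, `N` are the real arrays `21`, `23`,
`24`, their length is the natural variable `20` and `κ` is the real variable `1`. -/
def Cmd.lineMin : Cmd :=
  .forUp 10 20
    (.writeReal 10 (.var 10) (.div (.read 24 (.var 10)) (.read 21 (.var 10))) ;;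
    .cond (.realLt (.read 21 (.var 10)) (.const 0))
      (.writeReal 11 (.var 10)
        (.mul (.read 23 (.var 10)) (.sub (.const 0) (.read 21 (.var 10)))))
      (.writeReal 11 (.var 10) (.mul (.read 23 (.var 10)) (.read 21 (.var 10))))) ;;
  (.setNat 0 (.const 0) ;; .setNat 1 (.var 20)) ;;
  .call 0

/-- Check whether there is a direction of descent whose first component is `σ`, the real
variable `18`; if so, set the real variable `14` to `σ`. -/
def Cmd.descentCheck : Cmd :=
  .forUp 10 20
    (.writeReal 24 (.var 10) (.sub (.const 0) (.mul (.var 18) (.read 20 (.var 10))))) ;;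
  .setReal 1 (.var 17) ;;
  .lineMin ;;
  .setReal 19 (.add (.mul (.var 16) (.var 18)) (.mul (.var 17) (.var 0))) ;;
  .forUp 10 20
    (.cond (.realLt (.const 0) (.add (.mul (.read 20 (.var 10)) (.var 18))
        (.mul (.read 21 (.var 10)) (.var 0))))
      (.setReal 19 (.add (.var 19) (.mul (.read 23 (.var 10))
        (.add (.mul (.read 20 (.var 10)) (.var 18)) (.mul (.read 21 (.var 10)) (.var 0))))))
      (.setReal 19 (.sub (.var 19) (.mul (.read 23 (.var 10))
        (.add (.mul (.read 20 (.var 10)) (.var 18)) (.mul (.read 21 (.var 10)) (.var 0))))))) ;;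
  .cond (.realLt (.var 19) (.const 0)) (.setReal 14 (.var 18)) .skip

/-- Compute the linear part and the weights of the directional derivative. -/
def Cmd.gradient : Cmd :=
  (.setReal 16 (.var 12) ;; .setReal 17 (.var 13)) ;;
  .forUp 10 20
    (.cond (.realLt (.const 0)
        (.sub (.read 22 (.var 10)) (.mul (.read 21 (.var 10)) (.var 15))))
      (.setReal 16 (.sub (.var 16) (.mul (.read 25 (.var 10)) (.read 20 (.var 10)))) ;;
      .setReal 17 (.sub (.var 17) (.mul (.read 25 (.var 10)) (.read 21 (.var 10)))) ;;
      .writeReal 23 (.var 10) (.const 0))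
      (.cond (.realLt (.sub (.read 22 (.var 10)) (.mul (.read 21 (.var 10)) (.var 15)))
          (.const 0))
        (.setReal 16 (.add (.var 16) (.mul (.read 25 (.var 10)) (.read 20 (.var 10)))) ;;
        .setReal 17 (.add (.var 17) (.mul (.read 25 (.var 10)) (.read 21 (.var 10)))) ;;
        .writeReal 23 (.var 10) (.const 0))
        (.writeReal 23 (.var 10) (.read 25 (.var 10)))))

/-- Decide on which side of the line `x = 0` the minimisers of `linDev` lie, where the four
arrays are the real arrays `20`, `21`, `22`, `25` and the coefficients of the linear part are the
real variables `12` and `13`. The result is stored in the real variable `14`; the real variable `15`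
is the minimiser on the line. -/
def Cmd.lineTest : Cmd :=
  .forUp 10 20
    (.writeReal 24 (.var 10) (.read 22 (.var 10)) ;;
    .writeReal 23 (.var 10) (.read 25 (.var 10))) ;;
  .setReal 1 (.var 13) ;;
  .lineMin ;;
  .setReal 15 (.var 0) ;;
  .gradient ;;
  (.setReal 14 (.const 0) ;; .setReal 18 (.const 1)) ;;
  .descentCheck ;;
  .setReal 18 (.const (-1)) ;;
  .descentCheck

def lineMinFootprint : Footprint :=
  ⟨List.range 11, List.range 12, [0], [10, 11, 12], [0]⟩

def lineTestFootprint : Footprint :=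
  ⟨List.range 11, List.range 20, [0], [10, 11, 12, 23, 24], [0]⟩

theorem calls_of_procs {procs : List Cmd} (hp : procs[0]? = some .quantile) {A : Footprint}
    (hA : A.calls = [0]) (hw : Cmd.quantile.within A) :
    ∀ p ∈ A.calls, ∀ c, procs[p]? = some c → c.within A := by
  intro p hp' c hc
  obtain rfl : p = 0 := by simpa [hA] using hp'
  obtain rfl : Cmd.quantile = c := by simpa [hp] using hc
  exact hw

/-- For `Q ≠ 0` the term `Z * |N - Q * u|` is `Z * |Q| * |N / Q - u|`, so a quantile with weights `Z
* |Q|` is a minimiser. For `Q = 0` the term is constant; its cell has weight zero, and the value `N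
/ 0 = 0` stored there is harmless. -/
theorem Cmd.lineMin_runs {procs : List Cmd} (hp : procs[0]? = some .quantile) (n : ℕ) (s : State)
    (hn : s.natVar 20 = n) :
    Runs procs .lineMin s (quantileTime n + (100 * n + 200)) fun s' =>
      Frame lineMinFootprint s s' ∧
      ∀ N Q Z : ℕ → ℝ, (∀ k < n, s.realArr 24 k = N k) → (∀ k < n, s.realArr 21 k = Q k) →
        (∀ k < n, s.realArr 23 k = Z k) → (∀ k < n, 0 ≤ Z k) →
        |s.realVar 1| ≤ ∑ k ∈ range n, Z k * |Q k| → ∀ u,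
        ∑ k ∈ range n, Z k * |N k - Q k * s'.realVar 0| + s.realVar 1 * s'.realVar 0 ≤
          ∑ k ∈ range n, Z k * |N k - Q k * u| + s.realVar 1 * u := by
  refine (Runs.frame (A := lineMinFootprint) ?_ (calls_of_procs hp rfl rfl) rfl)
  refine Runs.seq (Runs.forUp ⟨[], [], [], [10, 11], []⟩ 100 n (fun j s' =>
    (∀ k < j, s'.realArr 10 k = s.realArr 24 k / s.realArr 21 k) ∧
    (∀ k < j, s'.realArr 11 k = s.realArr 23 k * |s.realArr 21 k|))
    rfl rfl (by simp) (by simp) rfl (by decide) hn (by simp) ?_)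
    (K₂ := quantileTime n + 50) ?_ (by omega)
  · rintro j hj s' hF hi ⟨h1, h2⟩
    have e1 := hF.realArr 24 (by simp [Footprint.addNat])
    have e2 := hF.realArr 21 (by simp [Footprint.addNat])
    have e3 := hF.realArr 23 (by simp [Footprint.addNat])
    by_cases h : s.realArr 21 j < 0
    · simp [hi, e1, e2, e3, h]
      refine ⟨fun k hk => ?_, fun k hk => ?_⟩
      · by_cases hkj : k = j
        · simp [hkj]
        · simp [hkj, h1 k (by omega)]
      · by_cases hkj : k = j
        · simp [hkj, abs_of_neg h]
        · simp [hkj, h2 k (by omega)]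
    · simp [hi, e1, e2, e3, h]
      refine ⟨fun k hk => ?_, fun k hk => ?_⟩
      · by_cases hkj : k = j
        · simp [hkj]
        · simp [hkj, h1 k (by omega)]
      · by_cases hkj : k = j
        · simp [hkj, abs_of_nonneg (not_lt.1 h)]
        · simp [hkj, h2 k (by omega)]
  · rintro s₁ ⟨hF, h1, h2⟩
    refine Runs.seq_simple rfl (K₂ := quantileTime n) ?_ (by simp [Cmd.bound, NExp.cost]; omega)
    have e20 : s₁.natVar 20 = n := by rw [hF.nat 20 (by simp [Footprint.addNat]), hn]
    refine (Cmd.quantile_spec hp n _ (by simpa using e20)).mono le_rfl ?_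
    rintro s₂ ⟨-, -, hQ⟩ N Q Z hN hQQ hZ hpos hκ u
    have eκ : s₁.realVar 1 = s.realVar 1 := hF.real 1 (by simp [Footprint.addNat])
    obtain ⟨κ, hκ'⟩ : ∃ κ, s.realVar 1 = κ := ⟨_, rfl⟩
    rw [hκ'] at eκ hκ ⊢
    obtain ⟨hκ1, hκ2⟩ := abs_le.1 hκ
    have hM : ∀ k < n, 0 ≤ Z k * |Q k| := fun k hk => mul_nonneg (hpos k hk) (abs_nonneg _)
    have hq := hQ (fun k => N k / Q k) (fun k => Z k * |Q k|)
      (fun k hk => by simp [h1 k hk, hN k hk, hQQ k hk])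
      (fun k hk => by simp [h2 k hk, hZ k hk, hQQ k hk]) hM
      (by simpa [eκ] using hκ1) (by simpa [eκ] using hκ2)
    have hle := hq.le hM u
    simp only [Cmd.run, eκ] at hle
    have e : ∀ w, ∑ k ∈ range n, Z k * |N k - Q k * w| =
        ∑ k ∈ range n, Z k * |Q k| * |N k / Q k - w| +
        ∑ k ∈ range n, if Q k = 0 then Z k * |N k| else 0 := fun w =>
      sum_eq_add_of_forall fun k => by
        by_cases hk : Q k = 0
        · simp [hk]
        · rw [if_neg hk, mul_assoc, ← abs_mul, mul_sub, mul_div_cancel₀ _ hk, add_zero]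
    rw [e, e]
    linarith

def descentCheckFootprint : Footprint :=
  ⟨List.range 11, [14, 19] ++ List.range 12, [0], [10, 11, 12, 24], [0]⟩

/-- With the first component fixed to `σ` the derivative depends on `τ` alone, and the sign of its
minimum decides. The condition `hb₀` guarantees that this minimum is attained. -/
theorem Cmd.descentCheck_runs {procs : List Cmd} (hp : procs[0]? = some .quantile) (n : ℕ)
    (s : State) (P Q Z : ℕ → ℝ) (a₀ b₀ σ : ℝ) (hn : s.natVar 20 = n)
    (hP : ∀ k < n, s.realArr 20 k = P k) (hQ : ∀ k < n, s.realArr 21 k = Q k)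
    (hZ : ∀ k < n, s.realArr 23 k = Z k) (ha : s.realVar 16 = a₀) (hb : s.realVar 17 = b₀)
    (hσ : s.realVar 18 = σ) (hpos : ∀ k < n, 0 ≤ Z k) (hb₀ : |b₀| ≤ ∑ k ∈ range n, Z k * |Q k|) :
    Runs procs .descentCheck s (quantileTime n + (400 * n + 900)) fun s' =>
      Frame descentCheckFootprint s s' ∧
      (((∃ τ, linDev n P Q (fun _ => 0) Z a₀ b₀ σ τ < 0) ∧ s'.realVar 14 = σ) ∨
      ((∀ τ, 0 ≤ linDev n P Q (fun _ => 0) Z a₀ b₀ σ τ) ∧ s'.realVar 14 = s.realVar 14)) := by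
  refine (Runs.frame (A := descentCheckFootprint) ?_ (calls_of_procs hp rfl rfl) rfl)
  refine Runs.seq (Runs.forUp ⟨[], [], [], [24], []⟩ 100 n (fun j s' =>
    (∀ k < j, s'.realArr 24 k = -(σ * P k)))
    rfl rfl (by simp) (by simp) rfl (by decide) hn (by simp) ?_)
    (K₂ := quantileTime n + (300 * n + 700)) ?_ (by omega)
  · rintro j hj s' hF hi h1
    have e1 := hF.realArr 20 (by simp [Footprint.addNat])
    have e2 := hF.real 18 (by simp [Footprint.addNat])
    simp only [Cmd.run, NExp.eval, RExp.eval, hi, e1, e2, hσ, hP j hj, Function.update_self]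
    intro k hk
    by_cases hkj : k = j
    · simp [hkj]
    · simp [hkj, h1 k (by omega)]
  rintro s₁ ⟨hF1, h24⟩
  refine Runs.seq_simple rfl (K₂ := quantileTime n + (300 * n + 650)) ?_
    (by simp [Cmd.bound, RExp.cost]; omega)
  obtain ⟨t, ht⟩ : ∃ t, (Cmd.setReal 1 (.var 17)).run s₁ = t := ⟨_, rfl⟩
  have t1 : t.realVar 1 = b₀ := by
    rw [← ht]; simp [hF1.real 17 (by simp [Footprint.addNat]), hb]
  have t14 : t.realVar 14 = s.realVar 14 := by
    rw [← ht]; simp [hF1.real 14 (by simp [Footprint.addNat])]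
  have t16 : t.realVar 16 = a₀ := by
    rw [← ht]; simp [hF1.real 16 (by simp [Footprint.addNat]), ha]
  have t17 : t.realVar 17 = b₀ := by
    rw [← ht]; simp [hF1.real 17 (by simp [Footprint.addNat]), hb]
  have t18 : t.realVar 18 = σ := by
    rw [← ht]; simp [hF1.real 18 (by simp [Footprint.addNat]), hσ]
  have t20 : t.natVar 20 = n := by
    rw [← ht]; simp [hF1.nat 20 (by simp [Footprint.addNat]), hn]
  have tP : ∀ k < n, t.realArr 20 k = P k := fun k hk => by
    rw [← ht]; simp [hF1.realArr 20 (by simp [Footprint.addNat]), hP k hk]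
  have tQ : ∀ k < n, t.realArr 21 k = Q k := fun k hk => by
    rw [← ht]; simp [hF1.realArr 21 (by simp [Footprint.addNat]), hQ k hk]
  have tZ : ∀ k < n, t.realArr 23 k = Z k := fun k hk => by
    rw [← ht]; simp [hF1.realArr 23 (by simp [Footprint.addNat]), hZ k hk]
  have tN : ∀ k < n, t.realArr 24 k = -(σ * P k) := fun k hk => by
    rw [← ht]; simp [h24 k hk]
  rw [ht]
  clear ht hF1 h24
  refine Runs.seq (Cmd.lineMin_runs hp n t t20) (K₂ := 200 * n + 440) ?_ (by omega)
  rintro s₂ ⟨hF2, hmin⟩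
  obtain ⟨τ, hτ⟩ : ∃ τ, s₂.realVar 0 = τ := ⟨_, rfl⟩
  replace hmin := hmin (fun k => -(σ * P k)) Q Z tN tQ tZ hpos (by rw [t1]; exact hb₀)
  rw [t1, hτ] at hmin
  have hD : ∀ w, linDev n P Q (fun _ => 0) Z a₀ b₀ σ τ ≤ linDev n P Q (fun _ => 0) Z a₀ b₀ σ w := by
    intro w
    have e : ∀ w, linDev n P Q (fun _ => 0) Z a₀ b₀ σ w =
        ∑ k ∈ range n, Z k * |-(σ * P k) - Q k * w| + b₀ * w + a₀ * σ := fun w => by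
      unfold linDev
      rw [add_right_comm]
      congr 2
      refine sum_congr rfl fun k _ => ?_
      congr 2
      ring
    rw [e, e]
    have := hmin w
    linarith
  have r16 : s₂.realVar 16 = a₀ := by rw [hF2.real 16 (by decide), t16]
  have r17 : s₂.realVar 17 = b₀ := by rw [hF2.real 17 (by decide), t17]
  have r18 : s₂.realVar 18 = σ := by rw [hF2.real 18 (by decide), t18]
  have r14 : s₂.realVar 14 = s.realVar 14 := by rw [hF2.real 14 (by decide), t14]
  have r20 : s₂.natVar 20 = n := by rw [hF2.nat 20 (by decide), t20]
  have rP : ∀ k < n, s₂.realArr 20 k = P k := by rw [hF2.realArr 20 (by decide)]; exact tP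
  have rQ : ∀ k < n, s₂.realArr 21 k = Q k := by rw [hF2.realArr 21 (by decide)]; exact tQ
  have rZ : ∀ k < n, s₂.realArr 23 k = Z k := by rw [hF2.realArr 23 (by decide)]; exact tZ
  refine Runs.seq_simple rfl (K₂ := 200 * n + 400) ?_ (by simp [Cmd.bound, RExp.cost]; omega)
  refine Runs.seq (Runs.forUp ⟨[], [19], [], [], []⟩ 100 n (fun j s' =>
    s'.realVar 19 = a₀ * σ + b₀ * τ + ∑ k ∈ range j, Z k * |P k * σ + Q k * τ|)
    rfl rfl (by simp) (by simp) rfl (by decide) (by simpa using r20) (by simp [r16, r17, r18, hτ])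
    ?_)
    (K₂ := 50) ?_ (by omega)
  · rintro j hj s' hF hi h1
    have e1 : s'.realArr 20 j = P j := by
      rw [hF.realArr 20 (by simp [Footprint.addNat])]; simpa using rP j hj
    have e2 : s'.realArr 21 j = Q j := by
      rw [hF.realArr 21 (by simp [Footprint.addNat])]; simpa using rQ j hj
    have e3 : s'.realArr 23 j = Z j := by
      rw [hF.realArr 23 (by simp [Footprint.addNat])]; simpa using rZ j hj
    have e4 : s'.realVar 18 = σ := by
      rw [hF.real 18 (by simp [Footprint.addNat])]; simpa using r18
    have e5 : s'.realVar 0 = τ := by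
      rw [hF.real 0 (by simp [Footprint.addNat])]; simpa using hτ
    by_cases h : 0 < P j * σ + Q j * τ
    · simp [hi, e1, e2, e3, e4, e5, h, h1, sum_range_succ, abs_of_pos h]
      ring
    · simp [hi, e1, e2, e3, e4, e5, h, h1, sum_range_succ, abs_of_nonpos (not_lt.1 h)]
      ring
  rintro s₃ ⟨hF3, h19⟩
  refine Runs.of_simple rfl (by decide) ?_
  have e14 : s₃.realVar 14 = s.realVar 14 := by
    rw [hF3.real 14 (by simp [Footprint.addNat])]; simpa using r14
  have e18 : s₃.realVar 18 = σ := by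
    rw [hF3.real 18 (by simp [Footprint.addNat])]; simpa using r18
  have eD : s₃.realVar 19 = linDev n P Q (fun _ => 0) Z a₀ b₀ σ τ := by
    rw [h19]
    unfold linDev
    rw [add_assoc, add_assoc, add_comm, add_comm (b₀ * τ), add_left_comm]
    have : ∀ k, |0 - P k * σ - Q k * τ| = |P k * σ + Q k * τ| := fun k => by
      rw [← abs_neg]; congr 1; ring
    simp only [this]
    ring
  by_cases h : linDev n P Q (fun _ => 0) Z a₀ b₀ σ τ < 0
  · left
    exact ⟨⟨τ, h⟩, by simp [eD, h, e18]⟩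
  · right
    exact ⟨fun w => (not_lt.1 h).trans (hD w), by simp [eD, h, e14]⟩

theorem Cmd.gradient_runs {procs : List Cmd} (n : ℕ)
    (s : State) (P Q S W : ℕ → ℝ) (a b u : ℝ) (hn : s.natVar 20 = n)
    (hP : ∀ k < n, s.realArr 20 k = P k) (hQ : ∀ k < n, s.realArr 21 k = Q k)
    (hS : ∀ k < n, s.realArr 22 k = S k) (hW : ∀ k < n, s.realArr 25 k = W k)
    (ha : s.realVar 12 = a) (hb : s.realVar 13 = b) (hu : s.realVar 15 = u) :
    Runs procs .gradient s (200 * n + 300) fun s' =>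
      Frame ⟨[10], [16, 17], [], [23], []⟩ s s' ∧
      s'.realVar 16 = slopeCoeff n W (fun k => S k - Q k * u) P a ∧
      s'.realVar 17 = slopeCoeff n W (fun k => S k - Q k * u) Q b ∧
      ∀ k < n, s'.realArr 23 k = zeroWeight W (fun k => S k - Q k * u) k := by
  refine (Runs.frame (A := ⟨[10], [16, 17], [], [23], []⟩) ?_ (by simp) rfl)
  refine Runs.seq_simple rfl (K₂ := 200 * n + 203) ?_ (by simp [Cmd.bound, RExp.cost]; omega)
  refine (Runs.forUp ⟨[], [16, 17], [], [23], []⟩ 200 n (fun j s' =>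
    s'.realVar 16 = slopeCoeff j W (fun k => S k - Q k * u) P a ∧
      s'.realVar 17 = slopeCoeff j W (fun k => S k - Q k * u) Q b ∧
      ∀ k < j, s'.realArr 23 k = zeroWeight W (fun k => S k - Q k * u) k)
    rfl rfl (by simp) (by simp) rfl (by decide) (by simpa using hn)
    (by simp [slopeCoeff, ha, hb]) ?_).mono (by omega) (fun s' h => h.2)
  rintro j hj s' hF hi ⟨h1, h2, h3⟩
  have e1 : s'.realArr 20 j = P j := by
    rw [hF.realArr 20 (by simp [Footprint.addNat])]; simpa using hP j hj
  have e2 : s'.realArr 21 j = Q j := by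
    rw [hF.realArr 21 (by simp [Footprint.addNat])]; simpa using hQ j hj
  have e3 : s'.realArr 22 j = S j := by
    rw [hF.realArr 22 (by simp [Footprint.addNat])]; simpa using hS j hj
  have e4 : s'.realArr 25 j = W j := by
    rw [hF.realArr 25 (by simp [Footprint.addNat])]; simpa using hW j hj
  have e5 : s'.realVar 15 = u := by
    rw [hF.real 15 (by simp [Footprint.addNat])]; simpa using hu
  unfold slopeCoeff at h1 h2 ⊢
  have hz : ∀ z, z = zeroWeight W (fun k => S k - Q k * u) j → ∀ k < j + 1,
      Function.update (s'.realArr 23) j z k = zeroWeight W (fun k => S k - Q k * u) k := by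
    rintro z rfl k hk
    by_cases hkj : k = j
    · simp [hkj]
    · simp [hkj, h3 k (by omega)]
  rw [sum_range_succ, sum_range_succ, ← add_assoc, ← add_assoc, ← h1, ← h2]
  by_cases hr : 0 < S j - Q j * u
  · have := hz 0 (by simp [zeroWeight, hr])
    simp only [Cmd.run, NExp.eval, RExp.eval, BExp.Holds, hi, e1, e2, e3, e4, e5, Rat.cast_zero, hr,
      if_true]
    refine ⟨?_, ?_, ?_⟩
    · simp; ring
    · simp; ring
    · simpa [hi] using this
  · by_cases hl : S j - Q j * u < 0
    · have := hz 0 (by simp [zeroWeight, hr, hl])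
      simp only [Cmd.run, NExp.eval, RExp.eval, BExp.Holds, hi, e1, e2, e3, e4, e5, Rat.cast_zero,
        hr, hl, if_true, if_false]
      refine ⟨?_, ?_, ?_⟩
      · simp
      · simp
      · simpa [hi] using this
    · have := hz (W j) (by simp [zeroWeight, hr, hl])
      simp only [Cmd.run, NExp.eval, RExp.eval, BExp.Holds, hi, e1, e2, e3, e4, e5, Rat.cast_zero,
        hr, hl, if_false]
      refine ⟨?_, ?_, ?_⟩
      · simp
      · simp
      · simpa using this

/-- The line `x = 0` contains the minimiser `(0, u)` of `linDev`, or all points with smaller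
values than on the line lie on the side indicated by `σ`. -/
def IsLineTest (n : ℕ) (P Q S W : ℕ → ℝ) (a b σ u : ℝ) : Prop :=
  (σ = 0 ∧ ∀ x y, linDev n P Q S W a b 0 u ≤ linDev n P Q S W a b x y) ∨
  ((σ = 1 ∨ σ = -1) ∧ (∃ x y, linDev n P Q S W a b x y < linDev n P Q S W a b 0 u) ∧
    ∀ x y, linDev n P Q S W a b x y < linDev n P Q S W a b 0 u → 0 < σ * x)

theorem zeroWeight_nonneg {n : ℕ} {W : ℕ → ℝ} (hW : ∀ k < n, 0 ≤ W k) (ρ : ℕ → ℝ) :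
    ∀ k < n, 0 ≤ zeroWeight W ρ k := by
  intro k hk
  unfold zeroWeight
  split_ifs
  · rfl
  · rfl
  · exact hW k hk

/-- The lower bound `m` is not known to the program; it only ensures that the minimum on the line
exists. -/
theorem Cmd.lineTest_runs {procs : List Cmd} (hp : procs[0]? = some .quantile) (n : ℕ)
    (s : State) (P Q S W : ℕ → ℝ) (a b m : ℝ) (hn : s.natVar 20 = n)
    (hP : ∀ k < n, s.realArr 20 k = P k) (hQ : ∀ k < n, s.realArr 21 k = Q k)
    (hS : ∀ k < n, s.realArr 22 k = S k) (hW : ∀ k < n, s.realArr 25 k = W k)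
    (ha : s.realVar 12 = a) (hb : s.realVar 13 = b) (hpos : ∀ k < n, 0 ≤ W k)
    (hm : ∀ x y, m ≤ linDev n P Q S W a b x y) :
    Runs procs .lineTest s (3 * quantileTime n + (2000 * n + 5000)) fun s' =>
      Frame lineTestFootprint s s' ∧
      IsLineTest n P Q S W a b (s'.realVar 14) (s'.realVar 15) := by
  refine (Runs.frame (A := lineTestFootprint) ?_ (calls_of_procs hp rfl rfl) rfl)
  refine Runs.seq (Runs.forUp ⟨[], [], [], [23, 24], []⟩ 100 n (fun j s' =>
    (∀ k < j, s'.realArr 24 k = S k) ∧ (∀ k < j, s'.realArr 23 k = W k))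
    rfl rfl (by simp) (by simp) rfl (by decide) hn (by simp) ?_)
    (K₂ := 3 * quantileTime n + (1900 * n + 4800)) ?_ (by omega)
  · rintro j hj s' hF hi ⟨h1, h2⟩
    have e1 := hF.realArr 22 (by simp [Footprint.addNat])
    have e2 := hF.realArr 25 (by simp [Footprint.addNat])
    simp [hi, e1, e2, hS j hj, hW j hj]
    refine ⟨fun k hk => ?_, fun k hk => ?_⟩
    · by_cases hkj : k = j
      · simp [hkj]
      · simp [hkj, h1 k (by omega)]
    · by_cases hkj : k = j
      · simp [hkj]
      · simp [hkj, h2 k (by omega)]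
  rintro s₁ ⟨hF1, h24, h23⟩
  refine Runs.seq_simple rfl (K₂ := 3 * quantileTime n + (1900 * n + 4700)) ?_
    (by simp [Cmd.bound, RExp.cost]; omega)
  have e1n : s₁.natVar 20 = n := by rw [hF1.nat 20 (by simp [Footprint.addNat]), hn]
  refine Runs.seq (Cmd.lineMin_runs hp n _ (by simpa using e1n))
    (K₂ := 2 * quantileTime n + (1800 * n + 4400)) ?_ (by omega)
  rintro s₂ ⟨hF2, hmin⟩
  have eb : s₁.realVar 13 = b := by rw [hF1.real 13 (by simp [Footprint.addNat]), hb]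
  replace hmin := hmin S Q W (by simpa using h24)
    (fun k hk => by simpa [hF1.realArr 21 (by simp [Footprint.addNat])] using hQ k hk)
    (by simpa using h23) hpos
    (by simpa [eb] using abs_le_of_linDev_bounded hpos (fun y => hm 0 y))
  obtain ⟨u, hu⟩ : ∃ u, s₂.realVar 0 = u := ⟨_, rfl⟩
  simp only [Cmd.run, RExp.eval, Function.update_self, hu, eb] at hmin
  replace hmin : ∀ y, linDev n P Q S W a b 0 u ≤ linDev n P Q S W a b 0 y := by
    intro y
    unfold linDev
    simpa using hmin y
  refine Runs.seq_simple rfl (K₂ := 2 * quantileTime n + (1800 * n + 4300)) ?_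
    (by simp [Cmd.bound, RExp.cost]; omega)
  refine Runs.seq (Cmd.gradient_runs n _ P Q S W a b u ?_ ?_ ?_ ?_ ?_ ?_ ?_ ?_)
    (K₂ := 2 * quantileTime n + (1600 * n + 3900)) ?_ (by omega)
  · simp [hF2.nat 20 (by decide), e1n]
  · simpa [hF2.realArr 20 (by decide), hF1.realArr 20 (by simp [Footprint.addNat])] using hP
  · simpa [hF2.realArr 21 (by decide), hF1.realArr 21 (by simp [Footprint.addNat])] using hQ
  · simpa [hF2.realArr 22 (by decide), hF1.realArr 22 (by simp [Footprint.addNat])] using hS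
  · simpa [hF2.realArr 25 (by decide), hF1.realArr 25 (by simp [Footprint.addNat])] using hW
  · simpa [hF2.real 12 (by decide), hF1.real 12 (by simp [Footprint.addNat])] using ha
  · simpa [hF2.real 13 (by decide), hF1.real 13 (by simp [Footprint.addNat])] using hb
  · simp [hu]
  rintro s₃ ⟨hF3, g16, g17, g23⟩
  obtain ⟨a₀, ha₀⟩ : ∃ z, slopeCoeff n W (fun k => S k - Q k * u) P a = z := ⟨_, rfl⟩
  obtain ⟨b₀, hb₀⟩ : ∃ z, slopeCoeff n W (fun k => S k - Q k * u) Q b = z := ⟨_, rfl⟩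
  obtain ⟨Z, hZ⟩ : ∃ z, zeroWeight W (fun k => S k - Q k * u) = z := ⟨_, rfl⟩
  have hdir : ∀ x y, linDevDir n P Q S W a b u x y = linDev n P Q (fun _ => 0) Z a₀ b₀ x y := by
    intro x y
    rw [← ha₀, ← hb₀, ← hZ]
    rfl
  rw [ha₀] at g16
  rw [hb₀] at g17
  rw [hZ] at g23
  have hZpos : ∀ k < n, 0 ≤ Z k := hZ ▸ zeroWeight_nonneg hpos _
  -- The derivative is nonnegative along the line itself. The resulting bound on `b₀` does not
  -- involve the first component and hence serves both descent checks.
  have hb₀' : |b₀| ≤ ∑ k ∈ range n, Z k * |Q k| :=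
    abs_le_of_linDev_bounded (m := 0) (P := P) (S := fun _ => 0) (a := a₀) hZpos fun y => by
      rw [← hdir]; exact linDevDir_line_nonneg hmin y
  have g20 : s₃.natVar 20 = n := by
    rw [hF3.nat 20 (by simp)]; simp [hF2.nat 20 (by decide), e1n]
  have gP : ∀ k < n, s₃.realArr 20 k = P k := by
    rw [hF3.realArr 20 (by simp)]
    simpa [hF2.realArr 20 (by decide), hF1.realArr 20 (by simp [Footprint.addNat])] using hP
  have gQ : ∀ k < n, s₃.realArr 21 k = Q k := by
    rw [hF3.realArr 21 (by simp)]
    simpa [hF2.realArr 21 (by decide), hF1.realArr 21 (by simp [Footprint.addNat])] using hQ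
  have g15 : s₃.realVar 15 = u := by
    rw [hF3.real 15 (by simp)]; simp [hu]
  clear hF1 hF2 hF3 h24 h23 e1n eb
  refine Runs.seq_simple rfl (K₂ := 2 * quantileTime n + (1600 * n + 3700)) ?_
    (by simp [Cmd.bound, RExp.cost]; omega)
  refine Runs.seq (Cmd.descentCheck_runs hp n _ P Q Z a₀ b₀ 1 (by simpa using g20)
    (by simpa using gP) (by simpa using gQ) (by simpa using g23) (by simpa using g16)
    (by simpa using g17) (by simp) hZpos hb₀')
    (K₂ := quantileTime n + (1000 * n + 2000)) ?_ (by omega)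
  rintro s₄ ⟨hF4, h4⟩
  refine Runs.seq_simple rfl (K₂ := quantileTime n + (1000 * n + 1900)) ?_
    (by simp [Cmd.bound, RExp.cost]; omega)
  refine (Cmd.descentCheck_runs hp n _ P Q Z a₀ b₀ (-1) ?_ ?_ ?_ ?_ ?_ ?_ ?_ hZpos hb₀').mono
    (by omega) ?_
  · simpa [hF4.nat 20 (by decide)] using g20
  · simpa [hF4.realArr 20 (by decide)] using gP
  · simpa [hF4.realArr 21 (by decide)] using gQ
  · simpa [hF4.realArr 23 (by decide)] using g23
  · simpa [hF4.real 16 (by decide)] using g16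
  · simpa [hF4.real 17 (by decide)] using g17
  · simp
  rintro s₅ ⟨hF5, h5⟩
  have f15 : s₅.realVar 15 = u := by
    rw [hF5.real 15 (by decide)]
    simpa [hF4.real 15 (by decide)] using g15
  rw [f15]
  simp at h4 h5
  simp only [← hdir] at h4 h5
  rcases h4 with ⟨⟨τ, hτ⟩, h4⟩ | ⟨h4', h4⟩
  · right
    obtain ⟨⟨x, y, hxy⟩, hs⟩ := lt_of_linDevDir_neg hpos hmin hτ (by norm_num)
    rcases h5 with ⟨⟨τ', hτ'⟩, h5⟩ | ⟨h5', h5⟩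
    -- Descent to both sides would put the same better point on both sides; hence the second check
    -- cannot overwrite a positive result of the first.
    · have h1 := hs x y hxy
      have h2 := (lt_of_linDevDir_neg hpos hmin hτ' (by norm_num)).2 x y hxy
      linarith
    · rw [h5, h4]
      exact ⟨Or.inl rfl, ⟨x, y, hxy⟩, hs⟩
  · rcases h5 with ⟨⟨τ', hτ'⟩, h5⟩ | ⟨h5', h5⟩
    · right
      rw [h5]
      exact ⟨Or.inr rfl, lt_of_linDevDir_neg hpos hmin hτ' (by norm_num)⟩
    · left
      rw [h5, h4]
      exact ⟨rfl, linDev_min_of_linDevDir_nonneg hpos hmin h4' h5'⟩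

/-! ### Agreement below a level, and pairs of lines -/

/-- Convexity of a function of two real variables. -/
def SegConvex (G : ℝ → ℝ → ℝ) : Prop :=
  ∀ t : ℝ, 0 ≤ t → t ≤ 1 → ∀ x y x' y' : ℝ,
    G ((1 - t) * x + t * x') ((1 - t) * y + t * y') ≤ (1 - t) * G x y + t * G x' y'

theorem SegConvex.add {F G : ℝ → ℝ → ℝ} (hF : SegConvex F) (hG : SegConvex G) :
    SegConvex fun x y => F x y + G x y := by
  intro t h0 h1 x y x' y'
  have := hF t h0 h1 x y x' y'
  have := hG t h0 h1 x y x' y'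
  simp only
  linarith

theorem SegConvex.add_const {F : ℝ → ℝ → ℝ} (hF : SegConvex F) (γ : ℝ) :
    SegConvex fun x y => F x y + γ :=
  hF.add fun t _ _ _ _ _ _ => by linarith

theorem segConvex_linDev {n : ℕ} {P Q S W : ℕ → ℝ} {a b : ℝ} (hW : ∀ k < n, 0 ≤ W k) :
    SegConvex (linDev n P Q S W a b) :=
  fun _ h0 h1 _ _ _ _ => linDev_convex hW h0 h1 _ _ _ _

/-- The weighted deviation from one reference price. -/
def dev (l r w x y : ℝ) : ℝ := w * |r - l * x - y|

theorem segConvex_sum_dev (s : Finset ℕ) {L R W : ℕ → ℝ} (hW : ∀ k ∈ s, 0 ≤ W k) :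
    SegConvex fun x y => ∑ k ∈ s, dev (L k) (R k) (W k) x y := by
  intro t h0 h1 x y x' y'
  simp only [mul_sum, ← sum_add_distrib]
  refine sum_le_sum fun k hk => ?_
  have := linDev_convex (n := 1) (P := fun _ => L k) (Q := fun _ => 1) (S := fun _ => R k)
    (W := fun _ => W k) (a := 0) (b := 0) (fun _ _ => hW k hk) h0 h1 x y x' y'
  simpa [linDev, dev] using this

/-- Two functions agree wherever one of them is smaller than `c`. -/
def SameBelow (c : ℝ) (F G : ℝ → ℝ → ℝ) : Prop :=
  ∀ x y, F x y < c ∨ G x y < c → F x y = G x y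

theorem SameBelow.trans {c : ℝ} {F G H : ℝ → ℝ → ℝ} (h : SameBelow c F G)
    (h' : SameBelow c G H) : SameBelow c F H := by
  rintro x y (hx | hx)
  · have := h x y (.inl hx)
    rw [this, h' x y (.inl (this ▸ hx))]
  · have := h' x y (.inr hx)
    rw [← this, h x y (.inr (this ▸ hx))]

theorem SameBelow.of_eq {c : ℝ} {F G : ℝ → ℝ → ℝ} (h : ∀ x y, F x y = G x y) :
    SameBelow c F G := fun x y _ => h x y

/-- If `G < c` held outside the half-plane, the segment to a point with `F < c` would cross the
boundary, where convexity gives `F = G < c`, although `F < c` occurs only in the interior. -/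
theorem SameBelow.of_halfPlane {c p q r : ℝ} {F G : ℝ → ℝ → ℝ} (hG : SegConvex G)
    (hne : ∃ x y, F x y < c) (hpos : ∀ x y, F x y < c → 0 < p * x + q * y + r)
    (heq : ∀ x y, 0 ≤ p * x + q * y + r → F x y = G x y) : SameBelow c F G := by
  rintro x y (h | h)
  · exact heq x y (hpos x y h).le
  · refine heq x y ?_
    by_contra! hneg
    obtain ⟨x₁, y₁, h₁⟩ := hne
    have hp₁ := hpos x₁ y₁ h₁
    have hd : 0 < (p * x₁ + q * y₁ + r) - (p * x + q * y + r) := by linarith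
    obtain ⟨t, ht⟩ : ∃ t, t = (p * x₁ + q * y₁ + r) /
      ((p * x₁ + q * y₁ + r) - (p * x + q * y + r)) := ⟨_, rfl⟩
    have ht0 : 0 ≤ t := by rw [ht]; positivity
    have ht1 : t ≤ 1 := by rw [ht, div_le_one hd]; linarith
    have hte : t * ((p * x₁ + q * y₁ + r) - (p * x + q * y + r)) = p * x₁ + q * y₁ + r := by
      rw [ht, div_mul_cancel₀ _ hd.ne']
    have hz : p * ((1 - t) * x₁ + t * x) + q * ((1 - t) * y₁ + t * y) + r = 0 := by
      linear_combination -hte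
    have hc := hG t ht0 ht1 x₁ y₁ x y
    rw [← heq x₁ y₁ hp₁.le, ← heq _ _ hz.ge] at hc
    have hlt : (1 - t) * F x₁ y₁ + t * G x y < c := by
      rcases ht0.eq_or_lt with h0 | h0
      · rw [← h0]; linarith
      · nlinarith
    have := hpos _ _ (hc.trans_lt hlt)
    linarith

/-- A minimiser of a function which agrees below `c` with `F` is a minimiser of `F`. -/
theorem SameBelow.isMin {c : ℝ} {F G : ℝ → ℝ → ℝ} (h : SameBelow c F G)
    (hne : ∃ x y, F x y < c) {x₀ y₀ : ℝ} (hmin : ∀ x y, G x₀ y₀ ≤ G x y) (x y : ℝ) :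
    F x₀ y₀ ≤ F x y := by
  obtain ⟨x₁, y₁, h₁⟩ := hne
  have e₁ := h x₁ y₁ (.inl h₁)
  have h₀ : G x₀ y₀ < c := by linarith [hmin x₁ y₁]
  have e₀ := h x₀ y₀ (.inr h₀)
  by_cases hxy : F x y < c
  · rw [e₀, h x y (.inl hxy)]
    exact hmin x y
  · linarith

/-- Of two lines which cross at a point with `x = X` and `y + lam * x = Y`, one does not meet an
open quadrant with vertex in that point. -/
theorem pair_side {li lj ri rj lam X Y σx σy x₀ y₀ x y : ℝ} (hi : li ≤ lam) (hj : lam ≤ lj)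
    (hX : X = (rj - ri) / (lj - li)) (hY : Y = ri - (li - lam) * X)
    (hσx : σx = 1 ∨ σx = -1) (hσy : σy = 1 ∨ σy = -1)
    (h₁ : 0 ≤ σx * (x₀ - X)) (h₂ : 0 ≤ σy * (y₀ - Y))
    (h₃ : 0 < σx * (x - x₀)) (h₄ : 0 < σy * (y + lam * x - y₀)) :
    (0 < σx * σy → li < lj → 0 < σy * (lj * x + y - rj)) ∧
    (¬ (0 < σx * σy ∧ li < lj) → 0 < σy * (li * x + y - ri)) := by
  have hxX : 0 < σx * (x - X) := by linarith
  have hyY : 0 < σy * (y + lam * x - Y) := by linarith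
  refine ⟨fun hs hl => ?_, fun hn => ?_⟩
  · have hX' : (lj - li) * X = rj - ri := by
      rw [hX, mul_div_cancel₀ _ (by linarith : lj - li ≠ 0)]
    have hσ : σx = σy := by
      rcases hσx with rfl | rfl <;> rcases hσy with rfl | rfl <;>
        first | rfl | (exfalso; norm_num at hs)
    have e : σy * (lj * x + y - rj) =
        σy * (y + lam * x - Y) + (lj - lam) * (σx * (x - X)) := by
      rw [hσ, hY]
      linear_combination σy * hX'
    rw [e]
    have := mul_nonneg (sub_nonneg.2 hj) hxX.le
    linarith
  · have e : σy * (li * x + y - ri) =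
        σy * (y + lam * x - Y) + (li - lam) * (σy * (x - X)) := by
      rw [hY]
      ring
    rw [e]
    by_cases hs : 0 < σx * σy
    -- In a pair of parallel lines both slopes equal `lam`; then `Y = ri`, and the value of `X`, a
    -- division by zero, is immaterial.
    · have : li = lam := le_antisymm hi (hj.trans (not_lt.1 fun h => hn ⟨hs, h⟩))
      rw [this]
      linarith
    · have hσ : σy = -σx := by
        rcases hσx with rfl | rfl <;> rcases hσy with rfl | rfl <;>
          first | (norm_num; done) | (exfalso; norm_num at hs)
      have := mul_nonneg (sub_nonneg.2 hi) hxX.le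
      have e' : (li - lam) * (σy * (x - X)) = (lam - li) * (σx * (x - X)) := by rw [hσ]; ring
      linarith

theorem linDev_one (n : ℕ) (L R W : ℕ → ℝ) (a b x y : ℝ) :
    linDev n L (fun _ => 1) R W a b x y =
      ∑ k ∈ range n, dev (L k) (R k) (W k) x y + a * x + b * y := by
  simp [linDev, dev]

/-- A translation carries the vertical line through `x₀` to the line `x = 0` required by the line
test. -/
theorem linDev_vertical (n : ℕ) (L R W : ℕ → ℝ) (a b x₀ x y : ℝ) :
    linDev n L (fun _ => 1) (fun k => R k - L k * x₀) W a b x y =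
      linDev n L (fun _ => 1) R W a b (x₀ + x) y - a * x₀ := by
  have : ∀ k, R k - L k * x₀ - L k * x - 1 * y = R k - L k * (x₀ + x) - 1 * y := fun k => by ring
  simp only [linDev, this]
  ring

/-- With `y + lam * x - y₀` as first and `x` as second coordinate, the sloped line becomes the one
required by the line test. -/
theorem linDev_sloped (n : ℕ) (L R W : ℕ → ℝ) (a b lam y₀ x y : ℝ) :
    linDev n (fun _ => 1) (fun k => L k - lam) (fun k => R k - y₀) W b (a - b * lam) y x =
      linDev n L (fun _ => 1) R W a b x (y₀ + y - lam * x) - b * y₀ := by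
  have : ∀ k, R k - y₀ - 1 * y - (L k - lam) * x = R k - L k * x - 1 * (y₀ + y - lam * x) :=
    fun k => by ring
  simp only [linDev, this]
  ring

theorem IsLineTest.vertical {n : ℕ} {L R W : ℕ → ℝ} {a b x₀ σ u : ℝ}
    (h : IsLineTest n L (fun _ => 1) (fun k => R k - L k * x₀) W a b σ u) :
    (σ = 0 ∧ ∀ x y, linDev n L (fun _ => 1) R W a b x₀ u ≤ linDev n L (fun _ => 1) R W a b x y) ∨
    ((σ = 1 ∨ σ = -1) ∧
      (∃ x y, linDev n L (fun _ => 1) R W a b x y < linDev n L (fun _ => 1) R W a b x₀ u) ∧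
      ∀ x y, linDev n L (fun _ => 1) R W a b x y < linDev n L (fun _ => 1) R W a b x₀ u →
        0 < σ * (x - x₀)) := by
  unfold IsLineTest at h
  simp only [linDev_vertical, sub_le_sub_iff_right, sub_lt_sub_iff_right, add_zero] at h
  rcases h with ⟨h0, h⟩ | ⟨h0, ⟨x, y, h1⟩, h2⟩
  · left
    refine ⟨h0, fun x y => ?_⟩
    have := h (x - x₀) y
    rwa [add_sub_cancel] at this
  · right
    refine ⟨h0, ⟨x₀ + x, y, h1⟩, fun x y hxy => h2 (x - x₀) y ?_⟩
    rwa [add_sub_cancel]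

theorem IsLineTest.sloped {n : ℕ} {L R W : ℕ → ℝ} {a b lam y₀ σ u : ℝ}
    (h : IsLineTest n (fun _ => 1) (fun k => L k - lam) (fun k => R k - y₀) W b (a - b * lam) σ u) :
    (σ = 0 ∧ ∀ x y, linDev n L (fun _ => 1) R W a b u (y₀ - lam * u) ≤
      linDev n L (fun _ => 1) R W a b x y) ∨
    ((σ = 1 ∨ σ = -1) ∧
      (∃ x y, linDev n L (fun _ => 1) R W a b x y <
        linDev n L (fun _ => 1) R W a b u (y₀ - lam * u)) ∧
      ∀ x y, linDev n L (fun _ => 1) R W a b x y <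
        linDev n L (fun _ => 1) R W a b u (y₀ - lam * u) → 0 < σ * (y + lam * x - y₀)) := by
  unfold IsLineTest at h
  simp only [linDev_sloped, sub_le_sub_iff_right, sub_lt_sub_iff_right, add_zero] at h
  rcases h with ⟨h0, h⟩ | ⟨h0, ⟨x, y, h1⟩, h2⟩
  · left
    refine ⟨h0, fun x y => ?_⟩
    have := h (y + lam * x - y₀) x
    rwa [show y₀ + (y + lam * x - y₀) - lam * x = y by ring] at this
  · right
    refine ⟨h0, ⟨_, _, h1⟩, fun x y hxy => h2 (y + lam * x - y₀) x ?_⟩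
    rwa [show y₀ + (y + lam * x - y₀) - lam * x = y by ring]

/-! ### The prune-and-search program -/

/-- Compute a median of the first `n` cells of the real array `10`, where `n` is the natural
variable `h`. -/
def Cmd.median (h : ℕ) : Cmd :=
  .setNat 0 (.const 0) ;; .setNat 1 (.var h) ;; .setReal 1 (.const 0) ;; .call 0

/-- Copy the slopes for the computation of a median. -/
def Cmd.copySlopes : Cmd :=
  .forUp 21 20
    (.writeReal 10 (.var 21) (.read 0 (.var 21)) ;; .writeReal 11 (.var 21) (.const 1))

/-- Append those items which pass a test to the arrays `3`, `4`, `5`. -/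
def Cmd.appendIf (t : BExp) : Cmd :=
  .forUp 21 20
    (.cond t
      (.writeReal 3 (.var 23) (.read 0 (.var 21)) ;;
      .writeReal 4 (.var 23) (.read 1 (.var 21)) ;;
      .writeReal 5 (.var 23) (.read 2 (.var 21)) ;;
      .setNat 23 (.add (.var 23) (.const 1)))
      .skip)

/-- Sort the items by the comparison of their slope with the real variable `22`. -/
def Cmd.partition : Cmd :=
  .setNat 23 (.const 0) ;;
  .appendIf (.realLt (.read 0 (.var 21)) (.var 22)) ;;
  .appendIf (.and (.not (.realLt (.read 0 (.var 21)) (.var 22)))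
    (.not (.realLt (.var 22) (.read 0 (.var 21))))) ;;
  .appendIf (.realLt (.var 22) (.read 0 (.var 21)))

/-- Compute the crossing points of the pairs of lines. -/
def Cmd.crossings : Cmd :=
  .setNat 21 (.const 0) ;;
  .loop (.natLt (.add (.var 21) (.var 21)) (.var 20))
    (.setNat 24 (.sub (.sub (.var 20) (.const 1)) (.var 21)) ;;
    .writeReal 6 (.var 21) (.div (.sub (.read 4 (.var 24)) (.read 4 (.var 21)))
      (.sub (.read 3 (.var 24)) (.read 3 (.var 21)))) ;;
    .writeReal 7 (.var 21) (.sub (.read 4 (.var 21))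
      (.mul (.sub (.read 3 (.var 21)) (.var 22)) (.read 6 (.var 21)))) ;;
    .writeReal 10 (.var 21) (.read 6 (.var 21)) ;;
    .writeReal 11 (.var 21) (.const 1) ;;
    .setNat 21 (.add (.var 21) (.const 1))) ;;
  .setNat 22 (.var 21)

def Cmd.prepareVertical : Cmd :=
  (.setReal 12 (.var 20) ;; .setReal 13 (.var 21)) ;;
  .forUp 21 20
    (.writeReal 20 (.var 21) (.read 3 (.var 21)) ;;
    .writeReal 21 (.var 21) (.const 1) ;;
    .writeReal 22 (.var 21)
      (.sub (.read 4 (.var 21)) (.mul (.read 3 (.var 21)) (.var 23))) ;;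
    .writeReal 25 (.var 21) (.read 5 (.var 21)))

/-- Collect the second coordinates of those crossing points which are not on the side of the
minimisers. -/
def Cmd.collect : Cmd :=
  .setNat 23 (.const 0) ;;
  .forUp 21 22
    (.cond (.not (.realLt (.mul (.var 24) (.sub (.var 23) (.read 6 (.var 21)))) (.const 0)))
      (.writeReal 10 (.var 23) (.read 7 (.var 21)) ;;
      .writeReal 11 (.var 23) (.const 1) ;;
      .setNat 23 (.add (.var 23) (.const 1)))
      .skip)

def Cmd.prepareSloped : Cmd :=
  (.setReal 12 (.var 21) ;; .setReal 13 (.sub (.var 20) (.mul (.var 21) (.var 22)))) ;;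
  .forUp 21 20
    (.writeReal 20 (.var 21) (.const 1) ;;
    .writeReal 21 (.var 21) (.sub (.read 3 (.var 21)) (.var 22)) ;;
    .writeReal 22 (.var 21) (.sub (.read 4 (.var 21)) (.var 25)) ;;
    .writeReal 25 (.var 21) (.read 5 (.var 21)))

/-- Keep the item with index the natural variable `t`, or, if that is the value of the natural
variable `25`, add it to the linear part. -/
def Cmd.process (t : ℕ) : Cmd :=
  .cond (.and (.not (.natLt (.var t) (.var 25))) (.not (.natLt (.var 25) (.var t))))
    (.setReal 20 (.add (.var 20) (.mul (.var 26) (.mul (.read 5 (.var t)) (.read 3 (.var t))))) ;;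
    .setReal 21 (.add (.var 21) (.mul (.var 26) (.read 5 (.var t)))))
    (.writeReal 0 (.var 23) (.read 3 (.var t)) ;;
    .writeReal 1 (.var 23) (.read 4 (.var t)) ;;
    .writeReal 2 (.var 23) (.read 5 (.var t)) ;;
    .setNat 23 (.add (.var 23) (.const 1)))

/-- Determine which item of the current pair becomes linear. -/
def Cmd.select : Cmd :=
  .setNat 24 (.sub (.sub (.var 20) (.const 1)) (.var 21)) ;;
  .setNat 25 (.var 20) ;;
  .cond (.and
      (.not (.realLt (.mul (.var 24) (.sub (.var 23) (.read 6 (.var 21)))) (.const 0)))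
      (.not (.realLt (.mul (.var 26) (.sub (.var 25) (.read 7 (.var 21)))) (.const 0))))
    (.cond (.and (.realLt (.const 0) (.mul (.var 24) (.var 26)))
        (.realLt (.read 3 (.var 21)) (.read 3 (.var 24))))
      (.setNat 25 (.var 24))
      (.setNat 25 (.var 21)))
    .skip

/-- For an odd number of items the middle one is its own partner; the guard on the second `process`
keeps it from being handled twice. -/
def Cmd.resolve : Cmd :=
  .setNat 23 (.const 0) ;;
  .forUp 21 22
    (.select ;; .process 21 ;; .cond (.natLt (.var 21) (.var 24)) (.process 24) .skip)

/-- The second half of an iteration of `Cmd.search`. -/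
def Cmd.descend : Cmd :=
  .collect ;; .median 23 ;; .setReal 25 (.var 0) ;; .prepareSloped ;; .lineTest ;;
  .setReal 26 (.var 14) ;;
  .cond (.realLt (.const 0) (.mul (.var 26) (.var 26)))
    (.resolve ;; .setNat 20 (.var 23) ;; .call 1)
    (.setReal 27 (.var 15) ;; .setReal 28 (.sub (.var 25) (.mul (.var 22) (.var 15))))

/-- The procedure which minimises `∑ W k * |R k - L k * x - y| + a * x + b * y`, where `L`, `R`, `W`
are the real arrays `0`, `1`, `2`, their length is the natural variable `20` and `a`, `b` are the
real variables `20`, `21`. The result is stored in the real variables `27` and `28`. -/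
def Cmd.search : Cmd :=
  .cond (.natLt (.const 0) (.var 20))
    (.copySlopes ;; .median 20 ;; .setReal 22 (.var 0) ;; .partition ;; .crossings ;;
    .median 22 ;; .setReal 23 (.var 0) ;; .prepareVertical ;; .lineTest ;;
    .setReal 24 (.var 14) ;;
    .cond (.realLt (.const 0) (.mul (.var 24) (.var 24)))
      .descend
      (.setReal 27 (.var 23) ;; .setReal 28 (.var 15)))
    (.setReal 27 (.const 0) ;; .setReal 28 (.const 0))

/-! ### Medians, partition and crossing points -/

theorem Cmd.median_runs {procs : List Cmd} (hp : procs[0]? = some .quantile) (h n : ℕ) (s : State)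
    (V : ℕ → ℝ) (hh : h ≠ 0) (hn : s.natVar h = n) (hV : ∀ k < n, s.realArr 10 k = V k)
    (hM : ∀ k < n, s.realArr 11 k = 1) :
    Runs procs (.median h) s (quantileTime n + 20) fun s' => Frame quantileFootprint s s' ∧
      (n : ℝ) ≤ 2 * ∑ k ∈ range n, (if V k ≤ s'.realVar 0 then (1 : ℝ) else 0) ∧
      (n : ℝ) ≤ 2 * ∑ k ∈ range n, (if s'.realVar 0 ≤ V k then (1 : ℝ) else 0) := by
  refine (Runs.frame (A := quantileFootprint) ?_ (calls_of_procs hp rfl rfl) rfl)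
  refine Runs.seq_simple rfl (K₂ := quantileTime n + 10) ?_ (by simp [Cmd.bound, NExp.cost]; omega)
  refine Runs.seq_simple rfl (K₂ := quantileTime n + 5) ?_ (by simp [Cmd.bound, NExp.cost]; omega)
  refine Runs.seq_simple rfl (K₂ := quantileTime n) ?_ (by simp [Cmd.bound, RExp.cost]; omega)
  refine (Cmd.quantile_spec hp n _ (by simp [hh, hn])).mono le_rfl ?_
  rintro s' ⟨-, -, hQ⟩
  have hq := hQ V (fun _ => 1) (fun k hk => by simp [hV k hk]) (fun k hk => by simp [hM k hk])
    (fun _ _ => zero_le_one) (by simp) (by simp)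
  have e : ((Cmd.setReal 1 (.const 0)).run ((Cmd.setNat 1 (.var h)).run
      ((Cmd.setNat 0 (.const 0)).run s))).realVar 1 = 0 := by simp
  rw [e] at hq
  exact hq.le_two_mul_card fun _ _ => rfl

theorem Cmd.copySlopes_runs {procs : List Cmd} (n : ℕ) (s : State) (hn : s.natVar 20 = n) :
    Runs procs .copySlopes s (100 * n + 110) fun s' =>
      Frame ⟨[21], [], [], [10, 11], []⟩ s s' ∧
      (∀ k < n, s'.realArr 10 k = s.realArr 0 k) ∧ (∀ k < n, s'.realArr 11 k = 1) := by
  refine (Runs.forUp ⟨[], [], [], [10, 11], []⟩ 100 n (fun j s' =>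
    (∀ k < j, s'.realArr 10 k = s.realArr 0 k) ∧ (∀ k < j, s'.realArr 11 k = 1))
    rfl rfl (by simp) (by simp) rfl (by decide) hn (by simp) ?_).mono (by omega)
    (fun s' h => ⟨h.1, h.2⟩)
  rintro j hj s' hF hi ⟨h1, h2⟩
  have e1 := hF.realArr 0 (by simp [Footprint.addNat])
  simp [hi, e1]
  refine ⟨fun k hk => ?_, fun k hk => ?_⟩
  · by_cases hkj : k = j
    · simp [hkj]
    · simp [hkj, h1 k (by omega)]
  · by_cases hkj : k = j
    · simp [hkj]
    · simp [hkj, h2 k (by omega)]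

/-- The effect of `Cmd.appendIf` on the arrays `3`, `4`, `5`. -/
structure Appended (n m₀ : ℕ) (T : ℝ → Prop) [DecidablePred T] (L R W : ℕ → ℝ) (s s' : State) :
    Prop where
  le : m₀ ≤ s'.natVar 23
  old₃ : ∀ k < m₀, s'.realArr 3 k = s.realArr 3 k
  old₄ : ∀ k < m₀, s'.realArr 4 k = s.realArr 4 k
  old₅ : ∀ k < m₀, s'.realArr 5 k = s.realArr 5 k
  test : ∀ k, m₀ ≤ k → k < s'.natVar 23 → T (s'.realArr 3 k) ∧ ∃ i < n, s'.realArr 5 k = W i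
  sum : ∀ φ : ℝ → ℝ → ℝ → ℝ,
    ∑ k ∈ range (s'.natVar 23), φ (s'.realArr 3 k) (s'.realArr 4 k) (s'.realArr 5 k) =
    ∑ k ∈ range m₀, φ (s.realArr 3 k) (s.realArr 4 k) (s.realArr 5 k) +
    ∑ k ∈ range n, if T (L k) then φ (L k) (R k) (W k) else 0

def appendFootprint : Footprint := ⟨[21, 23], [], [], [3, 4, 5], []⟩

theorem Cmd.appendIf_runs {procs : List Cmd} (n m₀ : ℕ) (T : ℝ → Prop) [DecidablePred T] (t : BExp)
    (s : State) (L R W : ℕ → ℝ) (hn : s.natVar 20 = n) (hm : s.natVar 23 = m₀)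
    (hL : ∀ k < n, s.realArr 0 k = L k) (hR : ∀ k < n, s.realArr 1 k = R k)
    (hW : ∀ k < n, s.realArr 2 k = W k) (ht : t.cost ≤ 100)
    (hT : ∀ s' : State, s'.realVar 22 = s.realVar 22 → s'.realArr 0 = s.realArr 0 →
      s'.natVar 21 < n → (t.Holds s' ↔ T (L (s'.natVar 21)))) :
    Runs procs (.appendIf t) s (200 * n + 210) fun s' =>
      Frame appendFootprint s s' ∧ Appended n m₀ T L R W s s' := by
  refine Runs.frame (A := appendFootprint) ?_ (by simp [appendFootprint]) rfl
  refine (Runs.forUp ⟨[23], [], [], [3, 4, 5], []⟩ 200 n (fun j s' =>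
    Appended j m₀ T L R W s s') ?_ ?_ (by simp) (by simp) rfl ?_ hn ?_ ?_).mono (by omega) ?_
  · simp [Cmd.simple]
  · simp [Cmd.within]
  · simp [Cmd.bound, NExp.cost, RExp.cost]; omega
  · refine ⟨by simp [hm], by simp, by simp, by simp, fun k h1 h2 => ?_, fun φ => by simp [hm]⟩
    simp [hm] at h2
    omega
  · rintro j hj s' hF hi ⟨hle, h3, h4, h5, htest, hsum⟩
    have e0 := hF.realArr 0 (by simp [Footprint.addNat])
    have e1 := hF.realArr 1 (by simp [Footprint.addNat])
    have e2 := hF.realArr 2 (by simp [Footprint.addNat])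
    have e22 := hF.real 22 (by simp [Footprint.addNat])
    have hT' := hT s' e22 e0 (by omega)
    rw [hi] at hT'
    obtain ⟨m, hm'⟩ : ∃ m, s'.natVar 23 = m := ⟨_, rfl⟩
    rw [hm'] at hle htest hsum
    by_cases h : T (L j)
    · have hb := hT'.2 h
      simp only [Cmd.run, hb, if_true, NExp.eval, RExp.eval]
      refine ⟨?_, ?_, ?_, ?_, ?_, ?_⟩
      · simp [hm']; omega
      · intro k hk
        have : k ≠ m := by omega
        simp [hm', this, h3 k hk]
      · intro k hk
        have : k ≠ m := by omega
        simp [hm', this, h4 k hk]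
      · intro k hk
        have : k ≠ m := by omega
        simp [hm', this, h5 k hk]
      · intro k hk hk'
        simp [hm'] at hk'
        by_cases hkm : k = m
        · simp [hkm, hm', hi, e0, e2, hL j hj, hW j hj, h]
          exact ⟨j, by omega, rfl⟩
        · obtain ⟨a1, i, a2, a3⟩ := htest k hk (by omega)
          refine ⟨by simpa [hm', hkm] using a1, i, by omega, by simpa [hm', hkm] using a3⟩
      · intro φ
        have hs := hsum φ
        simp [hm', hi, e0, e1, e2, hL j hj, hR j hj, hW j hj]
        rw [sum_range_succ, sum_range_succ, ← add_assoc, ← hs]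
        simp only [Function.update_self, h, if_true]
        congr 1
        refine sum_congr rfl fun k hk => ?_
        have : k ≠ m := by simp at hk; omega
        simp [this]
    · have hb := mt hT'.1 h
      simp only [Cmd.run, hb, if_false]
      refine ⟨by simp [hm', hle], h3, h4, h5, ?_, ?_⟩
      · intro k hk hk'
        simp [hm'] at hk'
        obtain ⟨a1, i, a2, a3⟩ := htest k hk (by omega)
        exact ⟨a1, i, by omega, a3⟩
      · intro φ
        rw [sum_range_succ, if_neg h, add_zero]
        simpa [hm'] using hsum φ
  · rintro s' ⟨-, h⟩
    exact h

/-- No sorting is needed: three classes around the median suffice for an index in the first half and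
its mirror image to lie on opposite sides of `lam`. The sums over all `φ` say that the items are
only rearranged. -/
theorem Cmd.partition_runs {procs : List Cmd} (n : ℕ) (s : State) (L R W : ℕ → ℝ) (lam : ℝ)
    (hn : s.natVar 20 = n) (hlam : s.realVar 22 = lam)
    (hL : ∀ k < n, s.realArr 0 k = L k) (hR : ∀ k < n, s.realArr 1 k = R k)
    (hW : ∀ k < n, s.realArr 2 k = W k)
    (h₁ : (n : ℝ) ≤ 2 * ∑ k ∈ range n, (if L k ≤ lam then (1 : ℝ) else 0))
    (h₂ : (n : ℝ) ≤ 2 * ∑ k ∈ range n, (if lam ≤ L k then (1 : ℝ) else 0)) :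
    Runs procs .partition s (600 * n + 700) fun s' => Frame appendFootprint s s' ∧
      (∀ φ : ℝ → ℝ → ℝ → ℝ,
        ∑ k ∈ range n, φ (s'.realArr 3 k) (s'.realArr 4 k) (s'.realArr 5 k) =
        ∑ k ∈ range n, φ (L k) (R k) (W k)) ∧
      (∀ k < n, ∃ i < n, s'.realArr 5 k = W i) ∧
      (∀ k, 2 * k < n → s'.realArr 3 k ≤ lam ∧ lam ≤ s'.realArr 3 (n - 1 - k)) := by
  refine Runs.frame (A := appendFootprint) ?_ (by simp [appendFootprint]) rfl
  refine Runs.seq_simple rfl (K₂ := 600 * n + 650) ?_ (by simp [Cmd.bound, NExp.cost]; omega)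
  refine Runs.seq (Cmd.appendIf_runs n 0 (· < lam) _ _ L R W (by simpa using hn) (by simp)
    (by simpa using hL) (by simpa using hR) (by simpa using hW) (by decide) ?_)
    (K₂ := 400 * n + 430) ?_ (by omega)
  · intro s' e22 e0 hi
    have e22' : s'.realVar 22 = lam := by rw [e22]; simpa using hlam
    simp [e22', e0, hL _ hi]
  rintro s₁ ⟨hF1, hA1⟩
  obtain ⟨m₁, hm₁⟩ : ∃ m, s₁.natVar 23 = m := ⟨_, rfl⟩
  have e20 : s₁.natVar 20 = n := by rw [hF1.nat 20 (by decide)]; simpa using hn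
  have e22 : s₁.realVar 22 = lam := by rw [hF1.real 22 (by decide)]; simpa using hlam
  have eL : ∀ k < n, s₁.realArr 0 k = L k := by rw [hF1.realArr 0 (by decide)]; simpa using hL
  have eR : ∀ k < n, s₁.realArr 1 k = R k := by rw [hF1.realArr 1 (by decide)]; simpa using hR
  have eW : ∀ k < n, s₁.realArr 2 k = W k := by rw [hF1.realArr 2 (by decide)]; simpa using hW
  refine Runs.seq (Cmd.appendIf_runs n m₁ (fun l => ¬ l < lam ∧ ¬ lam < l) _ _ L R W e20 hm₁
    eL eR eW (by decide) ?_) (K₂ := 200 * n + 215) ?_ (by omega)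
  · intro s' e22' e0 hi
    simp [e22', e22, e0, eL _ hi]
  rintro s₂ ⟨hF2, hA2⟩
  obtain ⟨m₂, hm₂⟩ : ∃ m, s₂.natVar 23 = m := ⟨_, rfl⟩
  have f22 : s₂.realVar 22 = lam := by rw [hF2.real 22 (by decide), e22]
  have fL : ∀ k < n, s₂.realArr 0 k = L k := by rw [hF2.realArr 0 (by decide)]; exact eL
  refine (Cmd.appendIf_runs n m₂ (lam < ·) _ _ L R W (by rw [hF2.nat 20 (by decide), e20]) hm₂
    fL (by rw [hF2.realArr 1 (by decide)]; exact eR)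
    (by rw [hF2.realArr 2 (by decide)]; exact eW) (by decide) ?_).mono (by omega) ?_
  · intro s' e22' e0 hi
    simp [e22', f22, e0, fL _ hi]
  rintro s₃ ⟨hF3, hA3⟩
  obtain ⟨m₃, hm₃⟩ : ∃ m, s₃.natVar 23 = m := ⟨_, rfl⟩
  have le1 := hA2.le
  have le2 := hA3.le
  have t1 := hA1.test
  have t2 := hA2.test
  have t3 := hA3.test
  have s1 := hA1.sum
  have s2 := hA2.sum
  have s3 := hA3.sum
  rw [hm₁] at t1 s1
  rw [hm₂] at t2 s2 le1
  rw [hm₃] at t3 s3 le2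
  simp only [range_zero, sum_empty, zero_add] at s1
  have hsum : ∀ φ : ℝ → ℝ → ℝ → ℝ,
      ∑ k ∈ range m₃, φ (s₃.realArr 3 k) (s₃.realArr 4 k) (s₃.realArr 5 k) =
        ∑ k ∈ range n, φ (L k) (R k) (W k) := by
    intro φ
    rw [s3, s2, s1, ← sum_add_distrib, ← sum_add_distrib]
    refine sum_congr rfl fun k _ => ?_
    rcases lt_trichotomy (L k) lam with h | h | h
    · simp [h, h.not_gt]
    · simp [h]
    · simp [h, h.not_gt]
  have hm₃n : m₃ = n := by
    have := hsum fun _ _ _ => 1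
    simpa using this
  have c1 : (m₁ : ℝ) = ∑ k ∈ range n, if L k < lam then (1 : ℝ) else 0 := by
    simpa using s1 fun _ _ _ => 1
  have c3 : (m₃ : ℝ) = m₂ + ∑ k ∈ range n, if lam < L k then (1 : ℝ) else 0 := by
    simpa using s3 fun _ _ _ => 1
  have d1 := sum_split n L (fun _ => 1) lam
  have d2 := sum_split' n L (fun _ => 1) lam
  simp only [sum_const, card_range, nsmul_eq_mul, mul_one] at d1 d2
  -- The class below `lam` ends at `m₁` and the class above begins at `m₂`; the median property
  -- places `n / 2` between them.
  have b1 : 2 * m₁ ≤ n := by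
    have : (2 : ℝ) * m₁ ≤ n := by linarith
    exact_mod_cast this
  have b2 : n ≤ 2 * m₂ := by
    rw [hm₃n] at c3
    have : (n : ℝ) ≤ 2 * m₂ := by linarith
    exact_mod_cast this
  have v1 : ∀ k < m₁, s₃.realArr 3 k = s₁.realArr 3 k ∧ s₃.realArr 5 k = s₁.realArr 5 k :=
    fun k hk => ⟨by rw [hA3.old₃ k (by omega), hA2.old₃ k hk],
      by rw [hA3.old₅ k (by omega), hA2.old₅ k hk]⟩
  have v2 : ∀ k < m₂, s₃.realArr 3 k = s₂.realArr 3 k ∧ s₃.realArr 5 k = s₂.realArr 5 k :=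
    fun k hk => ⟨hA3.old₃ k hk, hA3.old₅ k hk⟩
  refine ⟨?_, fun k hk => ?_, fun k hk => ⟨?_, ?_⟩⟩
  · intro φ
    rw [← hsum φ, hm₃n]
  · by_cases hk1 : k < m₁
    · rw [(v1 k hk1).2]
      exact (t1 k (by omega) hk1).2
    · by_cases hk2 : k < m₂
      · rw [(v2 k hk2).2]
        exact (t2 k (by omega) hk2).2
      · exact (t3 k (by omega) (by omega)).2
  · by_cases hk1 : k < m₁
    · rw [(v1 k hk1).1]
      exact (t1 k (by omega) hk1).1.le
    · have hk2 : k < m₂ := by omega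
      rw [(v2 k hk2).1]
      exact not_lt.1 (t2 k (by omega) hk2).1.2
  · obtain ⟨j, hj⟩ : ∃ j, n - 1 - k = j := ⟨_, rfl⟩
    rw [hj]
    by_cases hk2 : j < m₂
    · rw [(v2 j hk2).1]
      exact not_lt.1 (t2 j (by omega) hk2).1.1
    · exact (t3 j (by omega) (by omega)).1.le

/-- Rounding up the number of pairs includes the middle item of an odd list as its own partner.
Equal slopes give `X = 0` through division by zero, which `pair_side` tolerates. -/
theorem Cmd.crossings_runs {procs : List Cmd} (n : ℕ) (s : State) (L R X Y : ℕ → ℝ) (lam : ℝ)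
    (hn : s.natVar 20 = n) (hlam : s.realVar 22 = lam)
    (hL : ∀ k, s.realArr 3 k = L k) (hR : ∀ k, s.realArr 4 k = R k)
    (hX : ∀ k, X k = (R (n - 1 - k) - R k) / (L (n - 1 - k) - L k))
    (hY : ∀ k, Y k = R k - (L k - lam) * X k) :
    Runs procs .crossings s (200 * n + 300) fun s' =>
      Frame ⟨[21, 22, 24], [], [], [6, 7, 10, 11], []⟩ s s' ∧ s'.natVar 22 = (n + 1) / 2 ∧
      (∀ k < (n + 1) / 2, s'.realArr 6 k = X k) ∧ (∀ k < (n + 1) / 2, s'.realArr 7 k = Y k) ∧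
      (∀ k < (n + 1) / 2, s'.realArr 10 k = X k) ∧ (∀ k < (n + 1) / 2, s'.realArr 11 k = 1) := by
  set A : Footprint := ⟨[21, 22, 24], [], [], [6, 7, 10, 11], []⟩ with hA
  refine Runs.frame (A := A) ?_ (by simp [hA]) rfl
  refine Runs.seq_simple rfl (K₂ := 200 * n + 250) ?_ (by simp [Cmd.bound, NExp.cost]; omega)
  have hF0 : Frame A s ((Cmd.setNat 21 (.const 0)).run s) := by
    refine ⟨fun x hx => ?_, fun _ _ => rfl, fun _ _ => rfl, fun _ _ => rfl⟩
    simp [hA] at hx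
    simp [hx]
  refine Runs.seq (Runs.loop (K₁ := 150) (B := 180) ((n + 1) / 2) (fun j s' => Frame A s s' ∧
      s'.natVar 21 = j ∧ (∀ k < j, s'.realArr 6 k = X k) ∧ (∀ k < j, s'.realArr 7 k = Y k) ∧
      (∀ k < j, s'.realArr 10 k = X k) ∧ (∀ k < j, s'.realArr 11 k = 1))
    (by simp [BExp.cost, NExp.cost]) ?_ ?_ ⟨hF0, by simp⟩) (K₂ := 10) ?_ (by omega)
  · rintro j hj s' ⟨hF, h21, h6, h7, h10, h11⟩
    have e20 : s'.natVar 20 = n := by rw [hF.nat 20 (by simp [hA]), hn]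
    have e22 : s'.realVar 22 = lam := by rw [hF.real 22 (by simp [hA]), hlam]
    have e3 : ∀ k, s'.realArr 3 k = L k := by rw [hF.realArr 3 (by simp [hA])]; exact hL
    have e4 : ∀ k, s'.realArr 4 k = R k := by rw [hF.realArr 4 (by simp [hA])]; exact hR
    refine ⟨by simp [h21, e20]; omega, ?_⟩
    refine (Runs.frame (Runs.of_simple (procs := procs)
      (Q := fun t => t.natVar 21 = j + 1 ∧ (∀ k < j + 1, t.realArr 6 k = X k) ∧
        (∀ k < j + 1, t.realArr 7 k = Y k) ∧ (∀ k < j + 1, t.realArr 10 k = X k) ∧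
        (∀ k < j + 1, t.realArr 11 k = 1)) rfl (by decide) ?_) A
        (by simp [hA]) rfl).mono le_rfl (fun t ht => ⟨hF.trans ht.1, ht.2⟩)
    simp [h21, e20, e22, e3, e4, ← hX, ← hY]
    refine ⟨fun k hk => ?_, fun k hk => ?_, fun k hk => ?_, fun k hk => ?_⟩
    · by_cases hkj : k = j
      · simp [hkj]
      · simp [hkj, h6 k (by omega)]
    · by_cases hkj : k = j
      · simp [hkj]
      · simp [hkj, h7 k (by omega)]
    · by_cases hkj : k = j
      · simp [hkj]
      · simp [hkj, h10 k (by omega)]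
    · by_cases hkj : k = j
      · simp [hkj]
      · simp [hkj, h11 k (by omega)]
  · rintro s' ⟨hF, h21, -⟩
    have e20 : s'.natVar 20 = n := by rw [hF.nat 20 (by simp [hA]), hn]
    simp [h21, e20]
    omega
  · rintro s' ⟨-, h21, h⟩
    refine Runs.of_simple rfl (by decide) ⟨by simp [h21], ?_⟩
    simpa using h

theorem Cmd.prepareVertical_runs {procs : List Cmd} (n : ℕ) (s : State) (L R W : ℕ → ℝ)
    (a b x₀ : ℝ) (hn : s.natVar 20 = n) (ha : s.realVar 20 = a) (hb : s.realVar 21 = b)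
    (hx : s.realVar 23 = x₀) (hL : ∀ k, s.realArr 3 k = L k) (hR : ∀ k, s.realArr 4 k = R k)
    (hW : ∀ k, s.realArr 5 k = W k) :
    Runs procs .prepareVertical s (200 * n + 300) fun s' =>
      Frame ⟨[21], [12, 13], [], [20, 21, 22, 25], []⟩ s s' ∧
      s'.realVar 12 = a ∧ s'.realVar 13 = b ∧ (∀ k < n, s'.realArr 20 k = L k) ∧
      (∀ k < n, s'.realArr 21 k = 1) ∧ (∀ k < n, s'.realArr 22 k = R k - L k * x₀) ∧
      (∀ k < n, s'.realArr 25 k = W k) := by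
  refine Runs.frame (A := ⟨[21], [12, 13], [], [20, 21, 22, 25], []⟩) ?_ (by simp) rfl
  refine Runs.seq_simple rfl (K₂ := 200 * n + 210) ?_ (by simp [Cmd.bound, RExp.cost]; omega)
  refine (Runs.forUp ⟨[], [], [], [20, 21, 22, 25], []⟩ 200 n (fun j s' =>
      (∀ k < j, s'.realArr 20 k = L k) ∧
      (∀ k < j, s'.realArr 21 k = 1) ∧ (∀ k < j, s'.realArr 22 k = R k - L k * x₀) ∧
      (∀ k < j, s'.realArr 25 k = W k))
    rfl rfl (by simp) (by simp) rfl (by decide) (by simpa using hn) (by simp) ?_).mono (by omega) ?_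
  · rintro j hj s' hF hi ⟨h1, h2, h3, h4⟩
    have e3 : ∀ k, s'.realArr 3 k = L k := by
      rw [hF.realArr 3 (by simp [Footprint.addNat])]; simpa using hL
    have e4 : ∀ k, s'.realArr 4 k = R k := by
      rw [hF.realArr 4 (by simp [Footprint.addNat])]; simpa using hR
    have e5 : ∀ k, s'.realArr 5 k = W k := by
      rw [hF.realArr 5 (by simp [Footprint.addNat])]; simpa using hW
    have e6 : s'.realVar 23 = x₀ := by
      rw [hF.real 23 (by simp [Footprint.addNat])]; simpa using hx
    simp [hi, e3, e4, e5, e6]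
    refine ⟨fun k hk => ?_, fun k hk => ?_, fun k hk => ?_, fun k hk => ?_⟩
    · by_cases hkj : k = j
      · simp [hkj]
      · simp [hkj, h1 k (by omega)]
    · by_cases hkj : k = j
      · simp [hkj]
      · simp [hkj, h2 k (by omega)]
    · by_cases hkj : k = j
      · simp [hkj]
      · simp [hkj, h3 k (by omega)]
    · by_cases hkj : k = j
      · simp [hkj]
      · simp [hkj, h4 k (by omega)]
  · rintro s' ⟨hF, h⟩
    refine ⟨?_, ?_, h⟩
    · rw [hF.real 12 (by simp [Footprint.addNat])]; simp [ha]
    · rw [hF.real 13 (by simp [Footprint.addNat])]; simp [hb]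

theorem Cmd.prepareSloped_runs {procs : List Cmd} (n : ℕ) (s : State) (L R W : ℕ → ℝ)
    (a b lam y₀ : ℝ) (hn : s.natVar 20 = n) (ha : s.realVar 20 = a) (hb : s.realVar 21 = b)
    (hlam : s.realVar 22 = lam) (hy : s.realVar 25 = y₀) (hL : ∀ k, s.realArr 3 k = L k)
    (hR : ∀ k, s.realArr 4 k = R k) (hW : ∀ k, s.realArr 5 k = W k) :
    Runs procs .prepareSloped s (200 * n + 300) fun s' =>
      Frame ⟨[21], [12, 13], [], [20, 21, 22, 25], []⟩ s s' ∧
      s'.realVar 12 = b ∧ s'.realVar 13 = a - b * lam ∧ (∀ k < n, s'.realArr 20 k = 1) ∧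
      (∀ k < n, s'.realArr 21 k = L k - lam) ∧ (∀ k < n, s'.realArr 22 k = R k - y₀) ∧
      (∀ k < n, s'.realArr 25 k = W k) := by
  refine Runs.frame (A := ⟨[21], [12, 13], [], [20, 21, 22, 25], []⟩) ?_ (by simp) rfl
  refine Runs.seq_simple rfl (K₂ := 200 * n + 210) ?_ (by simp [Cmd.bound, RExp.cost]; omega)
  refine (Runs.forUp ⟨[], [], [], [20, 21, 22, 25], []⟩ 200 n (fun j s' =>
      (∀ k < j, s'.realArr 20 k = 1) ∧
      (∀ k < j, s'.realArr 21 k = L k - lam) ∧ (∀ k < j, s'.realArr 22 k = R k - y₀) ∧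
      (∀ k < j, s'.realArr 25 k = W k))
    rfl rfl (by simp) (by simp) rfl (by decide) (by simpa using hn) (by simp) ?_).mono (by omega) ?_
  · rintro j hj s' hF hi ⟨h1, h2, h3, h4⟩
    have e3 : ∀ k, s'.realArr 3 k = L k := by
      rw [hF.realArr 3 (by simp [Footprint.addNat])]; simpa using hL
    have e4 : ∀ k, s'.realArr 4 k = R k := by
      rw [hF.realArr 4 (by simp [Footprint.addNat])]; simpa using hR
    have e5 : ∀ k, s'.realArr 5 k = W k := by
      rw [hF.realArr 5 (by simp [Footprint.addNat])]; simpa using hW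
    have e6 : s'.realVar 25 = y₀ := by
      rw [hF.real 25 (by simp [Footprint.addNat])]; simpa using hy
    have e7 : s'.realVar 22 = lam := by
      rw [hF.real 22 (by simp [Footprint.addNat])]; simpa using hlam
    simp [hi, e3, e4, e5, e6, e7]
    refine ⟨fun k hk => ?_, fun k hk => ?_, fun k hk => ?_, fun k hk => ?_⟩
    · by_cases hkj : k = j
      · simp [hkj]
      · simp [hkj, h1 k (by omega)]
    · by_cases hkj : k = j
      · simp [hkj]
      · simp [hkj, h2 k (by omega)]
    · by_cases hkj : k = j
      · simp [hkj]
      · simp [hkj, h3 k (by omega)]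
    · by_cases hkj : k = j
      · simp [hkj]
      · simp [hkj, h4 k (by omega)]
  · rintro s' ⟨hF, h⟩
    refine ⟨?_, ?_, h⟩
    · rw [hF.real 12 (by simp [Footprint.addNat])]; simp [hb]
    · rw [hF.real 13 (by simp [Footprint.addNat])]; simp [ha, hb, hlam]

/-- The constant `φ = 1` counts the collected points; an indicator `φ` later counts those on the
wrong side of the second line as well. -/
theorem Cmd.collect_runs {procs : List Cmd} (h : ℕ) (s : State) (X Y : ℕ → ℝ) (σ x₀ : ℝ)
    (hh : s.natVar 22 = h) (hσ : s.realVar 24 = σ) (hx : s.realVar 23 = x₀)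
    (hX : ∀ k < h, s.realArr 6 k = X k) (hY : ∀ k < h, s.realArr 7 k = Y k) :
    Runs procs .collect s (200 * h + 300) fun s' =>
      Frame ⟨[21, 23], [], [], [10, 11], []⟩ s s' ∧
      (∀ φ : ℝ → ℝ, ∑ k ∈ range (s'.natVar 23), φ (s'.realArr 10 k) =
        ∑ k ∈ range h, if 0 ≤ σ * (x₀ - X k) then φ (Y k) else 0) ∧
      (∀ k < s'.natVar 23, s'.realArr 11 k = 1) := by
  refine Runs.frame (A := ⟨[21, 23], [], [], [10, 11], []⟩) ?_ (by simp) rfl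
  refine Runs.seq_simple rfl (K₂ := 200 * h + 210) ?_ (by simp [Cmd.bound, NExp.cost]; omega)
  refine (Runs.forUp ⟨[23], [], [], [10, 11], []⟩ 200 h (fun j s' =>
      (∀ φ : ℝ → ℝ, ∑ k ∈ range (s'.natVar 23), φ (s'.realArr 10 k) =
        ∑ k ∈ range j, if 0 ≤ σ * (x₀ - X k) then φ (Y k) else 0) ∧
      (∀ k < s'.natVar 23, s'.realArr 11 k = 1))
    rfl rfl (by simp) (by simp) rfl (by decide) (by simpa using hh) (by simp) ?_).mono (by omega)
    (fun s' h => h.2)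
  rintro j hj s' hF hi ⟨h1, h2⟩
  have e6 : s'.realArr 6 j = X j := by
    rw [hF.realArr 6 (by simp [Footprint.addNat])]; simpa using hX j hj
  have e7 : s'.realArr 7 j = Y j := by
    rw [hF.realArr 7 (by simp [Footprint.addNat])]; simpa using hY j hj
  have e23 : s'.realVar 23 = x₀ := by
    rw [hF.real 23 (by simp [Footprint.addNat])]; simpa using hx
  have e24 : s'.realVar 24 = σ := by
    rw [hF.real 24 (by simp [Footprint.addNat])]; simpa using hσ
  obtain ⟨m, hm⟩ : ∃ m, s'.natVar 23 = m := ⟨_, rfl⟩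
  rw [hm] at h1 h2
  by_cases hc : 0 ≤ σ * (x₀ - X j)
  · simp [hi, e6, e7, e23, e24, hc, hm]
    refine ⟨fun φ => ?_, fun k hk => ?_⟩
    · rw [sum_range_succ, sum_range_succ, ← h1 φ, if_pos hc]
      simp only [Function.update_self]
      congr 1
      refine sum_congr rfl fun k hk => ?_
      have : k ≠ m := by simp at hk; omega
      simp [this]
    · by_cases hkm : k = m
      · simp [hkm]
      · simp [hkm, h2 k (by omega)]
  · simp [hi, e6, e23, e24, hc, hm]
    refine ⟨fun φ => ?_, h2⟩
    rw [sum_range_succ, if_neg hc, add_zero, h1 φ]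

/-! ### Turning absolute values into linear terms -/

/-- The function described by the arrays `0`, `1`, `2` and the real variables `20` and `21`. -/
def objective (s : State) : ℝ → ℝ → ℝ :=
  linDev (s.natVar 23) (s.realArr 0) (fun _ => 1) (s.realArr 1) (s.realArr 2) (s.realVar 20)
    (s.realVar 21)

def processFootprint : Footprint := ⟨[23], [20, 21], [], [0, 1, 2], []⟩

theorem Cmd.frame_run {c : Cmd} (A : Footprint) (hA : A.calls = []) (hs : c.simple)
    (hw : c.within A) (s : State) : Frame A s (c.run s) := by
  obtain ⟨k, hk, -⟩ := c.exec_run [] hs s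
  exact hk.frame (by simp [hA]) hw

theorem sum_dev_congr {m : ℕ} {L R W L' R' W' : ℕ → ℝ} (hL : ∀ k < m, L k = L' k)
    (hR : ∀ k < m, R k = R' k) (hW : ∀ k < m, W k = W' k) (x y : ℝ) :
    ∑ k ∈ range m, dev (L k) (R k) (W k) x y = ∑ k ∈ range m, dev (L' k) (R' k) (W' k) x y :=
  sum_congr rfl fun k hk => by
    have := mem_range.1 hk
    rw [hL k this, hR k this, hW k this]

/-- A linearised term loses its constant `-(σ * w * r)`, since the memory stores no additive
constant; this is the reason for the `γ` in later statements. -/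
theorem Cmd.process_run (t : ℕ) (s : State) (i z : ℕ) (σ l r w : ℝ) (ht : s.natVar t = i)
    (hz : s.natVar 25 = z) (hσ : s.realVar 26 = σ) (hl : s.realArr 3 i = l)
    (hr : s.realArr 4 i = r) (hw : s.realArr 5 i = w)
    (hpos : ∀ k < s.natVar 23, 0 ≤ s.realArr 2 k) (hw0 : 0 ≤ w) :
    (∀ k < ((Cmd.process t).run s).natVar 23, 0 ≤ ((Cmd.process t).run s).realArr 2 k) ∧
    (i = z → ((Cmd.process t).run s).natVar 23 = s.natVar 23 ∧ ∀ x y,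
      objective ((Cmd.process t).run s) x y = objective s x y + σ * w * (l * x + y)) ∧
    (i ≠ z → ((Cmd.process t).run s).natVar 23 = s.natVar 23 + 1 ∧ ∀ x y,
      objective ((Cmd.process t).run s) x y = objective s x y + dev l r w x y) := by
  by_cases hiz : i = z
  · subst hiz
    have e : (Cmd.process t).run s = ⟨s.natVar, Function.update (Function.update s.realVar 20
        (s.realVar 20 + σ * (w * l))) 21 (s.realVar 21 + σ * w), s.natArr, s.realArr⟩ := by
      simp [Cmd.process, ht, hz, hσ, hl, hw]
    rw [e]
    refine ⟨hpos, fun _ => ⟨rfl, fun x y => ?_⟩, fun h => absurd rfl h⟩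
    simp only [objective, linDev_one]
    simp
    ring
  · have e : (Cmd.process t).run s = ⟨Function.update s.natVar 23 (s.natVar 23 + 1), s.realVar,
        s.natArr, Function.update (Function.update (Function.update s.realArr
          0 (Function.update (s.realArr 0) (s.natVar 23) l))
          1 (Function.update (s.realArr 1) (s.natVar 23) r))
          2 (Function.update (s.realArr 2) (s.natVar 23) w)⟩ := by
      have : ¬ (z ≤ i ∧ i ≤ z) := fun h => hiz (le_antisymm h.2 h.1)
      simp [Cmd.process, ht, hz, hl, hr, hw, this]
    rw [e]
    refine ⟨fun k hk => ?_, fun h => absurd h hiz, fun _ => ⟨by simp, fun x y => ?_⟩⟩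
    · simp at hk
      by_cases hkm : k = s.natVar 23
      · simp [hkm, hw0]
      · simpa [hkm] using hpos k (by omega)
    · simp only [objective, linDev_one]
      simp [sum_range_succ]
      rw [sum_dev_congr (L' := s.realArr 0) (R' := s.realArr 1) (W' := s.realArr 2)]
      · ring
      all_goals
        intro k hk
        simp [hk.ne]

/-- Where `G < c` the selected residual has a fixed sign, so old and new function agree on a
half-plane containing that set, and `SameBelow.of_halfPlane` applies. The function `E` stands for
the items still to be processed. -/
theorem Cmd.process_sameBelow (t : ℕ) (s : State) (i z : ℕ) (σ l r w c γ : ℝ)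
    (G E : ℝ → ℝ → ℝ) (ht : s.natVar t = i)
    (hz : s.natVar 25 = z) (hσ : s.realVar 26 = σ) (hl : s.realArr 3 i = l)
    (hr : s.realArr 4 i = r) (hw : s.realArr 5 i = w)
    (hpos : ∀ k < s.natVar 23, 0 ≤ s.realArr 2 k) (hw0 : 0 ≤ w) (hE : SegConvex E)
    (hG : SameBelow c G fun x y => objective s x y + (dev l r w x y + E x y) + γ)
    (hne : ∃ x y, G x y < c) (hσ1 : σ = 1 ∨ σ = -1)
    (hside : i = z → ∀ x y, G x y < c → 0 < σ * (l * x + y - r)) :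
    ∃ γ, SameBelow c G fun x y => objective ((Cmd.process t).run s) x y + E x y + γ := by
  obtain ⟨h1, h2, h3⟩ := Cmd.process_run t s i z σ l r w ht hz hσ hl hr hw hpos hw0
  by_cases hiz : i = z
  · obtain ⟨-, h2⟩ := h2 hiz
    have hside := hside hiz
    refine ⟨γ - σ * w * r, hG.trans ?_⟩
    have hconv : SegConvex fun x y =>
        objective ((Cmd.process t).run s) x y + E x y + (γ - σ * w * r) :=
      ((segConvex_linDev h1).add hE).add_const _
    have hback : ∀ x y, objective s x y + (dev l r w x y + E x y) + γ < c → G x y < c :=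
      fun x y h => by rwa [hG x y (.inr h)]
    refine SameBelow.of_halfPlane (p := σ * l) (q := σ) (r := -(σ * r)) hconv ?_ ?_ ?_
    · obtain ⟨x, y, h⟩ := hne
      exact ⟨x, y, by simpa only [hG x y (.inl h)] using h⟩
    · intro x y h
      have := hside x y (hback x y h)
      linarith
    · intro x y h
      have e : |r - l * x - y| = σ * (l * x + y - r) := by
        rcases hσ1 with rfl | rfl
        · rw [abs_of_nonpos (by linarith)]; ring
        · rw [abs_of_nonneg (by linarith)]; ring
      simp only [h2, dev, e]
      ring
  · obtain ⟨-, h3⟩ := h3 hiz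
    refine ⟨γ, hG.trans (SameBelow.of_eq fun x y => ?_)⟩
    rw [h3]
    ring

def selectFootprint : Footprint := ⟨[24, 25], [], [], [], []⟩

/-- The value `n` in natural variable `25` means that neither item becomes linear, as all indices
are smaller. -/
theorem Cmd.select_run (s : State) (n k : ℕ) (L : ℕ → ℝ) (σx σy x₀ y₀ X Y : ℝ)
    (hn : s.natVar 20 = n) (hk : s.natVar 21 = k) (hL : s.realArr 3 = L)
    (hσx : s.realVar 24 = σx) (hσy : s.realVar 26 = σy) (hx : s.realVar 23 = x₀)
    (hy : s.realVar 25 = y₀) (hX : s.realArr 6 k = X) (hY : s.realArr 7 k = Y) :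
    (Cmd.select.run s).natVar 24 = n - 1 - k ∧
    (0 ≤ σx * (x₀ - X) ∧ 0 ≤ σy * (y₀ - Y) →
      (0 < σx * σy ∧ L k < L (n - 1 - k) → (Cmd.select.run s).natVar 25 = n - 1 - k) ∧
      (¬ (0 < σx * σy ∧ L k < L (n - 1 - k)) → (Cmd.select.run s).natVar 25 = k)) ∧
    (¬ (0 ≤ σx * (x₀ - X) ∧ 0 ≤ σy * (y₀ - Y)) → (Cmd.select.run s).natVar 25 = n) := by
  by_cases h1 : 0 ≤ σx * (x₀ - X) ∧ 0 ≤ σy * (y₀ - Y)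
  · by_cases h2 : 0 < σx * σy ∧ L k < L (n - 1 - k)
    · simp [Cmd.select, hn, hk, hL, hσx, hσy, hx, hy, hX, hY, h1, h2]
    · simp [Cmd.select, hn, hk, hL, hσx, hσy, hx, hy, hX, hY, h1, h2]
  · simp [Cmd.select, hn, hk, hσx, hσy, hx, hy, hX, hY, h1]

theorem sum_Ico_pair {n k : ℕ} (h : k < n - 1 - k) (f : ℕ → ℝ) :
    ∑ i ∈ Ico k (n - k), f i = f k + (f (n - 1 - k) + ∑ i ∈ Ico (k + 1) (n - (k + 1)), f i) := by
  rw [sum_eq_sum_Ico_succ_bot (by omega), show n - k = (n - (k + 1)) + 1 by omega,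
    sum_Ico_succ_top (by omega), show n - 1 - k = n - (k + 1) by omega]
  ring

theorem sum_Ico_middle {n k : ℕ} (h : k + 1 + k = n) (f : ℕ → ℝ) :
    ∑ i ∈ Ico k (n - k), f i = f k + ∑ i ∈ Ico (k + 1) (n - (k + 1)), f i := by
  rw [sum_eq_sum_Ico_succ_bot (by omega), show n - k = k + 1 by omega,
    Ico_eq_empty_of_le (by omega : n - (k + 1) ≤ k + 1), Ico_self]

def resolveFootprint : Footprint := ⟨[23, 24, 25], [20, 21], [], [0, 1, 2], []⟩

/-- Each crossing point in the closed quadrant opposite to the better points costs its pair exactly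
one item, so the number of survivors is known exactly. -/
theorem Cmd.resolve_runs {procs : List Cmd} (n : ℕ) (s : State) (L R W X Y : ℕ → ℝ)
    (a b σx σy x₀ y₀ c : ℝ) (hn : s.natVar 20 = n) (hh : s.natVar 22 = (n + 1) / 2)
    (ha : s.realVar 20 = a) (hb : s.realVar 21 = b) (hL : s.realArr 3 = L) (hR : s.realArr 4 = R)
    (hW : s.realArr 5 = W) (hX : ∀ k < (n + 1) / 2, s.realArr 6 k = X k)
    (hY : ∀ k < (n + 1) / 2, s.realArr 7 k = Y k) (hσx : s.realVar 24 = σx)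
    (hσy : s.realVar 26 = σy) (hx : s.realVar 23 = x₀) (hy : s.realVar 25 = y₀)
    (hpos : ∀ k < n, 0 ≤ W k) (hσy1 : σy = 1 ∨ σy = -1)
    (hne : ∃ x y, linDev n L (fun _ => 1) R W a b x y < c)
    (hside : ∀ k, 2 * k < n → 0 ≤ σx * (x₀ - X k) → 0 ≤ σy * (y₀ - Y k) → ∀ x y,
      linDev n L (fun _ => 1) R W a b x y < c →
      (0 < σx * σy → L k < L (n - 1 - k) →
        0 < σy * (L (n - 1 - k) * x + y - R (n - 1 - k))) ∧
      (¬ (0 < σx * σy ∧ L k < L (n - 1 - k)) → 0 < σy * (L k * x + y - R k))) :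
    Runs procs .resolve s (400 * n + 900) fun s' =>
      (∃ γ, SameBelow c (linDev n L (fun _ => 1) R W a b) fun x y => objective s' x y + γ) ∧
      (∀ k < s'.natVar 23, 0 ≤ s'.realArr 2 k) ∧
      (s'.natVar 23 : ℝ) + ∑ k ∈ range ((n + 1) / 2),
        (if 0 ≤ σx * (x₀ - X k) ∧ 0 ≤ σy * (y₀ - Y k) then (1 : ℝ) else 0) = n := by
  refine Runs.seq_simple rfl (K₂ := 400 * n + 850) ?_ (by simp [Cmd.bound, NExp.cost]; omega)
  -- After `j` pairs the items with indices in `[j, n - j)` are still untouched. The minimum in the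
  -- count is due to a self-paired middle item, which counts once.
  refine (Runs.forUp resolveFootprint 400 ((n + 1) / 2) (fun j s' =>
      (∃ γ, SameBelow c (linDev n L (fun _ => 1) R W a b) fun x y => objective s' x y +
        ∑ i ∈ Ico j (n - j), dev (L i) (R i) (W i) x y + γ) ∧
      (∀ k < s'.natVar 23, 0 ≤ s'.realArr 2 k) ∧
      (s'.natVar 23 : ℝ) + ∑ k ∈ range j,
        (if 0 ≤ σx * (x₀ - X k) ∧ 0 ≤ σy * (y₀ - Y k) then (1 : ℝ) else 0) =
          (min (2 * j) n : ℕ))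
    (by rfl) (by rfl) (by decide) (by decide) (by rfl) (by decide) (by simpa using hh)
    ?_ ?_).mono (by omega) ?_
  · refine ⟨⟨0, SameBelow.of_eq fun x y => ?_⟩, by simp, by simp⟩
    rw [linDev_one, range_eq_Ico]
    simp [objective, linDev_one, ha, hb]
    ring
  · rintro k hk s₁ hF hi ⟨⟨γ, hG⟩, hpos₁, hcount⟩
    have h2k : 2 * k < n := by omega
    have e20 : s₁.natVar 20 = n := by rw [hF.nat 20 (by decide)]; simpa using hn
    have e3 : s₁.realArr 3 = L := by rw [hF.realArr 3 (by decide)]; simpa using hL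
    have e4 : s₁.realArr 4 = R := by rw [hF.realArr 4 (by decide)]; simpa using hR
    have e5 : s₁.realArr 5 = W := by rw [hF.realArr 5 (by decide)]; simpa using hW
    have e6 : s₁.realArr 6 k = X k := by rw [hF.realArr 6 (by decide)]; simpa using hX k hk
    have e7 : s₁.realArr 7 k = Y k := by rw [hF.realArr 7 (by decide)]; simpa using hY k hk
    have e23 : s₁.realVar 23 = x₀ := by rw [hF.real 23 (by decide)]; simpa using hx
    have e24 : s₁.realVar 24 = σx := by rw [hF.real 24 (by decide)]; simpa using hσx
    have e25 : s₁.realVar 25 = y₀ := by rw [hF.real 25 (by decide)]; simpa using hy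
    have e26 : s₁.realVar 26 = σy := by rw [hF.real 26 (by decide)]; simpa using hσy
    obtain ⟨hsel24, hsel⟩ := Cmd.select_run s₁ n k L σx σy x₀ y₀ (X k) (Y k) e20 hi e3 e24 e26 e23
      e25 e6 e7
    have hFs := Cmd.frame_run (c := .select) selectFootprint rfl rfl rfl s₁
    obtain ⟨s₂, hs₂⟩ : ∃ t, Cmd.select.run s₁ = t := ⟨_, rfl⟩
    rw [hs₂] at hsel24 hsel hFs
    obtain ⟨j, hj⟩ : ∃ j, n - 1 - k = j := ⟨_, rfl⟩
    obtain ⟨z, hz⟩ : ∃ z, s₂.natVar 25 = z := ⟨_, rfl⟩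
    have hside := hside k h2k
    rw [hj] at hsel24 hsel hside
    rw [hz] at hsel
    have hjn : j < n := by omega
    have hkj : k ≤ j := by omega
    have hobj₂ : objective s₂ = objective s₁ := by
      unfold objective
      rw [hFs.nat 23 (by decide), hFs.real 20 (by decide), hFs.real 21 (by decide),
        hFs.realArr 0 (by decide), hFs.realArr 1 (by decide), hFs.realArr 2 (by decide)]
    rw [← hobj₂] at hG
    have e23' : s₂.natVar 23 = s₁.natVar 23 := hFs.nat 23 (by decide)
    have hpos₂ : ∀ k < s₂.natVar 23, 0 ≤ s₂.realArr 2 k := by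
      rw [e23', hFs.realArr 2 (by decide)]
      exact hpos₁
    have f21 : s₂.natVar 21 = k := by rw [hFs.nat 21 (by decide), hi]
    have f26 : s₂.realVar 26 = σy := by rw [hFs.real 26 (by decide), e26]
    have f3 : s₂.realArr 3 = L := by rw [hFs.realArr 3 (by decide), e3]
    have f4 : s₂.realArr 4 = R := by rw [hFs.realArr 4 (by decide), e4]
    have f5 : s₂.realArr 5 = W := by rw [hFs.realArr 5 (by decide), e5]
    obtain ⟨hA, hB, hC⟩ := Cmd.process_run 21 s₂ k z σy (L k) (R k) (W k) f21 hz f26 (by rw [f3])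
      (by rw [f4]) (by rw [f5]) hpos₂ (hpos k (by omega))
    have hFp := Cmd.frame_run (c := .process 21) processFootprint rfl rfl rfl s₂
    have hrem : SegConvex fun x y =>
        ∑ i ∈ Ico (k + 1) (n - (k + 1)), dev (L i) (R i) (W i) x y :=
      segConvex_sum_dev _ fun i hi => hpos i (by simp at hi; omega)
    have hsidek : k = z → ∀ x y, linDev n L (fun _ => 1) R W a b x y < c →
        0 < σy * (L k * x + y - R k) := by
      intro hkz x y hxy
      by_cases hres : 0 ≤ σx * (x₀ - X k) ∧ 0 ≤ σy * (y₀ - Y k)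
      · refine (hside hres.1 hres.2 x y hxy).2 fun hq => ?_
        -- Here the partner `j` was selected, so `k = z` leaves only a self-paired item, whose slope
        -- is not smaller than itself.
        have h1 := (hsel.1 hres).1 hq
        have : k = j := by omega
        rw [this] at hq
        exact lt_irrefl _ hq.2
      · have := hsel.2 hres
        omega
    have hstep := fun E hE γ hG => Cmd.process_sameBelow 21 s₂ k z σy (L k) (R k) (W k) c γ
      (linDev n L (fun _ => 1) R W a b) E f21 hz f26 (by rw [f3])
      (by rw [f4]) (by rw [f5]) hpos₂ (hpos k (by omega)) hE hG hne hσy1 hsidek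
    obtain ⟨s₃, hs₃⟩ : ∃ t, (Cmd.process 21).run s₂ = t := ⟨_, rfl⟩
    rw [hs₃] at hA hB hC hFp hstep
    have g21 : s₃.natVar 21 = k := by rw [hFp.nat 21 (by decide), f21]
    have g24 : s₃.natVar 24 = j := by rw [hFp.nat 24 (by decide), hsel24]
    have g25 : s₃.natVar 25 = z := by rw [hFp.nat 25 (by decide), hz]
    have g26 : s₃.realVar 26 = σy := by rw [hFp.real 26 (by decide), f26]
    have g3 : s₃.realArr 3 = L := by rw [hFp.realArr 3 (by decide), f3]
    have g4 : s₃.realArr 4 = R := by rw [hFp.realArr 4 (by decide), f4]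
    have g5 : s₃.realArr 5 = W := by rw [hFp.realArr 5 (by decide), f5]
    rw [sum_range_succ, ← add_assoc]
    have hrun : (Cmd.select ;; .process 21 ;; .cond (.natLt (.var 21) (.var 24)) (.process 24)
        .skip).run s₁ = if k < j then (Cmd.process 24).run s₃ else s₃ := by
      simp only [Cmd.run, hs₂, hs₃, BExp.Holds, NExp.eval, g21, g24]
    rw [hrun]
    by_cases hlt : k < j
    · rw [if_pos hlt]
      have hsum : ∀ f : ℕ → ℝ, ∑ i ∈ Ico k (n - k), f i =
          f k + (f j + ∑ i ∈ Ico (k + 1) (n - (k + 1)), f i) := fun f => by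
        rw [sum_Ico_pair (by omega), hj]
      obtain ⟨γ₁, hG₁⟩ := hstep (fun x y => dev (L j) (R j) (W j) x y +
        ∑ i ∈ Ico (k + 1) (n - (k + 1)), dev (L i) (R i) (W i) x y)
        (SegConvex.add (by
          simpa using segConvex_sum_dev (L := L) (R := R) (W := W) (singleton j)
            (by simpa using hpos j hjn)) hrem) γ
        (hG.trans (SameBelow.of_eq fun x y => by rw [hsum]))
      have hsidej : j = z → ∀ x y, linDev n L (fun _ => 1) R W a b x y < c →
          0 < σy * (L j * x + y - R j) := by
        intro hjz x y hxy
        by_cases hres : 0 ≤ σx * (x₀ - X k) ∧ 0 ≤ σy * (y₀ - Y k)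
        · by_cases hq : 0 < σx * σy ∧ L k < L j
          · exact (hside hres.1 hres.2 x y hxy).1 hq.1 hq.2
          · have := (hsel.1 hres).2 hq
            omega
        · have := hsel.2 hres
          omega
      obtain ⟨hA', hB', hC'⟩ := Cmd.process_run 24 s₃ j z σy (L j) (R j) (W j) g24 g25 g26
        (by rw [g3]) (by rw [g4]) (by rw [g5]) hA (hpos j hjn)
      obtain ⟨γ₂, hG₂⟩ := Cmd.process_sameBelow 24 s₃ j z σy (L j) (R j) (W j) c γ₁
        (linDev n L (fun _ => 1) R W a b) _ g24 g25 g26 (by rw [g3])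
        (by rw [g4]) (by rw [g5]) hA (hpos j hjn) hrem hG₁ hne hσy1 hsidej
      refine ⟨⟨γ₂, hG₂⟩, by simpa using hA', ?_⟩
      have hmin : (min (2 * (k + 1)) n : ℕ) = min (2 * k) n + 2 := by omega
      rw [hmin, Nat.cast_add, ← hcount]
      simp only [Function.update_of_ne (by decide : (23 : ℕ) ≠ 21)]
      by_cases hres : 0 ≤ σx * (x₀ - X k) ∧ 0 ≤ σy * (y₀ - Y k)
      · rw [if_pos hres]
        by_cases hq : 0 < σx * σy ∧ L k < L j
        · have hzj := (hsel.1 hres).1 hq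
          rw [(hB' hzj.symm).1, (hC (by omega)).1, e23']
          push_cast
          ring
        · have hzk := (hsel.1 hres).2 hq
          rw [(hC' (by omega)).1, (hB hzk.symm).1, e23']
          push_cast
          ring
      · rw [if_neg hres]
        have hzn := hsel.2 hres
        rw [(hC' (by omega)).1, (hC (by omega)).1, e23']
        push_cast
        ring
    · rw [if_neg hlt]
      have hkj' : k = j := by omega
      obtain ⟨γ₁, hG₁⟩ := hstep _ hrem γ
        (hG.trans (SameBelow.of_eq fun x y => by rw [sum_Ico_middle (by omega)]))
      refine ⟨⟨γ₁, hG₁⟩, by simpa using hA, ?_⟩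
      have hmin : (min (2 * (k + 1)) n : ℕ) = min (2 * k) n + 1 := by omega
      rw [hmin, Nat.cast_add, ← hcount]
      simp only [Function.update_of_ne (by decide : (23 : ℕ) ≠ 21)]
      by_cases hres : 0 ≤ σx * (x₀ - X k) ∧ 0 ≤ σy * (y₀ - Y k)
      · rw [if_pos hres]
        have hzk : z = k := by
          rcases em (0 < σx * σy ∧ L k < L j) with hq | hq
          · rw [(hsel.1 hres).1 hq, hkj']
          · exact (hsel.1 hres).2 hq
        rw [(hB hzk.symm).1, e23']
        push_cast
        ring
      · rw [if_neg hres]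
        have hzn := hsel.2 hres
        rw [(hC (by omega)).1, e23']
        push_cast
        ring
  · rintro s' ⟨-, ⟨γ, hG⟩, hp, hc⟩
    refine ⟨⟨γ, hG.trans (SameBelow.of_eq fun x y => ?_)⟩, hp, ?_⟩
    · rw [Ico_eq_empty_of_le (by omega : n - (n + 1) / 2 ≤ (n + 1) / 2), sum_empty, add_zero]
    · rw [hc, min_eq_right (by omega)]

/-! ### The recursion and its running time -/

/-- A round leaves at most seven eighths of the items, so `1000000 * n` steps are available for the
round itself. -/
def searchTime (n : ℕ) : ℕ := 8000000 * n + 10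

/-- The procedure `1` minimises functions with `n` absolute values. -/
def SearchSpec (procs : List Cmd) (n : ℕ) : Prop :=
  ∀ (s : State) (m : ℝ), s.natVar 20 = n → (∀ k < n, 0 ≤ s.realArr 2 k) →
    (∀ x y, m ≤ linDev n (s.realArr 0) (fun _ => 1) (s.realArr 1) (s.realArr 2) (s.realVar 20)
      (s.realVar 21) x y) →
    Runs procs (.call 1) s (searchTime n) fun s' => ∀ x y,
      linDev n (s.realArr 0) (fun _ => 1) (s.realArr 1) (s.realArr 2) (s.realVar 20) (s.realVar 21)
        (s'.realVar 27) (s'.realVar 28) ≤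
      linDev n (s.realArr 0) (fun _ => 1) (s.realArr 1) (s.realArr 2) (s.realVar 20) (s.realVar 21)
        x y

/-- The memory after the items have been partitioned. -/
structure Partitioned (s : State) (n : ℕ) (L R W : ℕ → ℝ) (a b lam : ℝ) : Prop where
  card : s.natVar 20 = n
  linear₁ : s.realVar 20 = a
  linear₂ : s.realVar 21 = b
  slope : s.realVar 22 = lam
  arr₃ : s.realArr 3 = L
  arr₄ : s.realArr 4 = R
  arr₅ : s.realArr 5 = W

theorem Partitioned.frame {s s' : State} {n : ℕ} {L R W : ℕ → ℝ} {a b lam : ℝ}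
    (h : Partitioned s n L R W a b lam) {A : Footprint} (hF : Frame A s s') (h₁ : 20 ∉ A.nat)
    (h₂ : 20 ∉ A.real) (h₃ : 21 ∉ A.real) (h₄ : 22 ∉ A.real) (h₅ : 3 ∉ A.realArr)
    (h₆ : 4 ∉ A.realArr) (h₇ : 5 ∉ A.realArr) : Partitioned s' n L R W a b lam :=
  ⟨(hF.nat _ h₁).trans h.card, (hF.real _ h₂).trans h.linear₁, (hF.real _ h₃).trans h.linear₂,
    (hF.real _ h₄).trans h.slope, (hF.realArr _ h₅).trans h.arr₃, (hF.realArr _ h₆).trans h.arr₄,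
    (hF.realArr _ h₇).trans h.arr₅⟩

theorem Partitioned.setReal {s : State} {n : ℕ} {L R W : ℕ → ℝ} {a b lam : ℝ}
    (h : Partitioned s n L R W a b lam) (i : ℕ) (e : RExp) (h₁ : i ≠ 20) (h₂ : i ≠ 21)
    (h₃ : i ≠ 22) : Partitioned ((Cmd.setReal i e).run s) n L R W a b lam := by
  obtain ⟨g₁, g₂, g₃, g₄, g₅, g₆, g₇⟩ := h
  constructor <;> simp [*, h₁.symm, h₂.symm, h₃.symm]

theorem half_count {n : ℕ} {V : ℕ → ℝ} {u σ : ℝ} (hσ : σ = 1 ∨ σ = -1)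
    (h₁ : (n : ℝ) ≤ 2 * ∑ k ∈ range n, (if V k ≤ u then (1 : ℝ) else 0))
    (h₂ : (n : ℝ) ≤ 2 * ∑ k ∈ range n, (if u ≤ V k then (1 : ℝ) else 0)) :
    (n : ℝ) ≤ 2 * ∑ k ∈ range n, (if 0 ≤ σ * (u - V k) then (1 : ℝ) else 0) := by
  rcases hσ with rfl | rfl
  · simpa using h₁
  · simpa using h₂

/-- The recursive call needs a function bounded below: the pruned function equals the old one below
`c` and is at least `c` elsewhere. -/
theorem SameBelow.bounded {c m γ : ℝ} {F G : ℝ → ℝ → ℝ}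
    (h : SameBelow c F fun x y => G x y + γ) (hm : ∀ x y, m ≤ F x y) (x y : ℝ) :
    min m c - γ ≤ G x y := by
  by_cases hc : G x y + γ < c
  · have := h x y (.inr hc)
    have := hm x y
    have := min_le_left m c
    linarith
  · have := min_le_right m c
    linarith

theorem quantileTime_mono {m n : ℕ} (h : m ≤ n) : quantileTime m ≤ quantileTime n := by
  unfold quantileTime
  omega

/-- The nesting follows the sequence of commands; `7000000 * n + 10` bounds the time of the
recursive call with at most `7 * n / 8` items. -/
theorem descend_time {n : ℕ} (hn : 0 < n) :
    (200 * n + 300) + ((quantileTime n + 20) + (5 + ((200 * n + 300) +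
      ((3 * quantileTime n + (2000 * n + 5000)) + (5 + ((400 * n + 900) +
      (10 + (7000000 * n + 10) + 1) + 1 + 10) + 1) + 1) + 1) + 1) + 1) + 1 ≤ 7430000 * n := by
  unfold quantileTime
  omega

theorem search_time {n : ℕ} (hn : 0 < n) :
    3 + ((100 * n + 110) + ((quantileTime n + 20) + (5 + ((600 * n + 700) + ((200 * n + 300) +
      ((quantileTime n + 20) + (5 + ((200 * n + 300) + ((3 * quantileTime n + (2000 * n + 5000)) +
      (5 + (7430000 * n + 10) + 1) + 1) + 1) + 1) + 1) + 1) + 1) + 1) + 1) + 1) + 1 + 1 ≤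
      searchTime n := by
  unfold quantileTime searchTime
  omega

theorem Cmd.descend_runs {procs : List Cmd} (hp : procs[0]? = some .quantile) (n : ℕ)
    (hn0 : 0 < n) (ih : ∀ n', 8 * n' ≤ 7 * n → SearchSpec procs n')
    (s : State) (L R W X Y : ℕ → ℝ) (a b lam σ x₀ c m : ℝ) (hs : Partitioned s n L R W a b lam)
    (hh : s.natVar 22 = (n + 1) / 2) (hx : s.realVar 23 = x₀) (hσ : s.realVar 24 = σ)
    (hX6 : ∀ k < (n + 1) / 2, s.realArr 6 k = X k) (hY7 : ∀ k < (n + 1) / 2, s.realArr 7 k = Y k)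
    (hX : ∀ k, X k = (R (n - 1 - k) - R k) / (L (n - 1 - k) - L k))
    (hY : ∀ k, Y k = R k - (L k - lam) * X k)
    (hlam : ∀ k, 2 * k < n → L k ≤ lam ∧ lam ≤ L (n - 1 - k))
    (hpos : ∀ k < n, 0 ≤ W k) (hm : ∀ x y, m ≤ linDev n L (fun _ => 1) R W a b x y)
    (hσ1 : σ = 1 ∨ σ = -1) (hne : ∃ x y, linDev n L (fun _ => 1) R W a b x y < c)
    (hside : ∀ x y, linDev n L (fun _ => 1) R W a b x y < c → 0 < σ * (x - x₀))
    (hcount : (((n + 1) / 2 : ℕ) : ℝ) ≤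
      2 * ∑ k ∈ range ((n + 1) / 2), (if 0 ≤ σ * (x₀ - X k) then (1 : ℝ) else 0)) :
    Runs procs .descend s (7430000 * n) fun s' => ∀ x y,
      linDev n L (fun _ => 1) R W a b (s'.realVar 27) (s'.realVar 28) ≤
        linDev n L (fun _ => 1) R W a b x y := by
  refine Runs.mono ?_ (descend_time hn0) (fun _ h => h)
  refine Runs.seq ((Cmd.collect_runs ((n + 1) / 2) s X Y σ x₀ hh hσ hx hX6 hY7).mono (by omega)
    fun _ h => h) ?_ le_rfl
  rintro s₁ ⟨hF₁, hφ₁, hM₁⟩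
  obtain ⟨m₁, hm₁⟩ : ∃ m₁, s₁.natVar 23 = m₁ := ⟨_, rfl⟩
  rw [hm₁] at hφ₁ hM₁
  have hs₁ := hs.frame hF₁ (by decide) (by decide) (by decide) (by decide) (by decide) (by decide)
    (by decide)
  have hm₁c : (m₁ : ℝ) =
      ∑ k ∈ range ((n + 1) / 2), (if 0 ≤ σ * (x₀ - X k) then (1 : ℝ) else 0) := by
    rw [← hφ₁ fun _ => 1]
    simp
  have hm₁n : m₁ ≤ (n + 1) / 2 := by
    have : (m₁ : ℝ) ≤ ((n + 1) / 2 : ℕ) := by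
      rw [hm₁c, sum_boole]
      exact_mod_cast (card_filter_le _ _).trans (card_range _).le
    exact_mod_cast this
  refine Runs.seq ((Cmd.median_runs hp 23 m₁ s₁ (s₁.realArr 10) (by decide) hm₁ (fun _ _ => rfl)
    hM₁).mono (Nat.add_le_add_right (quantileTime_mono (by omega)) _) fun _ h => h) ?_ le_rfl
  rintro s₂ ⟨hF₂, hq₁, hq₂⟩
  obtain ⟨y₀, hy₀⟩ : ∃ y₀, s₂.realVar 0 = y₀ := ⟨_, rfl⟩
  rw [hy₀] at hq₁ hq₂
  have hs₂ := hs₁.frame hF₂ (by decide) (by decide) (by decide) (by decide) (by decide) (by decide)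
    (by decide)
  refine Runs.seq (P := fun t => t = (Cmd.setReal 25 (.var 0)).run s₂)
    (Runs.of_simple rfl (by simp [Cmd.bound, RExp.cost]) rfl) ?_ le_rfl
  rintro s₃ rfl
  have hs₃ := hs₂.setReal 25 (.var 0) (by decide) (by decide) (by decide)
  have hF₃ : Frame ⟨[], [25], [], [], []⟩ s₂ ((Cmd.setReal 25 (.var 0)).run s₂) :=
    Cmd.frame_run _ rfl rfl rfl s₂
  have e₃ : ((Cmd.setReal 25 (.var 0)).run s₂).realVar 25 = y₀ := by simp [hy₀]
  generalize (Cmd.setReal 25 (.var 0)).run s₂ = s₃ at hs₃ hF₃ e₃ ⊢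
  refine Runs.seq (Cmd.prepareSloped_runs n s₃ L R W a b lam y₀ hs₃.card hs₃.linear₁ hs₃.linear₂
    hs₃.slope e₃ (fun _ => congrFun hs₃.arr₃ _) (fun _ => congrFun hs₃.arr₄ _)
    (fun _ => congrFun hs₃.arr₅ _)) ?_ le_rfl
  rintro s₄ ⟨hF₄, h12, h13, h20, h21, h22, h25⟩
  have hs₄ := hs₃.frame hF₄ (by decide) (by decide) (by decide) (by decide) (by decide) (by decide)
    (by decide)
  refine Runs.seq (Cmd.lineTest_runs hp n s₄ _ _ _ W b (a - b * lam) (m - b * y₀) hs₄.card h20 h21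
    h22 h25 h12 h13 hpos fun y x => ?_) ?_ le_rfl
  · rw [linDev_sloped]
    linarith [hm x (y₀ + y - lam * x)]
  rintro s₅ ⟨hF₅, htest⟩
  have hs₅ := hs₄.frame hF₅ (by decide) (by decide) (by decide) (by decide) (by decide) (by decide)
    (by decide)
  refine Runs.seq (P := fun t => t = (Cmd.setReal 26 (.var 14)).run s₅)
    (Runs.of_simple rfl (by simp [Cmd.bound, RExp.cost]) rfl) ?_ le_rfl
  rintro s₆ rfl
  have hs₆ := hs₅.setReal 26 (.var 14) (by decide) (by decide) (by decide)
  have hF₆ : Frame ⟨[], [26], [], [], []⟩ s₅ ((Cmd.setReal 26 (.var 14)).run s₅) :=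
    Cmd.frame_run _ rfl rfl rfl s₅
  have e₆ : ((Cmd.setReal 26 (.var 14)).run s₅).realVar 26 = s₅.realVar 14 := by simp
  generalize (Cmd.setReal 26 (.var 14)).run s₅ = s₆ at hs₆ hF₆ e₆ ⊢
  obtain ⟨τ, hτ⟩ : ∃ τ, s₅.realVar 14 = τ := ⟨_, rfl⟩
  obtain ⟨u, hu⟩ : ∃ u, s₅.realVar 15 = u := ⟨_, rfl⟩
  rw [hτ] at e₆
  rw [hτ, hu] at htest
  have e15 : s₆.realVar 15 = u := (hF₆.real 15 (by decide)).trans hu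
  have e25 : s₆.realVar 25 = y₀ := by
    rw [hF₆.real 25 (by decide), hF₅.real 25 (by decide), hF₄.real 25 (by decide), e₃]
  rcases htest.sloped with ⟨h0, hmin⟩ | ⟨hτ1, hne', hside'⟩
  · refine Runs.cond (fun hb => ?_) (fun _ => ?_) (K₁ := (400 * n + 900) +
      (10 + (7000000 * n + 10) + 1) + 1) (by simp [BExp.cost, RExp.cost]; omega)
    · simp [e₆, h0] at hb
    · refine Runs.of_simple rfl (by simp [Cmd.bound, RExp.cost]; omega) ?_
      simpa [e15, e25, hs₆.slope] using hmin
  · have hττ : 0 < τ * τ := by rcases hτ1 with rfl | rfl <;> norm_num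
    refine Runs.cond (fun _ => ?_) (fun hb => ?_) (K₁ := (400 * n + 900) +
      (10 + (7000000 * n + 10) + 1) + 1) (by simp [BExp.cost, RExp.cost]; omega)
    swap
    · simp [e₆, hττ] at hb
    -- Below the smaller of the two levels the conclusions of both line tests hold, which gives the
    -- open quadrant.
    obtain ⟨c', hc'⟩ : ∃ c', c' = min c (linDev n L (fun _ => 1) R W a b u (y₀ - lam * u)) :=
      ⟨_, rfl⟩
    have hne'' : ∃ x y, linDev n L (fun _ => 1) R W a b x y < c' := by
      obtain ⟨x, y, h⟩ := hne
      obtain ⟨x', y', h'⟩ := hne'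
      rw [hc']
      rcases le_total c (linDev n L (fun _ => 1) R W a b u (y₀ - lam * u)) with hle | hle
      · exact ⟨x, y, lt_min h (h.trans_le hle)⟩
      · exact ⟨x', y', lt_min (h'.trans_le hle) h'⟩
    have e22 : s₆.natVar 22 = (n + 1) / 2 := by
      rw [hF₆.nat 22 (by decide), hF₅.nat 22 (by decide), hF₄.nat 22 (by decide),
        hF₃.nat 22 (by decide), hF₂.nat 22 (by decide), hF₁.nat 22 (by decide), hh]
    have e23 : s₆.realVar 23 = x₀ := by
      rw [hF₆.real 23 (by decide), hF₅.real 23 (by decide), hF₄.real 23 (by decide),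
        hF₃.real 23 (by decide), hF₂.real 23 (by decide), hF₁.real 23 (by decide), hx]
    have e24 : s₆.realVar 24 = σ := by
      rw [hF₆.real 24 (by decide), hF₅.real 24 (by decide), hF₄.real 24 (by decide),
        hF₃.real 24 (by decide), hF₂.real 24 (by decide), hF₁.real 24 (by decide), hσ]
    have e6 : s₆.realArr 6 = s.realArr 6 := by
      rw [hF₆.realArr 6 (by decide), hF₅.realArr 6 (by decide), hF₄.realArr 6 (by decide),
        hF₃.realArr 6 (by decide), hF₂.realArr 6 (by decide), hF₁.realArr 6 (by decide)]
    have e7 : s₆.realArr 7 = s.realArr 7 := by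
      rw [hF₆.realArr 7 (by decide), hF₅.realArr 7 (by decide), hF₄.realArr 7 (by decide),
        hF₃.realArr 7 (by decide), hF₂.realArr 7 (by decide), hF₁.realArr 7 (by decide)]
    refine Runs.seq (Cmd.resolve_runs n s₆ L R W X Y a b σ τ x₀ y₀ c' hs₆.card e22 hs₆.linear₁
      hs₆.linear₂ hs₆.arr₃ hs₆.arr₄ hs₆.arr₅ (by simpa only [e6] using hX6)
      (by simpa only [e7] using hY7) e24 e₆ e23 e25 hpos hτ1 hne'' ?_) ?_ le_rfl
    · intro k hk h₁ h₂ x y hxy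
      rw [hc', lt_min_iff] at hxy
      exact pair_side (hlam k hk).1 (hlam k hk).2 (hX k) (hY k) hσ1 hτ1 h₁ h₂ (hside x y hxy.1)
        (hside' x y hxy.2)
    rintro s₇ ⟨⟨γ, hγ⟩, hpos₇, hcard⟩
    have hn' : 8 * s₇.natVar 23 ≤ 7 * n := by
      -- At least half of the pairs are on the wrong side of the first line, and at least half of
      -- these on the wrong side of the second: a quarter of at least `n / 2` pairs.
      have hq := half_count hτ1 hq₁ hq₂
      rw [hφ₁ fun v => if 0 ≤ τ * (y₀ - v) then (1 : ℝ) else 0] at hq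
      simp only [← ite_and] at hq
      rw [← hm₁c] at hcount
      have h2 : (n : ℝ) ≤ 2 * ((n + 1) / 2 : ℕ) := by exact_mod_cast (by omega)
      have : (8 * s₇.natVar 23 : ℝ) ≤ 7 * n := by linarith
      exact_mod_cast this
    refine Runs.seq_simple rfl (K₂ := 7000000 * n + 10) ?_
      (by simp [Cmd.bound, NExp.cost])
    refine (ih (s₇.natVar 23) hn' ((Cmd.setNat 20 (.var 23)).run s₇) _ (by simp) hpos₇
      (hγ.bounded hm)).mono (by unfold searchTime; omega) ?_
    intro s₈ hs₈
    refine hγ.isMin hne'' fun x y => ?_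
    have := hs₈ x y
    simpa [objective] using this

theorem Cmd.search_spec {procs : List Cmd} (hp : procs[0]? = some .quantile)
    (hp₁ : procs[1]? = some .search) (n : ℕ) : SearchSpec procs n := by
  induction n using Nat.strong_induction_on with
  | _ n ih =>
  intro s m hn hpos hm
  obtain ⟨a, ha⟩ : ∃ a, s.realVar 20 = a := ⟨_, rfl⟩
  obtain ⟨b, hb⟩ : ∃ b, s.realVar 21 = b := ⟨_, rfl⟩
  rw [ha, hb] at hm ⊢
  rcases Nat.eq_zero_or_pos n with rfl | hn0
  · refine Runs.call (K₁ := 9) hp₁ (Runs.cond (K₁ := 5) (fun h => ?_) (fun _ => ?_)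
      (by simp [BExp.cost, NExp.cost])) (by simp [searchTime])
    · simp [hn] at h
    · refine Runs.of_simple rfl (by simp [Cmd.bound, RExp.cost]) fun x y => ?_
      by_contra! hneg
      simp [linDev] at hneg hm
      -- A linear function bounded below vanishes: at this multiple of `(x, y)` it would take the
      -- value `m - 1`.
      have := hm ((m - 1) / (a * x + b * y) * x) ((m - 1) / (a * x + b * y) * y)
      have e : a * ((m - 1) / (a * x + b * y) * x) + b * ((m - 1) / (a * x + b * y) * y) =
          (m - 1) / (a * x + b * y) * (a * x + b * y) := by ring
      rw [e, div_mul_cancel₀ _ hneg.ne] at this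
      linarith
  refine Runs.mono ?_ (search_time hn0) (fun _ h => h)
  refine Runs.call hp₁ (Runs.cond (fun _ => ?_) (fun h => ?_) le_rfl) le_rfl
  swap
  · simp [hn, hn0] at h
  refine Runs.seq (Cmd.copySlopes_runs n s hn) ?_ le_rfl
  rintro s₁ ⟨hF₁, hV, hM⟩
  refine Runs.seq (Cmd.median_runs hp 20 n s₁ (s.realArr 0) (by decide)
    ((hF₁.nat 20 (by decide)).trans hn) hV hM) ?_ le_rfl
  rintro s₂ ⟨hF₂, hq₁, hq₂⟩
  obtain ⟨lam, hlam⟩ : ∃ lam, s₂.realVar 0 = lam := ⟨_, rfl⟩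
  rw [hlam] at hq₁ hq₂
  refine Runs.seq (P := fun t => t = (Cmd.setReal 22 (.var 0)).run s₂)
    (Runs.of_simple rfl (by simp [Cmd.bound, RExp.cost]) rfl) ?_ le_rfl
  rintro s₃ rfl
  have hF₃ : Frame ⟨[], [22], [], [], []⟩ s₂ ((Cmd.setReal 22 (.var 0)).run s₂) :=
    Cmd.frame_run _ rfl rfl rfl s₂
  have e₃ : ((Cmd.setReal 22 (.var 0)).run s₂).realVar 22 = lam := by simp [hlam]
  generalize (Cmd.setReal 22 (.var 0)).run s₂ = s₃ at hF₃ e₃ ⊢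
  have e20 : s₃.natVar 20 = n := by
    rw [hF₃.nat 20 (by decide), hF₂.nat 20 (by decide), hF₁.nat 20 (by decide), hn]
  have earr : ∀ i < 3, s₃.realArr i = s.realArr i := by
    intro i hi
    rw [hF₃.realArr i (by simp), hF₂.realArr i (by simp [quantileFootprint]; omega),
      hF₁.realArr i (by simp; omega)]
  refine Runs.seq (Cmd.partition_runs n s₃ (s.realArr 0) (s.realArr 1) (s.realArr 2) lam e20 e₃
    (by simp [earr]) (by simp [earr]) (by simp [earr]) hq₁ hq₂) ?_ le_rfl
  rintro s₄ ⟨hF₄, hφ, hW, hlam'⟩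
  have hs₄ : Partitioned s₄ n (s₄.realArr 3) (s₄.realArr 4) (s₄.realArr 5) a b lam := by
    refine ⟨(hF₄.nat 20 (by decide)).trans e20, ?_, ?_, (hF₄.real 22 (by decide)).trans e₃, rfl,
      rfl, rfl⟩
    · rw [hF₄.real 20 (by decide), hF₃.real 20 (by decide), hF₂.real 20 (by decide),
        hF₁.real 20 (by decide), ha]
    · rw [hF₄.real 21 (by decide), hF₃.real 21 (by decide), hF₂.real 21 (by decide),
        hF₁.real 21 (by decide), hb]
  generalize s₄.realArr 3 = L at *
  generalize s₄.realArr 4 = R at *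
  generalize s₄.realArr 5 = W at *
  -- The partition only rearranges the items, so the function to be minimised is unchanged.
  have hG : ∀ x y, linDev n (s.realArr 0) (fun _ => 1) (s.realArr 1) (s.realArr 2) a b x y =
      linDev n L (fun _ => 1) R W a b x y := by
    intro x y
    rw [linDev_one, linDev_one, hφ fun l r w => dev l r w x y]
  simp only [hG] at hm ⊢
  have hposW : ∀ k < n, 0 ≤ W k := by
    intro k hk
    obtain ⟨i, hi, e⟩ := hW k hk
    rw [e]
    exact hpos i hi
  obtain ⟨X, hX⟩ : ∃ X : ℕ → ℝ, ∀ k, X k = (R (n - 1 - k) - R k) / (L (n - 1 - k) - L k) :=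
    ⟨_, fun _ => rfl⟩
  obtain ⟨Y, hY⟩ : ∃ Y : ℕ → ℝ, ∀ k, Y k = R k - (L k - lam) * X k := ⟨_, fun _ => rfl⟩
  refine Runs.seq (Cmd.crossings_runs n s₄ L R X Y lam hs₄.card hs₄.slope (congrFun hs₄.arr₃)
    (congrFun hs₄.arr₄) hX hY) ?_ le_rfl
  rintro s₅ ⟨hF₅, h22, h6, h7, h10, h11⟩
  have hs₅ := hs₄.frame hF₅ (by decide) (by decide) (by decide) (by decide) (by decide) (by decide)
    (by decide)
  refine Runs.seq ((Cmd.median_runs hp 22 _ s₅ X (by decide) h22 h10 h11).mono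
    (Nat.add_le_add_right (quantileTime_mono (n := n) (by omega)) _) fun _ h => h) ?_ le_rfl
  rintro s₆ ⟨hF₆, hp₁, hp₂⟩
  have hs₆ := hs₅.frame hF₆ (by decide) (by decide) (by decide) (by decide) (by decide) (by decide)
    (by decide)
  obtain ⟨x₀, hx₀⟩ : ∃ x₀, s₆.realVar 0 = x₀ := ⟨_, rfl⟩
  rw [hx₀] at hp₁ hp₂
  refine Runs.seq (P := fun t => t = (Cmd.setReal 23 (.var 0)).run s₆)
    (Runs.of_simple rfl (by simp [Cmd.bound, RExp.cost]) rfl) ?_ le_rfl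
  rintro s₇ rfl
  have hs₇ := hs₆.setReal 23 (.var 0) (by decide) (by decide) (by decide)
  have hF₇ : Frame ⟨[], [23], [], [], []⟩ s₆ ((Cmd.setReal 23 (.var 0)).run s₆) :=
    Cmd.frame_run _ rfl rfl rfl s₆
  have e₇ : ((Cmd.setReal 23 (.var 0)).run s₆).realVar 23 = x₀ := by simp [hx₀]
  generalize (Cmd.setReal 23 (.var 0)).run s₆ = s₇ at hs₇ hF₇ e₇ ⊢
  refine Runs.seq (Cmd.prepareVertical_runs n s₇ L R W a b x₀ hs₇.card hs₇.linear₁ hs₇.linear₂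
    e₇ (congrFun hs₇.arr₃) (congrFun hs₇.arr₄) (congrFun hs₇.arr₅)) ?_ le_rfl
  rintro s₈ ⟨hF₈, h12, h13, h20, h21, h22', h25⟩
  have hs₈ := hs₇.frame hF₈ (by decide) (by decide) (by decide) (by decide) (by decide) (by decide)
    (by decide)
  refine Runs.seq (Cmd.lineTest_runs hp n s₈ _ _ _ W a b (m - a * x₀) hs₈.card h20 h21
    h22' h25 h12 h13 hposW fun x y => ?_) ?_ le_rfl
  · rw [linDev_vertical]
    linarith [hm (x₀ + x) y]
  rintro s₉ ⟨hF₉, htest⟩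
  have hs₉ := hs₈.frame hF₉ (by decide) (by decide) (by decide) (by decide) (by decide) (by decide)
    (by decide)
  refine Runs.seq (P := fun t => t = (Cmd.setReal 24 (.var 14)).run s₉)
    (Runs.of_simple rfl (by simp [Cmd.bound, RExp.cost]) rfl) ?_ le_rfl
  rintro t rfl
  have ht := hs₉.setReal 24 (.var 14) (by decide) (by decide) (by decide)
  have hFt : Frame ⟨[], [24], [], [], []⟩ s₉ ((Cmd.setReal 24 (.var 14)).run s₉) :=
    Cmd.frame_run _ rfl rfl rfl s₉
  have e24 : ((Cmd.setReal 24 (.var 14)).run s₉).realVar 24 = s₉.realVar 14 := by simp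
  generalize (Cmd.setReal 24 (.var 14)).run s₉ = t at ht hFt e24 ⊢
  obtain ⟨σ, hσ⟩ : ∃ σ, s₉.realVar 14 = σ := ⟨_, rfl⟩
  obtain ⟨u, hu⟩ : ∃ u, s₉.realVar 15 = u := ⟨_, rfl⟩
  rw [hσ] at e24
  rw [hσ, hu] at htest
  have e15 : t.realVar 15 = u := (hFt.real 15 (by decide)).trans hu
  have e23 : t.realVar 23 = x₀ := by
    rw [hFt.real 23 (by decide), hF₉.real 23 (by decide), hF₈.real 23 (by decide), e₇]
  rcases htest.vertical with ⟨h0, hmin⟩ | ⟨hσ1, hne, hside⟩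
  · refine Runs.cond (fun hb => ?_) (fun _ => ?_) (K₁ := 7430000 * n)
      (by simp [BExp.cost, RExp.cost]; omega)
    · simp [e24, h0] at hb
    · refine Runs.of_simple rfl (by simp [Cmd.bound, RExp.cost]; omega) ?_
      simpa [e15, e23] using hmin
  · have hσσ : 0 < σ * σ := by rcases hσ1 with rfl | rfl <;> norm_num
    refine Runs.cond (fun _ => ?_) (fun hb => ?_) (K₁ := 7430000 * n)
      (by simp [BExp.cost, RExp.cost]; omega)
    swap
    · simp [e24, hσσ] at hb
    refine Cmd.descend_runs hp n hn0 (fun n' hn' => ih n' (by omega)) t L R W X Y a b lam σ x₀ _ m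
      ht ?_ e23 e24 ?_ ?_ hX hY hlam' hposW hm hσ1 hne hside (half_count hσ1 hp₁ hp₂)
    · rw [hFt.nat 22 (by decide), hF₉.nat 22 (by decide), hF₈.nat 22 (by decide),
        hF₇.nat 22 (by decide), hF₆.nat 22 (by decide), h22]
    · rwa [hFt.realArr 6 (by decide), hF₉.realArr 6 (by decide), hF₈.realArr 6 (by decide),
        hF₇.realArr 6 (by decide), hF₆.realArr 6 (by decide)]
    · rwa [hFt.realArr 7 (by decide), hF₉.realArr 7 (by decide), hF₈.realArr 7 (by decide),
        hF₇.realArr 7 (by decide), hF₆.realArr 7 (by decide)]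

/-! ### Exact penalties and the tariff program -/

/-- Prepare the objective function in the variables `x = p - f` and `y = f`, with penalties for
negative prices. -/
def Cmd.prepare : Cmd :=
  .forUp 21 0
    (.setReal 29 (.add (.var 29) (.mul (.read 2 (.var 21)) (.read 0 (.var 21)))) ;;
    .setReal 30 (.add (.var 30) (.read 2 (.var 21))) ;;
    .setReal 31 (.add (.const 1) (.read 0 (.var 21))) ;;
    .writeReal 0 (.var 21) (.div (.read 0 (.var 21)) (.var 31)) ;;
    .writeReal 1 (.var 21) (.div (.read 1 (.var 21)) (.var 31)) ;;
    .writeReal 2 (.var 21) (.mul (.read 2 (.var 21)) (.var 31)))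

/-- The slopes `1` and `0` with reference `0` give `|x + y| = |p|` and `|y| = |f|`. The substitution
`x = p - f` is what gives the first of these the coefficient `1` at `y`. -/
def Cmd.addPenalties : Cmd :=
  .writeReal 0 (.var 0) (.const 1) ;;
  .writeReal 1 (.var 0) (.const 0) ;;
  .writeReal 2 (.var 0) (.var 29) ;;
  .writeReal 0 (.add (.var 0) (.const 1)) (.const 0) ;;
  .writeReal 1 (.add (.var 0) (.const 1)) (.const 0) ;;
  .writeReal 2 (.add (.var 0) (.const 1)) (.var 30) ;;
  .setReal 20 (.sub (.const 0) (.var 29)) ;;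
  .setReal 21 (.sub (.sub (.const 0) (.var 29)) (.var 30)) ;;
  .setNat 20 (.add (.var 0) (.const 2))

def Cmd.output : Cmd :=
  .setReal 0 (.add (.var 27) (.var 28)) ;;
  .cond (.realLt (.var 0) (.const 0)) (.setReal 0 (.const 0)) .skip ;;
  .setReal 1 (.var 28) ;;
  .cond (.realLt (.var 1) (.const 0)) (.setReal 1 (.const 0)) .skip

/-- The program for the affine distance tariff design problem. -/
def tariffProgram : Program :=
  ⟨.prepare ;; .addPenalties ;; .call 1 ;; .output, [.quantile, .search]⟩

/-- The sum of absolute deviations for OD pairs given by arrays. -/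
def tariffDev (n : ℕ) (l r t : ℕ → ℝ) (p f : ℝ) : ℝ :=
  ∑ k ∈ range n, t k * |r k - (p * l k + f)|

theorem Cmd.prepare_runs {procs : List Cmd} (n : ℕ) (s : State) (l r t : ℕ → ℝ)
    (hn : s.natVar 0 = n) (hl : s.realArr 0 = l) (hr : s.realArr 1 = r) (ht : s.realArr 2 = t)
    (h29 : s.realVar 29 = 0) (h30 : s.realVar 30 = 0) :
    Runs procs .prepare s (100 * n + 110) fun s' =>
      s'.natVar 0 = n ∧ s'.realVar 29 = ∑ k ∈ range n, t k * l k ∧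
      s'.realVar 30 = ∑ k ∈ range n, t k ∧ (∀ k < n, s'.realArr 0 k = l k / (1 + l k)) ∧
      (∀ k < n, s'.realArr 1 k = r k / (1 + l k)) ∧
      (∀ k < n, s'.realArr 2 k = t k * (1 + l k)) := by
  refine (Runs.forUp ⟨[], [29, 30, 31], [], [0, 1, 2], []⟩ 100 n (fun j s' =>
    s'.realVar 29 = ∑ k ∈ range j, t k * l k ∧ s'.realVar 30 = ∑ k ∈ range j, t k ∧
    (∀ k, s'.realArr 0 k = if k < j then l k / (1 + l k) else l k) ∧
    (∀ k, s'.realArr 1 k = if k < j then r k / (1 + l k) else r k) ∧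
    (∀ k, s'.realArr 2 k = if k < j then t k * (1 + l k) else t k))
    rfl rfl (by simp) (by simp) rfl (by decide) hn (by simp [*]) ?_).mono (by omega) ?_
  · rintro j hj s' hF hi ⟨g29, g30, g0, g1, g2⟩
    have e0 := g0 j
    have e1 := g1 j
    have e2 := g2 j
    simp only [lt_irrefl, if_false] at e0 e1 e2
    simp [hi, e0, e1, e2, g29, g30, sum_range_succ]
    refine ⟨fun k => ?_, fun k => ?_, fun k => ?_⟩
    all_goals
      by_cases hkj : k = j
      · simp [hkj]
      · simp [hkj, g0, g1, g2, show k ≤ j ↔ k < j by omega]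
  · rintro s' ⟨hF, g29, g30, g0, g1, g2⟩
    refine ⟨(hF.nat 0 (by decide)).trans hn, g29, g30, fun k hk => ?_, fun k hk => ?_,
      fun k hk => ?_⟩
    · rw [g0, if_pos hk]
    · rw [g1, if_pos hk]
    · rw [g2, if_pos hk]

/-- Truncation shifts a residual by at most `l * (|p| - p) + (|f| - f)`. As the penalty vanishes for
nonnegative prices, a truncated unconstrained minimiser of the penalised function is optimal. -/
theorem tariffDev_max_le {n : ℕ} {l r t : ℕ → ℝ} (hl : ∀ k < n, 0 ≤ l k) (ht : ∀ k < n, 0 ≤ t k)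
    (p f : ℝ) :
    tariffDev n l r t (max p 0) (max f 0) ≤ tariffDev n l r t p f +
      (∑ k ∈ range n, t k * l k) * (|p| - p) + (∑ k ∈ range n, t k) * (|f| - f) := by
  unfold tariffDev
  rw [sum_mul, sum_mul, ← sum_add_distrib, ← sum_add_distrib]
  refine sum_le_sum fun k hk => ?_
  rw [mem_range] at hk
  have h₁ : 0 ≤ max p 0 - p := sub_nonneg.2 (le_max_left _ _)
  have h₂ : 0 ≤ max f 0 - f := sub_nonneg.2 (le_max_left _ _)
  have h₃ : max p 0 ≤ |p| := max_le (le_abs_self p) (abs_nonneg p)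
  have h₄ : max f 0 ≤ |f| := max_le (le_abs_self f) (abs_nonneg f)
  have key : |r k - (max p 0 * l k + max f 0)| ≤
      |r k - (p * l k + f)| + (l k * (|p| - p) + (|f| - f)) := by
    have e : r k - (max p 0 * l k + max f 0) =
        r k - (p * l k + f) + -(l k * (max p 0 - p) + (max f 0 - f)) := by ring
    have h₅ := mul_nonneg (hl k hk) h₁
    have h₆ := mul_le_mul_of_nonneg_left (sub_le_sub_right h₃ p) (hl k hk)
    rw [e]
    refine (abs_add_le _ _).trans (add_le_add_right ?_ _)
    rw [abs_neg, abs_of_nonneg (add_nonneg h₅ h₂)]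
    linarith
  refine (mul_le_mul_of_nonneg_left key (ht k hk)).trans (le_of_eq ?_)
  ring

theorem tariffDev_nonneg {n : ℕ} {l r t : ℕ → ℝ} (ht : ∀ k < n, 0 ≤ t k) (p f : ℝ) :
    0 ≤ tariffDev n l r t p f :=
  sum_nonneg fun k hk => mul_nonneg (ht k (mem_range.1 hk)) (abs_nonneg _)

/-- The function which is handed to `Cmd.search`. -/
theorem linDev_eq_tariffDev {n : ℕ} {l r t L R W : ℕ → ℝ} {wp wf : ℝ} (hl : ∀ k < n, 0 ≤ l k)
    (hL : ∀ k < n, L k = l k / (1 + l k)) (hR : ∀ k < n, R k = r k / (1 + l k))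
    (hW : ∀ k < n, W k = t k * (1 + l k)) (hL₀ : L n = 1) (hR₀ : R n = 0) (hW₀ : W n = wp)
    (hL₁ : L (n + 1) = 0) (hR₁ : R (n + 1) = 0) (hW₁ : W (n + 1) = wf) (x y : ℝ) :
    linDev (n + 2) L (fun _ => 1) R W (-wp) (-wp - wf) x y =
      tariffDev n l r t (x + y) y + wp * (|x + y| - (x + y)) + wf * (|y| - y) := by
  have h : ∑ k ∈ range n, dev (L k) (R k) (W k) x y = tariffDev n l r t (x + y) y := by
    refine sum_congr rfl fun k hk => ?_
    rw [mem_range] at hk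
    -- In the new variables the residual is `r - l * x - (1 + l) * y`; the positive factor moves
    -- into the weight.
    have h1 : 0 < 1 + l k := by linarith [hl k hk]
    rw [dev, hL k hk, hR k hk, hW k hk, mul_assoc]
    congr 1
    rw [← abs_of_pos h1, ← abs_mul, abs_of_pos h1]
    congr 1
    field_simp
    ring
  rw [linDev_one, sum_range_succ, sum_range_succ, h, hL₀, hR₀, hW₀, hL₁, hR₁, hW₁]
  have e₁ : |0 - 1 * x - y| = |x + y| := by rw [← abs_neg]; congr 1; ring
  have e₂ : |0 - 0 * x - y| = |y| := by rw [← abs_neg]; congr 1; ring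
  rw [dev, dev, e₁, e₂]
  ring

theorem Cmd.output_run (s : State) (x y : ℝ) (hx : s.realVar 27 = x) (hy : s.realVar 28 = y) :
    (Cmd.output.run s).realVar 0 = max (x + y) 0 ∧ (Cmd.output.run s).realVar 1 = max y 0 := by
  by_cases h₁ : x + y < 0 <;> by_cases h₂ : y < 0 <;>
    simp [Cmd.output, hx, hy, h₁, h₂, le_of_lt, not_lt.1]

theorem tariffProgram_runs (n : ℕ) (s : State) (l r t : ℕ → ℝ)
    (hn : s.natVar 0 = n) (hl : s.realArr 0 = l) (hr : s.realArr 1 = r) (ht : s.realArr 2 = t)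
    (h29 : s.realVar 29 = 0) (h30 : s.realVar 30 = 0) (hl₀ : ∀ k < n, 0 ≤ l k)
    (ht₀ : ∀ k < n, 0 ≤ t k) :
    Runs tariffProgram.procs tariffProgram.main s (20000000 * (n + 1)) fun s' =>
      0 ≤ s'.realVar 0 ∧ 0 ≤ s'.realVar 1 ∧ ∀ p f, 0 ≤ p → 0 ≤ f →
        tariffDev n l r t (s'.realVar 0) (s'.realVar 1) ≤ tariffDev n l r t p f := by
  refine Runs.mono (K₁ := 100 * n + 110 + (100 + (searchTime (n + 2) + 100 + 1) + 1) + 1) ?_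
    (by unfold searchTime; omega) fun _ h => h
  refine Runs.seq (Cmd.prepare_runs n s l r t hn hl hr ht h29 h30) ?_ le_rfl
  rintro s₁ ⟨g0, g29, g30, gL, gR, gW⟩
  obtain ⟨wp, hwp⟩ : ∃ wp, wp = ∑ k ∈ range n, t k * l k := ⟨_, rfl⟩
  obtain ⟨wf, hwf⟩ : ∃ wf, wf = ∑ k ∈ range n, t k := ⟨_, rfl⟩
  rw [← hwp] at g29
  rw [← hwf] at g30
  have hwp₀ : 0 ≤ wp := hwp ▸ sum_nonneg fun k hk =>
    mul_nonneg (ht₀ k (mem_range.1 hk)) (hl₀ k (mem_range.1 hk))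
  have hwf₀ : 0 ≤ wf := hwf ▸ sum_nonneg fun k hk => ht₀ k (mem_range.1 hk)
  refine Runs.seq (P := fun t => t = Cmd.addPenalties.run s₁)
    (Runs.of_simple rfl (by decide) rfl) ?_ le_rfl
  rintro s₂ rfl
  obtain ⟨s₂, hs₂⟩ : ∃ s₂, Cmd.addPenalties.run s₁ = s₂ := ⟨_, rfl⟩
  have e20 : s₂.natVar 20 = n + 2 := by simp [← hs₂, Cmd.addPenalties, g0]
  have r20 : s₂.realVar 20 = -wp := by simp [← hs₂, Cmd.addPenalties, g29]
  have r21 : s₂.realVar 21 = -wp - wf := by simp [← hs₂, Cmd.addPenalties, g29, g30]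
  have a0 : s₂.realArr 0 = Function.update (Function.update (s₁.realArr 0) n 1) (n + 1) 0 := by
    simp [← hs₂, Cmd.addPenalties, g0]
  have a1 : s₂.realArr 1 = Function.update (Function.update (s₁.realArr 1) n 0) (n + 1) 0 := by
    simp [← hs₂, Cmd.addPenalties, g0]
  have a2 : s₂.realArr 2 = Function.update (Function.update (s₁.realArr 2) n wp) (n + 1) wf := by
    simp [← hs₂, Cmd.addPenalties, g0, g29, g30]
  rw [hs₂]
  have hW : ∀ k < n, s₂.realArr 2 k = t k * (1 + l k) := fun k hk => by
    rw [a2, Function.update_of_ne (by omega), Function.update_of_ne (by omega), gW k hk]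
  have hG := linDev_eq_tariffDev (r := r) (t := t) (L := s₂.realArr 0) (R := s₂.realArr 1)
    (W := s₂.realArr 2) (wp := wp) (wf := wf) hl₀
    (fun k hk => by
      rw [a0, Function.update_of_ne (by omega), Function.update_of_ne (by omega), gL k hk])
    (fun k hk => by
      rw [a1, Function.update_of_ne (by omega), Function.update_of_ne (by omega), gR k hk]) hW
    (by simp [a0]) (by simp [a1]) (by simp [a2]) (by simp [a0]) (by simp [a1]) (by simp [a2])
  have hspec := Cmd.search_spec (procs := tariffProgram.procs) rfl rfl (n + 2) s₂ 0 e20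
    (fun k hk => by
      rcases lt_or_ge k n with h | h
      · rw [hW k h]
        exact mul_nonneg (ht₀ k h) (by linarith [hl₀ k h])
      · obtain rfl | rfl : k = n ∨ k = n + 1 := by omega
        · simpa [a2] using hwp₀
        · simpa [a2] using hwf₀)
    (fun x y => by
      rw [r20, r21, hG]
      have h1 := tariffDev_nonneg (l := l) (r := r) ht₀ (x + y) y
      have h2 := mul_nonneg hwp₀ (sub_nonneg.2 (le_abs_self (x + y)))
      have h3 := mul_nonneg hwf₀ (sub_nonneg.2 (le_abs_self y))
      linarith)
  rw [r20, r21] at hspec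
  simp only [hG] at hspec
  refine Runs.seq hspec ?_ le_rfl
  intro s₃ hmin
  refine Runs.of_simple rfl (by decide) ?_
  obtain ⟨o₁, o₂⟩ := Cmd.output_run s₃ _ _ rfl rfl
  rw [o₁, o₂]
  refine ⟨le_max_right _ _, le_max_right _ _, fun p f hp hf => ?_⟩
  have h₁ := tariffDev_max_le (r := r) hl₀ ht₀ (s₃.realVar 27 + s₃.realVar 28) (s₃.realVar 28)
  -- This point represents the competitor `(p, f)`, whose penalties vanish.
  have h₂ := hmin (p - f) f
  rw [sub_add_cancel, abs_of_nonneg hp, abs_of_nonneg hf] at h₂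
  rw [← hwp, ← hwf] at h₁
  linarith

end RealRAM

/-- There is one real-RAM program which, for every instance of the affine distance tariff design
problem, halts after at most `C * (|D| + 1)` steps with an optimal price per kilometer `p` in the
real variable `0` and an optimal base amount `f` in the real variable `1`. -/
theorem mainTheorem6 :
    ∃ (P : RealRAM.Program) (C : ℕ),
      ∀ (D : Type*) [Fintype D] (I : AffineDistanceInstance D) (e : Fin (Fintype.card D) ≃ D),
        ∃ (k : ℕ) (s : RealRAM.State),
          P.HaltsIn (I.inputState e) k s ∧
          k ≤ C * (Fintype.card D + 1) ∧
          I.IsOptimal (s.realVar 0) (s.realVar 1) := by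
  refine ⟨RealRAM.tariffProgram, 20000000, fun D _ I e => ?_⟩
  have hdev : ∀ p f, RealRAM.tariffDev (Fintype.card D) ((I.inputState e).realArr 0)
      ((I.inputState e).realArr 1) ((I.inputState e).realArr 2) p f = I.deviation p f := by
    intro p f
    rw [RealRAM.tariffDev, AffineDistanceInstance.deviation, Finset.sum_range, ← e.sum_comp]
    simp [AffineDistanceInstance.inputState]
  obtain ⟨k, s, h, hk, h₁, h₂, h₃⟩ := RealRAM.tariffProgram_runs (Fintype.card D) (I.inputState e)
    _ _ _ rfl rfl rfl rfl rfl rfl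
    (fun j hj => by simpa [AffineDistanceInstance.inputState, hj] using I.dist_nonneg _)
    (fun j hj => by simp [AffineDistanceInstance.inputState, hj])
  simp only [hdev] at h₃
  exact ⟨k, s, h, hk, h₁, h₂, h₃⟩
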